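/- **Setting.** Let $1\le k\le n$ be integers and let $\Sigma$ be an alphabet with $|\Sigma|\le n^3$. Put $L=\lceil\log_{3/2}n\rceil+3$. Let $\Sigma_c=\bigcup_{\ell=1}^{L}\Sigma_c^\ell$, where the $\Sigma_c^\ell$ are pairwise disjoint alphabets of size $n^4$, let $\Sigma_r=\{\mathtt r_{a,r}: a\in\Sigma\cup\Sigma_c,\ 2\le r\le n\}$, $\Gamma=\Sigma\cup\Sigma_c\cup\Sigma_r$ (disjoint union) and $\#\notin\Gamma$. Put $R=\log^*|\Gamma|+20$, $D=110R(L+1)k$ and $m=\lceil 5\log_2 n\rceil$. $\mathrm{ED}$ is the edit distance (insertions, deletions, substitutions), $w[p,\dots]$ is the suffix of $w$ that starts at position $p$ (empty if $p>|w|$), and $\mathrm{Dict}(B)$ is the set of pairs of consecutive symbols of $B$. **Coloring.** A *local coloring* is a function $F:\Gamma^*\to\{1,2,3\}^*$ such that for every $w\in\Gamma^*$ without two equal consecutive symbols: $|F(w)|=|w|$; the color at a position depends only on the symbols (and ends of $w$) seen at distance at most $R$ from that position; no two consecutive colors are equal; among any three consecutive colors one is $1$; if $|w|=1$ then $F(w)=3$;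 if $|w|\ge2$ then $F(w)$ starts with $1$ and ends with $2$ or $3$. **Random choices.** A finite nonempty set $\mathcal H$ of functions $U\to V$ is pair-wise independent if $\Pr_{h\in\mathcal H}[h(u)=v,\ h(u')=v']=1/|V|^2$ for all $u\ne u'$ in $U$ and $v,v'\in V$. Independently and uniformly from pair-wise independent sets, choose $C_\ell:\Gamma^2\to\Sigma_c^\ell$ for $1\le\ell\le L$, and $h_{\ell,i}:\Gamma^2\to\{0,\dots,mD-1\}$ for $0\le\ell\le L$, $1\le i\le m$. Let $H_\ell(ab)=0$ if $\prod_i h_{\ell,i}(ab)=0$ and $H_\ell(ab)=1$ otherwise. **Decomposition algorithm** (for a local coloring $F$). * $\mathrm{Compress}(B,\ell)$: divide $B$ into the minimum number of blocks such that each maximal subword $a^r$ with $r\ge2$ is a block. Replace such a block by $\mathtt r_{a,r}$. Copy a block of one symbol. Cut every other block $w$ in front of each symbol that $F(w)$ colors $1$, and replace the resulting parts $ab$ by $C_\ell(ab)$ and $abc$ by $C_\ell(ab)\,c$. * $\mathrm{Split}(B,\ell)$: start a new block at each position $i\in\{2,\dots,|B|-1\}$ with $H_\ell(B[i]B[i+1])=0$,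 and return the sequence of blocks. * $\mathrm{Process}(B,(D_1,\dots,D_{\ell-1}),\ell)$: if $|B|\le2$, output the grammar that consists of the rule $\#\to B$, of all rules $c\to ab$ of $D_{\ell-1},\dots,D_1$ (in this order) whose left-hand side $c\in\Sigma_c$ is needed, i.e. $c$ or some $\mathtt r_{c,r}$ occurs in $B$ or in a rule already taken, and of the rules $\mathtt r_{a,r}\to a^r$ for all $\mathtt r_{a,r}$ that occur in those rules. Otherwise let $D_\ell=\{C_\ell(ab)\to ab: ab\in\mathrm{Dict}(B)\}$, and run $\mathrm{Process}(B',(D_1,\dots,D_\ell),\ell+1)$ on each block $B'$ of $\mathrm{Split}(\mathrm{Compress}(B,\ell),\ell)$ in turn. * On input $x\in\Sigma^*$, run $\mathrm{Process}(B,(),1)$ on each block $B$ of $\mathrm{Split}(x,0)$ in turn; the output is the sequence of grammars. A grammar is deterministic if no letter of $\Sigma$ and every other symbol at most once is the left-hand side of a rule. For a deterministic grammar $G$, $\mathrm{eval}(G)$ is the word over $\Sigma$ obtained from $\#$ by rewriting; otherwise, or if there is no such word, $\mathrm{eval}(G)$ is undefined. **Theorem.** Local colorings exist, and for every local coloring $F$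 and all pair-wise independent sets as above the following holds. Let $u,v,x,y\in\Sigma^*$ with $|ux|\le n$, $|vy|\le n$ and $\mathrm{ED}(x,y)\le k$. Let $G^x_1,\dots,G^x_s$ and $G^y_1,\dots,G^y_{s'}$ be the outputs of the decomposition algorithm on $ux$ and on $vy$ with the same random functions $C_1,\dots,C_L,H_0,\dots,H_L$. With probability at least $1-1/5$ there are integers $r,r'\ge1$, $1\le t\le s$ and $1\le t'\le s'$ such that $s-t=s'-t'$, the evaluations of $G^x_t,\dots,G^x_s$ and of $G^y_{t'},\dots,G^y_{s'}$ are defined, $$x=\mathrm{eval}(G^x_t)[r,\dots]\cdot\mathrm{eval}(G^x_{t+1})\cdots\mathrm{eval}(G^x_s),\qquad y=\mathrm{eval}(G^y_{t'})[r',\dots]\cdot\mathrm{eval}(G^y_{t'+1})\cdots\mathrm{eval}(G^y_{s'}),$$ and $$\mathrm{ED}(x,y)=\mathrm{ED}\bigl(\mathrm{eval}(G^x_t)[r,\dots],\mathrm{eval}(G^y_{t'})[r',\dots]\bigr)+\sum_{i=1}^{s-t}\mathrm{ED}\bigl(\mathrm{eval}(G^x_{t+i}),\mathrm{eval}(G^y_{t'+i})\bigr).$$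 -/

import Mathlib

namespace EDDecomp

/-! ### Edit distance, uniform probability, pair-wise independence, iterated logarithm -/

/-- One edit operation: a letter is inserted, deleted or substituted. -/
inductive EditStep {α : Type*} : List α → List α → Prop
  | insert (p q : List α) (a : α) : EditStep (p ++ q) (p ++ a :: q)
  | delete (p q : List α) (a : α) : EditStep (p ++ a :: q) (p ++ q)
  | subst (p q : List α) (a b : α) : EditStep (p ++ a :: q) (p ++ b :: q)

/-- `EditPath m x y`: `m` edit operations change `x` into `y`. -/
inductive EditPath {α : Type*} : ℕ → List α → List α → Prop
  | refl (x : List α) : EditPath 0 x x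
  | step {m : ℕ} {x y z : List α} : EditPath m x y → EditStep y z → EditPath (m + 1) x z

/-- The edit distance: the least number of edit operations that change `x` into `y`. -/
noncomputable def editDist {α : Type*} (x y : List α) : ℕ := sInf {m : ℕ | EditPath m x y}

open Classical in
/-- The probability of the event `P` for a uniformly random element of the finite set `A`. -/
noncomputable def uniformProb {Ω : Type*} (A : Finset Ω) (P : Ω → Prop) : ℝ :=
  ((A.filter P).card : ℝ) / (A.card : ℝ)

/-- A (nonempty, finite) pair-wise independent system of hash functions `U → V`. -/
def PairwiseIndependent {U V : Type*} [Fintype V] (F : Finset (U → V)) : Prop :=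
  F.Nonempty ∧ ∀ u u' : U, u ≠ u' → ∀ v v' : V,
    uniformProb F (fun h => h u = v ∧ h u' = v') = 1 / (Fintype.card V : ℝ) ^ 2

/-- The iterated binary logarithm: the least number of times `log₂` has to be applied to `N` to
reach a value at most `1`. (Rounding the intermediate logarithms up does not change that number.) -/
noncomputable def logStar (N : ℕ) : ℕ := sInf {i : ℕ | (Nat.clog 2)^[i] N ≤ 1}

/-! ### Locally consistent colorings -/

/-- The symbol of `x` at the (0-based) integer position `p`, if there is one. -/
def symbolAt {α : Type*} (x : List α) (p : ℤ) : Option α :=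
  if 0 ≤ p then x[p.toNat]? else none

/-- No two consecutive symbols of `x` are the same. -/
def NoRepeat {α : Type*} (x : List α) : Prop := x.IsChain (fun a b => a ≠ b)

/-- `F` is a locally consistent coloring by `1, 2, 3`, of radius `R`, of the strings over `α` that
have no two equal consecutive symbols. -/
structure IsLocalColoring {α : Type*} (R : ℕ) (F : List α → List ℕ) : Prop where
  colors : ∀ x, NoRepeat x → ∀ c ∈ F x, c = 1 ∨ c = 2 ∨ c = 3
  length : ∀ x, NoRepeat x → (F x).length = x.length
  /-- The color at a position is a function of the symbols (and ends of the string) that are seen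
  at distance at most `R` from that position. -/
  local_dep : ∀ x x', NoRepeat x → NoRepeat x' → ∀ i i' : ℕ,
    (∀ d : ℤ, |d| ≤ (R : ℤ) → symbolAt x (i + d) = symbolAt x' (i' + d)) →
      symbolAt (F x) i = symbolAt (F x') i'
  proper : ∀ x, NoRepeat x → NoRepeat (F x)
  /-- Among any three consecutive colors one is `1`. -/
  one_in_three : ∀ x, NoRepeat x → ∀ p q a b c, F x = p ++ [a, b, c] ++ q →
    a = 1 ∨ b = 1 ∨ c = 1
  single : ∀ a, F [a] = [3]
  first : ∀ x, NoRepeat x → 2 ≤ x.length → (F x).head? = some 1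
  last : ∀ x, NoRepeat x → 2 ≤ x.length →
    (F x).getLast? = some 2 ∨ (F x).getLast? = some 3

/-! ### Alphabets and parameters -/

/-- The depth `L = ⌈log_{3/2} n⌉ + 3`. -/
noncomputable def depth (n : ℕ) : ℕ := ⌈Real.logb (3 / 2) n⌉₊ + 3

/-- The alphabet `Σ_c` of compression symbols: `n ^ 4` of them on each level. The pair `(ℓ, i)`
is a symbol of level `ℓ + 1`. -/
abbrev Comp (n : ℕ) : Type := Fin (depth n) × Fin (n ^ 4)

/-- `Σ ∪ Σ_c`. -/
abbrev Base (S : Type*) (n : ℕ) : Type _ := S ⊕ Comp n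

/-- The working alphabet `Γ = Σ ∪ Σ_c ∪ Σ_r`, where `Σ_r` consists of the symbols
`r_{a,r}` with `a ∈ Σ ∪ Σ_c` and `2 ≤ r ≤ n`. -/
abbrev Gam (S : Type*) (n : ℕ) : Type _ := Base S n ⊕ (Base S n × ↥(Finset.Icc 2 n))

section
variable {S : Type*} {n : ℕ}

/-- A letter of `Σ` as a symbol of `Γ`. -/
abbrev letter (a : S) : Gam S n := Sum.inl (Sum.inl a)

/-- A symbol of `Σ_c` as a symbol of `Γ`. -/
abbrev compSym (c : Comp n) : Gam S n := Sum.inl (Sum.inr c)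

/-- The symbol `r_{b,r}` as a symbol of `Γ`. -/
abbrev repSym (b : Base S n) (r : ↥(Finset.Icc 2 n)) : Gam S n := Sum.inr (b, r)

end

/-- The coloring radius `R = log* |Γ| + 20`. -/
noncomputable def radius (S : Type*) [Fintype S] (n : ℕ) : ℕ :=
  logStar (Fintype.card (Gam S n)) + 20

/-- The splitting parameter `D = 110 R (L + 1) k`. -/
noncomputable def splitParam (S : Type*) [Fintype S] (n k : ℕ) : ℕ :=
  110 * radius S n * (depth n + 1) * k

/-- The number `⌈5 log₂ n⌉` of hash functions in an iterated hash function. -/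
noncomputable def iterNum (n : ℕ) : ℕ := ⌈5 * Real.logb 2 n⌉₊

/-- The iterated function built from `h₁, …, h_m`: it is `0` where the product of the `h_i` is `0`,
and `1` elsewhere. -/
def iteratedHash {U : Type*} {m N : ℕ} (h : Fin m → U → Fin N) (p : U) : ℕ :=
  if ∏ i, (h i p : ℕ) = 0 then 0 else 1

/-! ### Compress -/

/-- A block of a string: a repetition `a ^ r`, or a word without equal adjacent symbols. -/
inductive Piece (α : Type*) where
  | rep (a : α) (r : ℕ) : Piece α
  | plain (w : List α) : Piece α

/-- Prepend one symbol to a string that is already divided into pieces. -/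
def consPiece {α : Type*} [DecidableEq α] (a : α) : List (Piece α) → List (Piece α)
  | [] => [.plain [a]]
  | .rep b r :: ps => if a = b then .rep b (r + 1) :: ps else .plain [a] :: .rep b r :: ps
  | .plain [] :: ps => .plain [a] :: ps
  | .plain [b] :: ps => if a = b then .rep b 2 :: ps else .plain [a, b] :: ps
  | .plain (b :: c :: w) :: ps =>
      if a = b then .rep b 2 :: .plain (c :: w) :: ps else .plain (a :: b :: c :: w) :: ps

/-- The division of a string into the minimum number of blocks such that each maximal subword
`a ^ r`, `r ≥ 2`, is one of the blocks. -/
def pieces {α : Type*} [DecidableEq α] (B : List α) : List (Piece α) := B.foldr consPiece []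

section
variable {S : Type*} {n : ℕ}

/-- The symbol that replaces a block `a ^ r`: it is `r_{a,r}` for `a ∈ Σ ∪ Σ_c`, and `r_{b,rs}` for
`a = r_{b,s}`. (If the exponent is not in `{2, …, n}`, there is no such symbol and the value is the
dummy `a`.) -/
noncomputable def repeatSymbol (a : Gam S n) (r : ℕ) : Gam S n :=
  match a with
  | Sum.inl b => if h : r ∈ Finset.Icc 2 n then repSym b ⟨r, h⟩ else a
  | Sum.inr (b, s) => if h : r * (s : ℕ) ∈ Finset.Icc 2 n then repSym b ⟨r * s, h⟩ else a

/-- Compression of a colored block without equal adjacent symbols: it is cut before each symbol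
colored `1`, a part `ab` is replaced by `C(ab)` and a part `abc` by `C(ab) c`; a block of one symbol
is copied. -/
def compressPlain (C : Gam S n × Gam S n → Comp n) : List (Gam S n × ℕ) → List (Gam S n)
  | [] => []
  | [(a, _)] => [a]
  | [(a, _), (b, _)] => [compSym (C (a, b))]
  | (a, _) :: (b, _) :: (c, col) :: w =>
      if col = 1 then compSym (C (a, b)) :: compressPlain C ((c, col) :: w)
      else compSym (C (a, b)) :: c :: compressPlain C w

/-- `Compress(B, ℓ)`, with coloring function `F` and compression hash function `C = C_ℓ`. -/
noncomputable def compress [DecidableEq S] (F : List (Gam S n) → List ℕ) (C : Gam S n × Gam S n → Comp n)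
    (B : List (Gam S n)) : List (Gam S n) :=
  (pieces B).flatMap fun
    | .rep a r => [repeatSymbol a r]
    | .plain w => compressPlain C (w.zip (F w))

end

/-! ### Split -/

/-- Put a symbol in front of the first block. -/
def consHead {α : Type*} (a : α) : List (List α) → List (List α)
  | [] => [[a]]
  | B :: Bs => (a :: B) :: Bs

/-- `Split(B, ℓ)` with `H = H_ℓ`: a new block starts at each position `i ∈ {2, …, |B| - 1}` such that
`H(B[i, i+1]) = 0`. -/
def split {α : Type*} (H : α × α → ℕ) : List α → List (List α)
  | a :: b :: c :: w =>
      if H (b, c) = 0 then [a] :: split H (b :: c :: w) else consHead a (split H (b :: c :: w))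
  | [] => [[]]
  | [a] => [[a]]
  | [a, b] => [[a, b]]

/-! ### Grammars -/

/-- A grammar: a set of rules `c → w`, where `c` is a symbol of `Γ` or the starting symbol
`# = none`, and `w` is a word over `Γ`. -/
abbrev Gramm (S : Type*) (n : ℕ) : Type _ := Set (Option (Gam S n) × List (Gam S n))

section
variable {S : Type*} {n : ℕ}

/-- A deterministic grammar: letters of `Σ` are not rewritten, and each other symbol is the left-hand
side of at most one rule. -/
def Deterministic (G : Gramm S n) : Prop :=
  (∀ (a : S) (w : List (Gam S n)), (some (letter a), w) ∉ G) ∧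
    ∀ c w w', (c, w) ∈ G → (c, w') ∈ G → w = w'

/-- `Produces G f z`: iterated (leftmost) rewriting by the rules of `G` takes the word `f` over
`Γ ∪ {#}` to the word `z` over `Σ`. -/
inductive Produces (G : Gramm S n) : List (Option (Gam S n)) → List S → Prop
  | nil : Produces G [] []
  | terminal (a : S) {f : List (Option (Gam S n))} {z : List S} :
      Produces G f z → Produces G (some (letter a) :: f) (a :: z)
  | rewrite {c : Option (Gam S n)} {w : List (Gam S n)} {f : List (Option (Gam S n))}
      {z : List S} : (c, w) ∈ G → Produces G (w.map some ++ f) z → Produces G (c :: f) z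

/-- The evaluation `eval(G)` is defined and equal to `z`. -/
def IsEval (G : Gramm S n) (z : List S) : Prop := Deterministic G ∧ Produces G [none] z

/-- A partial grammar: a set of rules `c → ab` with `c ∈ Σ_c`, `a, b ∈ Γ`. -/
abbrev PartialGramm (S : Type*) (n : ℕ) : Type _ := Set (Comp n × (Gam S n × Gam S n))

/-- `{C(ab) → ab : ab ∈ Dict(B)}`, where `Dict(B)` is the set of pairs of consecutive symbols. -/
def dictRules (C : Gam S n × Gam S n → Comp n) (B : List (Gam S n)) : PartialGramm S n :=
  {ρ | ρ.2 ∈ B.zip B.tail ∧ ρ.1 = C ρ.2}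

/-- The compression symbols `c` with `a = c` or `a = r_{c,r}` for some `r`. -/
def compOf : Gam S n → Set (Comp n)
  | Sum.inl (Sum.inr c) => {c}
  | Sum.inr (Sum.inr c, _) => {c}
  | _ => ∅

/-- The rules collected by the main loop of `Grammar`, from the partial grammars (the last one
first) and the set `K` of symbols that need a rule. -/
def collectRules : List (PartialGramm S n) → Set (Comp n) → Gramm S n
  | [], _ => ∅
  | D :: Ds, K =>
      {ρ | ∃ c a b, c ∈ K ∧ (c, (a, b)) ∈ D ∧ ρ = (some (compSym c), [a, b])} ∪
        collectRules Ds
          (K ∪ {c' | ∃ c a b, c ∈ K ∧ (c, (a, b)) ∈ D ∧ (c' ∈ compOf a ∨ c' ∈ compOf b)})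

/-- The rules of `Grammar` before those for repetitions are added. -/
def coreGrammar (B : List (Gam S n)) (Ds : List (PartialGramm S n)) : Gramm S n :=
  {(none, B)} ∪ collectRules Ds {c | ∃ a ∈ B, c ∈ compOf a}

/-- `Grammar(B, (D₁, …, D_ℓ), ℓ)`; the list of partial grammars is `D_ℓ, …, D₁`. -/
def grammarOf (B : List (Gam S n)) (Ds : List (PartialGramm S n)) : Gramm S n :=
  coreGrammar B Ds ∪
    {ρ | ∃ b r, (∃ σ ∈ coreGrammar B Ds, repSym b r ∈ σ.2) ∧
      ρ = (some (repSym b r), List.replicate (r : ℕ) (Sum.inl b))}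

/-! ### The decomposition algorithm -/

/-- `Process(B, (D₁, …, D_{ℓ-1}), ℓ)`. The first argument after `F` lists the remaining pairs of
hash functions `(C_ℓ, H_ℓ), …, (C_L, H_L)`; the partial grammars are listed as `D_{ℓ-1}, …, D₁`. -/
noncomputable def process [DecidableEq S] (F : List (Gam S n) → List ℕ) :
    List ((Gam S n × Gam S n → Comp n) × (Gam S n × Gam S n → ℕ)) →
      List (Gam S n) → List (PartialGramm S n) → List (Gramm S n)
  | [], B, Ds => [grammarOf B Ds]
  | (C, H) :: rest, B, Ds =>
      if B.length ≤ 2 then [grammarOf B Ds]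
      else (split H (compress F C B)).flatMap fun B' => process F rest B' (dictRules C B :: Ds)

end

/-- The random choices: for each level `ℓ + 1 ∈ {1, …, L}` a compression function into the symbols
of that level, and for each level in `{0, …, L}` the functions that make up the splitting
function. -/
abbrev Choices (S : Type*) [Fintype S] (n k : ℕ) : Type _ :=
  (Fin (depth n) → Gam S n × Gam S n → Fin (n ^ 4)) ×
    (Fin (depth n + 1) → Fin (iterNum n) → Gam S n × Gam S n →
      Fin (iterNum n * splitParam S n k))

/-- The set of all choices in which all functions are taken from the given families; a uniformly
random element is an independent uniformly random choice from each of the families. -/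
noncomputable def allChoices {S : Type*} [Fintype S] {n k : ℕ}
    (famC : Fin (depth n) → Finset (Gam S n × Gam S n → Fin (n ^ 4)))
    (famH : Fin (depth n + 1) → Fin (iterNum n) →
      Finset (Gam S n × Gam S n → Fin (iterNum n * splitParam S n k))) :
    Finset (Choices S n k) :=
  Fintype.piFinset famC ×ˢ Fintype.piFinset fun ℓ => Fintype.piFinset (famH ℓ)

/-- The decomposition algorithm: the sequence of grammars output on input `x`. -/
noncomputable def decompose {S : Type*} [Fintype S] [DecidableEq S] {n k : ℕ} (F : List (Gam S n) → List ℕ)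
    (ω : Choices S n k) (x : List S) : List (Gramm S n) :=
  (split (iteratedHash (ω.2 0)) (x.map letter)).flatMap fun B =>
    process F
      (List.ofFn fun ℓ : Fin (depth n) =>
        ((fun p => (ℓ, ω.1 ℓ p) : Gam S n × Gam S n → Comp n), iteratedHash (ω.2 ℓ.succ)))
      B []

/-! ### The alignment -/

/-- `z[r, …]` (positions are counted from `1`). -/
def suffixFrom {α : Type*} (z : List α) (r : ℕ) : List α := z.drop (r - 1)

/-- The sequences `Gx = (G₁, …, G_s)` and `Gy = (G'₁, …, G'_{s'})` of grammars are aligned from the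
right and cover `x` and `y`: `X₀, Xs` are the evaluations of `G_t` and of `G_{t+1}, …, G_s`, and
`Y₀, Ys` are those of `G'_{t'}` and of `G'_{t'+1}, …, G'_{s'}`. -/
def Aligned {S : Type*} {n : ℕ} (x y : List S) (Gx Gy : List (Gramm S n)) : Prop :=
  ∃ r r' t t' : ℕ, 1 ≤ r ∧ 1 ≤ r' ∧ 1 ≤ t ∧ t ≤ Gx.length ∧ 1 ≤ t' ∧ t' ≤ Gy.length ∧
    (Gx.length : ℤ) - t = (Gy.length : ℤ) - t' ∧
    ∃ (X₀ Y₀ : List S) (Xs Ys : List (List S)),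
      List.Forall₂ IsEval (Gx.drop (t - 1)) (X₀ :: Xs) ∧
      List.Forall₂ IsEval (Gy.drop (t' - 1)) (Y₀ :: Ys) ∧
      x = suffixFrom X₀ r ++ Xs.flatten ∧
      y = suffixFrom Y₀ r' ++ Ys.flatten ∧
      editDist x y = editDist (suffixFrom X₀ r) (suffixFrom Y₀ r') +
        (List.zipWith editDist Xs Ys).sum

end EDDecomp

/-!
The algorithm is followed on *annotated* strings, in which each symbol carries the word over the input
alphabet that it stands for (`Ann`, `annProcess`, `annDecompose`); the blocks that are turned into grammars then
partition the input. Three things have to be shown.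

*Locality.* Whether `Compress` cuts in front of a symbol depends only on the symbols at distance at most `R + 2`
(`flags_local`, where `R` is the radius of the coloring), and compression shortens a string by a factor of about
`2 / 3` (`GoodChunks.length_flatMap_le`). If two strings differ only in a part of length `M` between a common prefix
and a common suffix, then so do the compressed strings, and the length of the new part is at most
`(2 M + 4 R + 21) / 3` (`annCompress_between`). So this length never exceeds `4 R + 21`. If on each level the splitting
function does not vanish on the `O(R)` pairs of symbols in that part and next to it, then `Split` makes the same cuts
in both strings, and only one pair of corresponding blocks differs (`adaptive_edit`). Similarly, a different prefix
affects the blocks up to the border only (`adaptive_prefix`). An optimal sequence of edit operations takes `u x` to `u y`,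
and an exchange of the prefix takes this to `v y`. When the `O(R k)` constraints on each level hold for all of these
changes, the blocks behind the border correspond to each other, and the sum of their edit distances is at most the
number of operations, that is, at most the edit distance of `x` and `y` (`adaptive_closeBehind`). The reverse inequality
is the subadditivity of the edit distance.

*Evaluation.* If no compression function takes the same value on two pairs that occur in the same block, then the
grammars are deterministic and evaluate to the words that the blocks stand for (`forall₂_isEval_process`). On each level
there are at most `(n - 1) (n - 2) / 2` pairs of pairs that might collide.

*Probability.* The constraints on the splitting function of a level are named when the functions on the levels before and
the compression function of this level are known (`Adaptive`), so they are independent of the splitting function, and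
each is violated with probability at most `1 / D`. In the same way each collision has probability `1 / n ^ 4`. The general
principle is `uniformProb_le_of_resample`. The union bound gives `17 / 110 + 1 / n` for the total failure probability, which
is small enough for `n ≥ 26`. For smaller `n` the constraints may demand that the strings are not split at all, which
leaves `1 / 30 + 1 / 6`.
-/

namespace EDDecomp

/-! ### Locally consistent colorings exist -/

section Coloring

variable {α : Type*}

/-- The lowest bit in which two numbers differ (`0` if they are equal). -/
noncomputable def firstDiff (a b : ℕ) : ℕ :=
  if h : a ≠ b then Nat.find (Nat.exists_testBit_ne_of_ne h) else 0

lemma testBit_firstDiff {a b : ℕ} (h : a ≠ b) :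
    a.testBit (firstDiff a b) ≠ b.testBit (firstDiff a b) := by
  unfold firstDiff
  rw [dif_pos h]
  exact Nat.find_spec (Nat.exists_testBit_ne_of_ne h)

lemma firstDiff_lt_clog {a b N : ℕ} (h : a ≠ b) (ha : a < N) (hb : b < N) :
    firstDiff a b < Nat.clog 2 N := by
  by_contra hc
  have hN : N ≤ 2 ^ firstDiff a b := (Nat.clog_le_iff_le_pow one_lt_two).1 (not_lt.1 hc)
  apply testBit_firstDiff h
  rw [Nat.testBit_eq_false_of_lt (ha.trans_le hN), Nat.testBit_eq_false_of_lt (hb.trans_le hN)]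

/-- The labels of deterministic coin tossing after `t` rounds, on a two-sided sequence `s` that
is `none` outside of the string. In each round a label is replaced by the position and the value of
the lowest bit in which it differs from the preceding label. -/
noncomputable def tossLabel (code : α → ℕ) (s : ℤ → Option α) : ℕ → ℤ → ℕ
  | 0, p => (s p).elim 0 code
  | t + 1, p =>
      if s (p - 1) = none then (tossLabel code s t p).testBit 0 |>.toNat
      else 2 * firstDiff (tossLabel code s t p) (tossLabel code s t (p - 1)) +
        ((tossLabel code s t p).testBit
          (firstDiff (tossLabel code s t p) (tossLabel code s t (p - 1)))).toNat

lemma tossLabel_congr (code : α → ℕ) {s s' : ℤ → Option α} (t : ℕ) : ∀ p p' : ℤ,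
    (∀ d : ℤ, |d| ≤ (t : ℤ) → s (p + d) = s' (p' + d)) →
      tossLabel code s t p = tossLabel code s' t p' := by
  induction t with
  | zero =>
    intro p p' h
    have := h 0 (by simp)
    simp only [add_zero] at this
    simp [tossLabel, this]
  | succ t ih =>
    intro p p' h
    have h0 : tossLabel code s t p = tossLabel code s' t p' :=
      ih p p' fun d hd => h d (by push_cast; linarith)
    have h1 : tossLabel code s t (p - 1) = tossLabel code s' t (p' - 1) := by
      refine ih _ _ fun d hd => ?_
      have := h (d - 1) (by rw [abs_le] at hd ⊢; push_cast; constructor <;> linarith)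
      convert this using 2 <;> ring
    have h2 : s (p - 1) = s' (p' - 1) := by
      have := h (-1) (by simp)
      simpa [sub_eq_add_neg] using this
    simp only [tossLabel, h0, h1, h2]

/-- No two consecutive symbols of the two-sided sequence are equal. -/
def StreamProper (s : ℤ → Option α) : Prop := ∀ p a, s p = some a → s (p + 1) ≠ some a

lemma toNat_bool_injective {a b : Bool} (h : a.toNat = b.toNat) : a = b := by
  revert a b; decide

/-- Consecutive labels stay different: equal new labels would record the same position and bit, but each
position that is recorded is one where the two old labels differ. -/
lemma tossLabel_ne {code : α → ℕ} (hcode : Function.Injective code) {s : ℤ → Option α}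
    (hs : StreamProper s) (t : ℕ) : ∀ p : ℤ, s p ≠ none → s (p + 1) ≠ none →
      tossLabel code s t p ≠ tossLabel code s t (p + 1) := by
  induction t with
  | zero =>
    intro p h0 h1
    obtain ⟨a, ha⟩ := Option.ne_none_iff_exists'.1 h0
    obtain ⟨b, hb⟩ := Option.ne_none_iff_exists'.1 h1
    simp only [tossLabel, ha, hb, Option.elim]
    intro hab
    exact hs p a ha (by rw [hb, hcode hab])
  | succ t ih =>
    intro p h0 h1 heq
    have hne := ih p h0 h1
    have hdiff := testBit_firstDiff hne.symm
    simp only [tossLabel, add_sub_cancel_right, if_neg h0] at heq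
    generalize firstDiff (tossLabel code s t (p + 1)) (tossLabel code s t p) = i at *
    have hlt : ∀ b : Bool, b.toNat ≤ 1 := Bool.toNat_le
    split_ifs at heq with hp
    · have hi : i = 0 := by
        have := hlt ((tossLabel code s t p).testBit 0)
        omega
      subst hi
      apply hdiff
      have : ((tossLabel code s t p).testBit 0).toNat =
        ((tossLabel code s t (p + 1)).testBit 0).toNat := by simpa using heq
      exact (toNat_bool_injective this).symm
    · generalize firstDiff (tossLabel code s t p) (tossLabel code s t (p - 1)) = j at *
      have h1 := hlt ((tossLabel code s t p).testBit j)
      have h2 := hlt ((tossLabel code s t (p + 1)).testBit i)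
      have hij : j = i := by omega
      subst hij
      apply hdiff
      exact toNat_bool_injective (by omega)

/-- An upper bound for the labels after `t` rounds of coin tossing, starting from `N` labels. -/
def tossBound (N : ℕ) : ℕ → ℕ
  | 0 => N
  | t + 1 => 2 * max 1 (Nat.clog 2 (tossBound N t))

lemma tossLabel_lt {code : α → ℕ} (hcode : Function.Injective code) {N : ℕ}
    (hN : ∀ a, code a < N) {s : ℤ → Option α} (hs : StreamProper s) (t : ℕ) :
    ∀ p : ℤ, s p ≠ none → tossLabel code s t p < tossBound N t := by
  induction t with
  | zero =>
    intro p h0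
    obtain ⟨a, ha⟩ := Option.ne_none_iff_exists'.1 h0
    simpa [tossLabel, ha, tossBound] using hN a
  | succ t ih =>
    intro p h0
    have hlt : ∀ b : Bool, b.toNat ≤ 1 := Bool.toNat_le
    simp only [tossLabel, tossBound]
    split_ifs with hp
    · have := hlt ((tossLabel code s t p).testBit 0)
      have := le_max_left 1 (Nat.clog 2 (tossBound N t))
      omega
    · have hne := tossLabel_ne hcode hs t (p - 1) hp (by simpa using h0)
      rw [sub_add_cancel] at hne
      have h1 := firstDiff_lt_clog hne.symm (ih p h0) (ih (p - 1) hp)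
      generalize firstDiff (tossLabel code s t p) (tossLabel code s t (p - 1)) = j at *
      have := hlt ((tossLabel code s t p).testBit j)
      have := le_max_right 1 (Nat.clog 2 (tossBound N t))
      omega

lemma tossBound_le (N t : ℕ) : tossBound N t ≤ 4 * max 2 ((Nat.clog 2)^[t] N) := by
  induction t with
  | zero => simp only [tossBound, Function.iterate_zero, id]; omega
  | succ t ih =>
    rw [Function.iterate_succ_apply', tossBound]
    generalize (Nat.clog 2)^[t] N = c at *
    have h1 : Nat.clog 2 (tossBound N t) ≤ 2 + Nat.clog 2 (max 2 c) := by
      rw [Nat.clog_le_iff_le_pow one_lt_two]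
      calc tossBound N t ≤ 4 * max 2 c := ih
        _ ≤ 4 * 2 ^ Nat.clog 2 (max 2 c) := by
            gcongr
            exact Nat.le_pow_clog one_lt_two _
        _ = 2 ^ (2 + Nat.clog 2 (max 2 c)) := by rw [pow_add]; norm_num
    rcases le_or_gt c 2 with hc | hc
    · rw [max_eq_left hc] at h1
      have h2 : Nat.clog 2 2 = 1 := Nat.clog_eq_one le_rfl le_rfl
      omega
    · rw [max_eq_right hc.le] at h1
      have h2 : 1 < Nat.clog 2 c := by
        by_contra hcc
        have := (Nat.clog_le_iff_le_pow one_lt_two).1 (not_lt.1 hcc)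
        omega
      omega

lemma iterate_clog_logStar (N : ℕ) : (Nat.clog 2)^[logStar N] N ≤ 1 := by
  have key : ∀ M : ℕ, ∃ i, (Nat.clog 2)^[i] M ≤ 1 := by
    intro M
    induction M using Nat.strong_induction_on with
    | _ M ih =>
      rcases le_or_gt M 1 with h | h
      · exact ⟨0, by simpa using h⟩
      · have hlt : Nat.clog 2 M < M := by
          have : Nat.clog 2 M ≤ M - 1 := by
            rw [Nat.clog_le_iff_le_pow one_lt_two]
            have := (M - 1).lt_two_pow_self
            omega
          omega
        obtain ⟨i, hi⟩ := ih _ hlt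
        exact ⟨i + 1, by simpa [Function.iterate_succ_apply] using hi⟩
  exact Nat.sInf_mem (s := {i : ℕ | (Nat.clog 2)^[i] N ≤ 1}) (key N)

/-- Replacing `N` by `⌈log₂ N⌉` until one label would remain leaves at most six labels, because of the factor
two in each round. -/
lemma tossBound_logStar (N : ℕ) : tossBound N (logStar N + 1) ≤ 6 := by
  have h1 := tossBound_le N (logStar N)
  rw [max_eq_left ((iterate_clog_logStar N).trans one_le_two)] at h1
  have h2 : Nat.clog 2 (tossBound N (logStar N)) ≤ 3 := by
    rw [Nat.clog_le_iff_le_pow one_lt_two]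
    omega
  rw [tossBound]
  omega

/-- The priority of a position in the greedy choice: the first position of the string comes first,
the others follow in the order of their labels. -/
noncomputable def priority (code : α → ℕ) (T : ℕ) (s : ℤ → Option α) (p : ℤ) : ℕ :=
  if s (p - 1) = none then 0 else tossLabel code s T p + 1

/-- `Chosen code T s c p`: the position `p` has been chosen when the positions of priority less
than `c` have been treated. A position that is not the last one of the string is chosen when its turn
comes, unless a neighbor has been chosen before. -/
def Chosen (code : α → ℕ) (T : ℕ) (s : ℤ → Option α) : ℕ → ℤ → Prop
  | 0, _ => False
  | c + 1, p => Chosen code T s c p ∨ (s p ≠ none ∧ s (p + 1) ≠ none ∧ priority code T s p = c ∧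
      ¬ Chosen code T s c (p - 1) ∧ ¬ Chosen code T s c (p + 1))

open Classical in
/-- The color of a position: `1` at the chosen positions, `2` after these, `3` elsewhere. There are seven
priorities: `0` for the first position, and one for each of the six labels. -/
noncomputable def tossColor (code : α → ℕ) (T : ℕ) (s : ℤ → Option α) (p : ℤ) : ℕ :=
  if Chosen code T s 7 p then 1 else if Chosen code T s 7 (p - 1) then 2 else 3

lemma priority_congr (code : α → ℕ) (T : ℕ) {s s' : ℤ → Option α} {p p' : ℤ}
    (h : ∀ d : ℤ, |d| ≤ (T : ℤ) + 1 → s (p + d) = s' (p' + d)) :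
    priority code T s p = priority code T s' p' := by
  have h1 : s (p - 1) = s' (p' - 1) := by
    have := h (-1) (by simp)
    simpa [sub_eq_add_neg] using this
  rw [priority, priority, h1,
    tossLabel_congr code T p p' fun d hd => h d (by linarith)]

lemma chosen_congr (code : α → ℕ) (T : ℕ) {s s' : ℤ → Option α} (c : ℕ) : ∀ p p' : ℤ,
    (∀ d : ℤ, |d| ≤ (T : ℤ) + 1 + c → s (p + d) = s' (p' + d)) →
      (Chosen code T s c p ↔ Chosen code T s' c p') := by
  induction c with
  | zero => intro p p' _; simp [Chosen]
  | succ c ih =>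
    intro p p' h
    push_cast at h
    have e0 : s p = s' p' := by simpa using h 0 (by simp; positivity)
    have e1 : s (p + 1) = s' (p' + 1) := h 1 (by
      rw [abs_one]
      linarith [Nat.cast_nonneg (α := ℤ) T, Nat.cast_nonneg (α := ℤ) c])
    have i0 := ih p p' fun d hd => h d (by linarith)
    have i1 := ih (p - 1) (p' - 1) fun d hd => by
      have := h (d - 1) (by rw [abs_le] at hd ⊢; constructor <;> linarith)
      convert this using 2 <;> ring
    have i2 := ih (p + 1) (p' + 1) fun d hd => by
      have := h (d + 1) (by rw [abs_le] at hd ⊢; constructor <;> linarith)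
      convert this using 2 <;> ring
    have hp := priority_congr code T (s := s) (s' := s') (p := p) (p' := p')
      fun d hd => h d (by linarith)
    simp only [Chosen, e0, e1, i0, i1, i2, hp]

lemma tossColor_congr (code : α → ℕ) (T : ℕ) {s s' : ℤ → Option α} {p p' : ℤ}
    (h : ∀ d : ℤ, |d| ≤ (T : ℤ) + 9 → s (p + d) = s' (p' + d)) :
    tossColor code T s p = tossColor code T s' p' := by
  have i0 := chosen_congr code T (s := s) (s' := s') 7 p p'
    fun d hd => h d (by push_cast at hd; linarith)
  have i1 := chosen_congr code T (s := s) (s' := s') 7 (p - 1) (p' - 1) fun d hd => by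
    have := h (d - 1) (by rw [abs_le] at hd ⊢; push_cast at hd; constructor <;> linarith)
    convert this using 2 <;> ring
  classical exact if_congr i0 rfl (if_congr i1 rfl rfl)

lemma chosen_mono (code : α → ℕ) (T : ℕ) (s : ℤ → Option α) {c c' : ℕ} (h : c ≤ c') {p : ℤ}
    (hp : Chosen code T s c p) : Chosen code T s c' p := by
  induction h with
  | refl => exact hp
  | step _ ih => exact Or.inl ih

lemma Chosen.not_last {code : α → ℕ} {T : ℕ} {s : ℤ → Option α} {c : ℕ} {p : ℤ}
    (hp : Chosen code T s c p) : s p ≠ none ∧ s (p + 1) ≠ none := by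
  induction c with
  | zero => exact hp.elim
  | succ c ih =>
    rcases hp with hp | hp
    · exact ih hp
    · exact ⟨hp.1, hp.2.1⟩

lemma priority_ne {code : α → ℕ} (hcode : Function.Injective code) {s : ℤ → Option α}
    (hs : StreamProper s) (T : ℕ) {p : ℤ} (h0 : s p ≠ none) (h1 : s (p + 1) ≠ none) :
    priority code T s p ≠ priority code T s (p + 1) := by
  have := tossLabel_ne hcode hs T p h0 h1
  simp only [priority, add_sub_cancel_right, if_neg h0]
  split_ifs <;> omega

lemma not_chosen_succ {code : α → ℕ} (hcode : Function.Injective code) {s : ℤ → Option α}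
    (hs : StreamProper s) (T c : ℕ) (p : ℤ) (h0 : Chosen code T s c p) :
    ¬ Chosen code T s c (p + 1) := by
  induction c with
  | zero => exact h0.elim
  | succ c ih =>
    rintro (h1 | h1)
    · rcases h0 with h0 | h0
      · exact ih h0 h1
      · exact h0.2.2.2.2 h1
    · rcases h0 with h0 | h0
      · exact h1.2.2.2.1 (by simpa using h0)
      · exact priority_ne hcode hs T h0.1 h1.1 (h0.2.2.1.trans h1.2.2.1.symm)

/-- The choice is maximal: except for the last position, each position is chosen or has a chosen neighbor. -/
lemma chosen_near {code : α → ℕ} {T : ℕ} {s : ℤ → Option α} {p : ℤ} (h0 : s p ≠ none)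
    (h1 : s (p + 1) ≠ none) (hp : priority code T s p < 7) :
    Chosen code T s 7 p ∨ Chosen code T s 7 (p - 1) ∨ Chosen code T s 7 (p + 1) := by
  by_contra! hcon
  have hmono := fun q => chosen_mono code T s hp.le (p := q)
  exact hcon.1 (chosen_mono code T s hp (Or.inr ⟨h0, h1, rfl, fun h => hcon.2.1 (hmono _ h),
    fun h => hcon.2.2 (hmono _ h)⟩))

/-- The coloring of a string by deterministic coin tossing. -/
noncomputable def tossColoring (code : α → ℕ) (T : ℕ) (x : List α) : List ℕ :=
  (List.range x.length).map fun i : ℕ => tossColor code T (symbolAt x) i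

lemma symbolAt_natCast (x : List α) (i : ℕ) : symbolAt x (i : ℤ) = x[i]? := by
  simp [symbolAt]

lemma symbolAt_eq_none_iff (x : List α) (p : ℤ) :
    symbolAt x p = none ↔ p < 0 ∨ (x.length : ℤ) ≤ p := by
  unfold symbolAt
  split_ifs with h
  · rw [List.getElem?_eq_none_iff]
    omega
  · simp; omega

lemma symbolAt_ne_none_iff (x : List α) (p : ℤ) :
    symbolAt x p ≠ none ↔ 0 ≤ p ∧ p < (x.length : ℤ) := by
  rw [Ne, symbolAt_eq_none_iff]
  omega

lemma NoRepeat.streamProper {x : List α} (hx : NoRepeat x) : StreamProper (symbolAt x) := by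
  intro p a h0 h1
  have hp := (symbolAt_ne_none_iff x p).1 (by simp [h0])
  have hp1 := (symbolAt_ne_none_iff x (p + 1)).1 (by simp [h1])
  lift p to ℕ using hp.1
  rw [symbolAt_natCast] at h0
  have e : ((p : ℤ) + 1) = ((p + 1 : ℕ) : ℤ) := by push_cast; rfl
  rw [e, symbolAt_natCast] at h1
  have hlt : p + 1 < x.length := by omega
  have := (List.isChain_iff_getElem.1 hx) p hlt
  rw [List.getElem?_eq_getElem (by omega)] at h0 h1
  simp only [Option.some.injEq] at h0 h1
  exact this (h0.trans h1.symm)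

lemma symbolAt_tossColoring (code : α → ℕ) (T : ℕ) (x : List α) (i : ℕ) (hi : i < x.length) :
    (tossColoring code T x)[i]? = some (tossColor code T (symbolAt x) i) := by
  simp [tossColoring, hi]

lemma length_tossColoring (code : α → ℕ) (T : ℕ) (x : List α) :
    (tossColoring code T x).length = x.length := by simp [tossColoring]

lemma tossColor_last {code : α → ℕ} {T : ℕ} {s : ℤ → Option α} {p : ℤ} (h : s (p + 1) = none) :
    tossColor code T s p = 2 ∨ tossColor code T s p = 3 := by
  have : ¬ Chosen code T s 7 p := fun hc => hc.not_last.2 h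
  unfold tossColor
  rw [if_neg this]
  split_ifs <;> simp

/-- Colors are determined at radius `logStar N + 10`: `logStar N + 1` rounds of coin tossing look that far to the left,
and the greedy choice, with its seven classes, adds nine. -/
theorem isLocalColoring_tossColoring {code : α → ℕ} (hcode : Function.Injective code) {N : ℕ}
    (hN : ∀ a, code a < N) {R : ℕ} (hR : logStar N + 10 ≤ R) :
    IsLocalColoring R (tossColoring code (logStar N + 1)) := by
  set T := logStar N + 1 with hT
  have hprio : ∀ {x : List α}, NoRepeat x → ∀ p, symbolAt x p ≠ none →
      priority code T (symbolAt x) p < 7 := by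
    intro x hx p hp
    have := (tossLabel_lt hcode hN hx.streamProper T p hp).trans_le (tossBound_logStar N)
    unfold priority
    split_ifs <;> omega
  have hcol : ∀ (x : List α) (i c : ℕ), (tossColoring code T x)[i]? = some c →
      i < x.length ∧ c = tossColor code T (symbolAt x) i := by
    intro x i c h
    have hi : i < x.length := by
      rw [← length_tossColoring code T x]
      exact (List.getElem?_eq_some_iff.1 h).1
    rw [symbolAt_tossColoring code T x i hi] at h
    exact ⟨hi, (Option.some.inj h).symm⟩
  have hadj : ∀ {x : List α}, NoRepeat x → ∀ i : ℕ, i + 1 < x.length →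
      tossColor code T (symbolAt x) i ≠ tossColor code T (symbolAt x) (i + 1 : ℕ) := by
    intro x hx i hi
    have h0 : symbolAt x i ≠ none := by rw [symbolAt_ne_none_iff]; omega
    have h1 : symbolAt x (i + 1) ≠ none := by rw [symbolAt_ne_none_iff]; omega
    have hind := not_chosen_succ hcode hx.streamProper T 7 i
    have hnear := chosen_near h0 h1 (hprio hx i h0)
    have e0 : (i : ℤ) + 1 = ((i + 1 : ℕ) : ℤ) := by push_cast; rfl
    have e1 : ((i + 1 : ℕ) : ℤ) - 1 = i := by push_cast; ring
    rw [e0] at hind hnear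
    have e2 : Chosen code T (symbolAt x) 7 (((i + 1 : ℕ) : ℤ) - 1) ↔
      Chosen code T (symbolAt x) 7 i := by rw [e1]
    unfold tossColor
    revert hind hnear e2
    generalize Chosen code T (symbolAt x) 7 (i : ℤ) = A
    generalize Chosen code T (symbolAt x) 7 ((i : ℤ) - 1) = B
    generalize Chosen code T (symbolAt x) 7 ((i + 1 : ℕ) : ℤ) = C
    generalize Chosen code T (symbolAt x) 7 (((i + 1 : ℕ) : ℤ) - 1) = D
    intro hind hnear e2
    split_ifs <;> first | decide | (exfalso; tauto)
  constructor
  · intro x hx c hc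
    obtain ⟨i, hi⟩ := List.mem_iff_getElem?.1 hc
    rw [(hcol x i c hi).2]
    unfold tossColor
    split_ifs <;> simp
  · intro x _
    exact length_tossColoring code T x
  · intro x x' hx hx' i i' h
    have h0 : symbolAt x i = symbolAt x' i' := by simpa using h 0 (by simp)
    rw [symbolAt_natCast, symbolAt_natCast]
    rcases lt_or_ge i x.length with hi | hi
    · have hi' : i' < x'.length := by
        by_contra hcon
        have e := (symbolAt_eq_none_iff x' i').2 (by omega)
        rw [← h0, symbolAt_eq_none_iff] at e
        omega
      rw [symbolAt_tossColoring code T x i hi, symbolAt_tossColoring code T x' i' hi']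
      congr 1
      apply tossColor_congr
      intro d hd
      apply h d
      push_cast [hT] at hd
      have : (logStar N : ℤ) + 10 ≤ R := by exact_mod_cast hR
      linarith
    · have hi' : x'.length ≤ i' := by
        by_contra hcon
        have e := (symbolAt_eq_none_iff x i).2 (by omega)
        rw [h0, symbolAt_eq_none_iff] at e
        omega
      rw [List.getElem?_eq_none (by rw [length_tossColoring]; exact hi),
        List.getElem?_eq_none (by rw [length_tossColoring]; exact hi')]
  · intro x hx
    rw [NoRepeat, List.isChain_iff_getElem]
    intro i hi
    rw [length_tossColoring] at hi
    have := hadj hx i hi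
    simp only [tossColoring, List.getElem_map, List.getElem_range]
    exact this
  · intro x hx p q a b c hF
    have ha := hcol x p.length a (by rw [hF]; simp)
    have hb := hcol x (p.length + 1) b (by rw [hF]; simp)
    have hc := hcol x (p.length + 2) c (by rw [hF]; simp)
    have h0 : symbolAt x ((p.length + 1 : ℕ) : ℤ) ≠ none := by rw [symbolAt_ne_none_iff]; omega
    have h1 : symbolAt x ((p.length + 1 : ℕ) + 1) ≠ none := by rw [symbolAt_ne_none_iff]; omega
    have e0 : ((p.length + 1 : ℕ) : ℤ) - 1 = (p.length : ℕ) := by push_cast; ring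
    have e1 : ((p.length + 1 : ℕ) : ℤ) + 1 = (p.length + 2 : ℕ) := by push_cast; ring
    rw [ha.2, hb.2, hc.2]
    have := chosen_near h0 h1 (hprio hx _ h0)
    rw [e0, e1] at this
    rcases this with h | h | h
    · right; left; unfold tossColor; rw [if_pos h]
    · left; unfold tossColor; rw [if_pos h]
    · right; right; unfold tossColor; rw [if_pos h]
  · intro a
    have h1 : ∀ p, ¬ Chosen code T (symbolAt [a]) 7 p := by
      intro p hp
      have h0 := (symbolAt_ne_none_iff _ _).1 hp.not_last.1
      have h1 := (symbolAt_ne_none_iff _ _).1 hp.not_last.2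
      simp at h0 h1
      omega
    simp [tossColoring, tossColor, h1]
  · intro x hx h2
    rw [List.head?_eq_getElem?, symbolAt_tossColoring code T x 0 (by omega)]
    congr 1
    unfold tossColor
    rw [if_pos]
    refine chosen_mono code T _ (show 1 ≤ 7 by norm_num) (Or.inr ⟨?_, ?_, ?_, id, id⟩)
    · rw [symbolAt_ne_none_iff]; simp; omega
    · rw [symbolAt_ne_none_iff]; simp; omega
    · unfold priority
      rw [if_pos]
      rw [symbolAt_eq_none_iff]; simp
  · intro x hx h2
    rw [List.getLast?_eq_getElem?, length_tossColoring,
      symbolAt_tossColoring code T x (x.length - 1) (by omega)]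
    simp only [Option.some.injEq]
    apply tossColor_last
    rw [symbolAt_eq_none_iff]; omega

/-- Locally consistent colorings exist: deterministic coin tossing, followed by a greedy choice. -/
theorem exists_isLocalColoring (S : Type*) [Fintype S] (n : ℕ) :
    ∃ F : List (Gam S n) → List ℕ, IsLocalColoring (radius S n) F := by
  classical
  refine ⟨_, isLocalColoring_tossColoring (code := fun a => (Fintype.equivFin (Gam S n) a : ℕ))
    (N := Fintype.card (Gam S n)) ?_ (fun a => (Fintype.equivFin (Gam S n) a).2) ?_⟩
  · intro a b h
    exact (Fintype.equivFin (Gam S n)).injective (Fin.ext h)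
  · unfold radius; omega

end Coloring

/-! ### Splitting and cutting of strings -/

section Cutting

variable {α β : Type*}

/-- The pairs of consecutive symbols of a string. -/
def adjPairs (l : List α) : List (α × α) := l.zip l.tail

lemma adjPairs_cons_cons (a b : α) (l : List α) :
    adjPairs (a :: b :: l) = (a, b) :: adjPairs (b :: l) := by simp [adjPairs]

lemma length_adjPairs (l : List α) : (adjPairs l).length = l.length - 1 := by
  simp [adjPairs]

lemma adjPairs_map (f : α → β) (l : List α) :
    adjPairs (l.map f) = (adjPairs l).map (Prod.map f f) := by
  simp [adjPairs, ← List.map_tail, List.zip_map]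

lemma mem_adjPairs_of_infix {A B : List α} (h : A <:+: B) : ∀ p ∈ adjPairs A, p ∈ adjPairs B := by
  obtain ⟨s, t, rfl⟩ := h
  intro p hp
  obtain ⟨i, hi, rfl⟩ := List.mem_iff_getElem.1 hp
  rw [length_adjPairs] at hi
  refine List.mem_iff_getElem.2 ⟨s.length + i, by simp [length_adjPairs]; omega, ?_⟩
  simp only [adjPairs, List.getElem_zip, List.getElem_tail]
  congr 1
  · rw [List.getElem_append_left (by simp; omega), List.getElem_append_right (by simp)]
    simp
  · rw [List.getElem_append_left (by simp; omega), List.getElem_append_right (by omega)]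
    congr 1
    omega

lemma split_exists_cons (H : α × α → ℕ) (l : List α) : ∃ h Cs, split H l = h :: Cs := by
  induction l using split.induct H with
  | case1 a b c w h ih => exact ⟨_, _, by rw [split, if_pos h]⟩
  | case2 a b c w h ih =>
    obtain ⟨x, Cs, e⟩ := ih
    exact ⟨a :: x, Cs, by rw [split, if_neg h, e, consHead]⟩
  | case3 => exact ⟨_, _, by rw [split]⟩
  | case4 => exact ⟨_, _, by rw [split]⟩
  | case5 => exact ⟨_, _, by rw [split]⟩

lemma exists_eq_append_singleton {l : List α} (h : l ≠ []) : ∃ As a, l = As ++ [a] :=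
  ⟨l.dropLast, l.getLast h, (List.dropLast_append_getLast h).symm⟩

lemma split_exists_concat (H : α × α → ℕ) (l : List α) : ∃ As x, split H l = As ++ [x] := by
  obtain ⟨h, Cs, e⟩ := split_exists_cons H l
  exact exists_eq_append_singleton (by rw [e]; simp)

lemma flatten_split (H : α × α → ℕ) (l : List α) : (split H l).flatten = l := by
  induction l using split.induct H with
  | case1 a b c w h ih => rw [split, if_pos h, List.flatten_cons, ih]; rfl
  | case2 a b c w h ih =>
    obtain ⟨x, Cs, e⟩ := split_exists_cons H (b :: c :: w)
    rw [split, if_neg h]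
    rw [e] at ih ⊢
    simpa [consHead] using ih
  | case3 => simp [split]
  | case4 => simp [split]
  | case5 => simp [split]

lemma split_map (H : β × β → ℕ) (f : α → β) (l : List α) :
    split H (l.map f) = (split (fun p => H (Prod.map f f p)) l).map (List.map f) := by
  induction l using split.induct (fun p => H (Prod.map f f p)) with
  | case1 a b c w h ih =>
    simp only [List.map_cons] at ih ⊢
    rw [split, split, if_pos h, if_pos (show H (f b, f c) = 0 from h), ih]
    simp
  | case2 a b c w h ih =>
    obtain ⟨x, Cs, e⟩ := split_exists_cons (fun p => H (Prod.map f f p)) (b :: c :: w)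
    rw [e] at ih
    simp only [List.map_cons] at ih ⊢
    rw [split, split, if_neg h, if_neg (show ¬ H (f b, f c) = 0 from h), ih, e]
    simp [consHead]
  | case3 => simp [split]
  | case4 => simp [split]
  | case5 => simp [split]

/-- If no cut is made at the junction, then the blocks of a concatenation are those of the two parts,
except that the last block of the first part and the first block of the second part are joined. -/
lemma split_append (H : α × α → ℕ) {P X l h : List α} {As Cs : List (List α)}
    (hP : split H P = As ++ [l]) (hX : split H X = h :: Cs)
    (h1 : ∀ a ∈ P.getLast?, ∀ b ∈ X.head?, H (a, b) ≠ 0)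
    (h2 : ∀ b c w, X = b :: c :: w → H (b, c) ≠ 0) :
    split H (P ++ X) = As ++ (l ++ h) :: Cs := by
  have single : ∀ a, split H (a :: X) = (a :: h) :: Cs := by
    intro a
    match X, hX, h2 with
    | [], hX, _ => simp [split] at hX ⊢; simp [hX]
    | [b], hX, _ => simp [split] at hX ⊢; simp [hX]
    | b :: c :: w, hX, h2 => rw [split, if_neg (h2 b c w rfl), hX, consHead]
  induction P using split.induct H generalizing As l with
  | case1 a b c w h0 ih =>
    obtain ⟨As', l', e⟩ := split_exists_concat H (b :: c :: w)
    rw [split, if_pos h0, e, ← List.cons_append] at hP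
    obtain ⟨rfl, e2⟩ := List.append_inj' hP rfl
    simp only [List.cons.injEq, and_true] at e2
    subst e2
    have := ih e (by simpa using h1)
    simp only [List.cons_append] at this ⊢
    rw [split, if_pos h0, this]
  | case2 a b c w h0 ih =>
    obtain ⟨As', l', e⟩ := split_exists_concat H (b :: c :: w)
    have := ih e (by simpa using h1)
    rw [split, if_neg h0, e] at hP
    simp only [List.cons_append] at this ⊢
    rw [split, if_neg h0, this]
    match As', hP with
    | [], hP =>
      obtain ⟨e1, e2⟩ := List.append_inj' (s₁ := []) hP rfl
      simp only [List.cons.injEq, and_true] at e2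
      simp [consHead, ← e1, ← e2]
    | x :: As', hP =>
      change (a :: x) :: As' ++ [l'] = As ++ [l] at hP
      obtain ⟨e1, e2⟩ := List.append_inj' hP rfl
      simp only [List.cons.injEq, and_true] at e2
      simp [consHead, ← e1, ← e2]
  | case3 =>
    rw [split] at hP
    obtain ⟨e1, e2⟩ := List.append_inj' (s₁ := []) hP rfl
    simp only [List.cons.injEq, and_true] at e2
    simp [← e1, ← e2, hX]
  | case4 a =>
    rw [split] at hP
    obtain ⟨e1, e2⟩ := List.append_inj' (s₁ := []) hP rfl
    simp only [List.cons.injEq, and_true] at e2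
    simp [← e1, ← e2, single]
  | case5 a b =>
    rw [split] at hP
    obtain ⟨e1, e2⟩ := List.append_inj' (s₁ := []) hP rfl
    simp only [List.cons.injEq, and_true] at e2
    rw [← e1, ← e2]
    match X, hX, h1, single b with
    | [], hX, _, _ => simp [split] at hX ⊢; simp [hX]
    | c :: X, _, h1, hb =>
      have := h1 b (by simp) c (by simp)
      simp only [List.cons_append, List.nil_append]
      rw [split, if_neg this, hb, consHead]

/-- Whatever is put in front of a string, the blocks after the first one stay the same. -/
lemma split_append_left (H : α × α → ℕ) (J : List α) {X h : List α} {Cs : List (List α)}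
    (hX : split H X = h :: Cs) :
    ∃ As J', As.flatten ++ J' = J ∧ (J = [] → As = []) ∧
      split H (J ++ X) = As ++ (J' ++ h) :: Cs := by
  induction J with
  | nil => exact ⟨[], [], by simp, by simp, by simpa using hX⟩
  | cons a J ih =>
    obtain ⟨As, J', e, -, hs⟩ := ih
    by_cases hc : ∃ b c w, J ++ X = b :: c :: w
    · obtain ⟨b, c, w, hw⟩ := hc
      rw [List.cons_append, hw, split, ← hw, hs]
      split_ifs with h0
      · exact ⟨[a] :: As, J', by simp [e], by simp, by simp⟩
      · cases As with
        | nil => exact ⟨[], a :: J', by simpa using e, by simp, by simp [consHead]⟩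
        | cons x As => exact ⟨(a :: x) :: As, J', by simpa using e, by simp, by simp [consHead]⟩
    · have hlen : split H (a :: (J ++ X)) = [a :: (J ++ X)] ∧ split H (J ++ X) = [J ++ X] := by
        match hJ : J ++ X with
        | [] => simp [split]
        | [b] => simp [split]
        | b :: c :: w => exact (hc ⟨b, c, w, hJ⟩).elim
      rw [hlen.2] at hs
      cases As with
      | nil =>
        simp only [List.nil_append, List.cons.injEq] at hs
        refine ⟨[], a :: J', by simpa using e, by simp, ?_⟩
        rw [List.cons_append, hlen.1, hs.1, ← hs.2]
        simp
      | cons x As => simp at hs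

lemma split_eq_singleton (H : α × α → ℕ) (l : List α) (hl : ∀ p ∈ adjPairs l, H p ≠ 0) :
    split H l = [l] := by
  induction l using split.induct H with
  | case1 a b c w h0 ih =>
    exact (hl (b, c) (by simp [adjPairs_cons_cons]) h0).elim
  | case2 a b c w h0 ih =>
    rw [adjPairs_cons_cons] at hl
    rw [split, if_neg h0, ih fun p hp => hl p (List.mem_cons_of_mem _ hp), consHead]
  | case3 => simp [split]
  | case4 => simp [split]
  | case5 => simp [split]

/-- If no cut is made inside of `M`, next to it, or one position to the right of it, then `M` is inside
of one block, and the other blocks do not depend on it. -/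
lemma split_between (H : α × α → ℕ) {P M Q l h : List α} {As Cs : List (List α)}
    (hM : ∀ p ∈ adjPairs (P.getLast?.toList ++ (M ++ Q.take 2)), H p ≠ 0)
    (hP : split H P = As ++ [l]) (hQ : split H Q = h :: Cs) :
    split H (P ++ (M ++ Q)) = As ++ (l ++ (M ++ h)) :: Cs := by
  have hfirst : ∀ b c w, M ++ Q = b :: c :: w → H (b, c) ≠ 0 := by
    intro b c w e
    refine hM (b, c) (mem_adjPairs_of_infix (A := [b, c]) ?_ (b, c) (by simp [adjPairs]))
    refine List.IsInfix.trans (l₂ := M ++ Q.take 2) ?_ (List.suffix_append _ _).isInfix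
    match M, e with
    | [], e => rw [List.nil_append] at e; rw [e]; simp
    | [x], e =>
      simp only [List.cons_append, List.nil_append, List.cons.injEq] at e
      rw [e.1, e.2]
      exact ⟨[], w.take 1, by simp⟩
    | x :: y :: M, e =>
      simp only [List.cons_append, List.cons.injEq] at e
      rw [e.1, e.2.1]
      exact ⟨[], M ++ Q.take 2, by simp⟩
  have hMQ : split H (M ++ Q) = (M ++ h) :: Cs := by
    have h1 : split H M = [] ++ [M] := split_eq_singleton H M fun p hp =>
      hM p (mem_adjPairs_of_infix ⟨P.getLast?.toList, Q.take 2, by simp⟩ p hp)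
    rcases List.eq_nil_or_concat M with rfl | ⟨M', a, rfl⟩
    · simpa using hQ
    · refine split_append H h1 hQ ?_ ?_
      · intro a' ha b hb
        obtain rfl : a = a' := by simpa using ha
        obtain ⟨Q', rfl⟩ : ∃ Q', Q = b :: Q' := by
          cases Q with
          | nil => simp at hb
          | cons c Q => exact ⟨Q, by simp at hb; rw [hb]⟩
        exact hM (a, b) (mem_adjPairs_of_infix (A := [a, b]) ⟨P.getLast?.toList ++ M', Q'.take 1, by simp⟩ _
          (by simp [adjPairs]))
      · rintro b c w rfl
        exact hM (b, c) (mem_adjPairs_of_infix (A := [b, c]) ⟨P.getLast?.toList ++ (M'.concat a), [], by simp⟩ _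
          (by simp [adjPairs]))
  refine split_append H hP hMQ ?_ hfirst
  intro a ha b hb
  refine hM (a, b) (mem_adjPairs_of_infix (A := [a, b]) ?_ (a, b) (by simp [adjPairs]))
  rw [Option.mem_def] at ha
  rw [ha]
  match M, hb with
  | [], hb =>
    cases Q with
    | nil => simp at hb
    | cons c Q =>
      obtain rfl : c = b := by simpa using hb
      exact ⟨[], Q.take 1, by simp⟩
  | c :: M, hb =>
    obtain rfl : c = b := by simpa using hb
    exact ⟨[], M ++ Q.take 2, by simp⟩

/-- Cut a string in front of each marked symbol. (What comes before the first marked symbol is a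
block, too, even if it is empty.) -/
def chop : List (β × Bool) → List (List β)
  | [] => [[]]
  | (a, f) :: w => if f then [] :: consHead a (chop w) else consHead a (chop w)

lemma chop_exists_cons (z : List (β × Bool)) : ∃ h Cs, chop z = h :: Cs := by
  induction z with
  | nil => exact ⟨_, _, rfl⟩
  | cons p z ih =>
    obtain ⟨a, f⟩ := p
    obtain ⟨h, Cs, e⟩ := ih
    cases f
    · exact ⟨a :: h, Cs, by simp [chop, e, consHead]⟩
    · exact ⟨[], (a :: h) :: Cs, by simp [chop, e, consHead]⟩

lemma chop_exists_concat (z : List (β × Bool)) : ∃ As x, chop z = As ++ [x] := by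
  obtain ⟨h, Cs, e⟩ := chop_exists_cons z
  exact exists_eq_append_singleton (by rw [e]; simp)

lemma chop_cons_false (a : β) {z : List (β × Bool)} {h : List β} {Cs : List (List β)}
    (hz : chop z = h :: Cs) : chop ((a, false) :: z) = (a :: h) :: Cs := by
  simp [chop, hz, consHead]

lemma chop_cons_true (a : β) {z : List (β × Bool)} {h : List β} {Cs : List (List β)}
    (hz : chop z = h :: Cs) : chop ((a, true) :: z) = [] :: (a :: h) :: Cs := by
  simp [chop, hz, consHead]

lemma flatten_chop (z : List (β × Bool)) : (chop z).flatten = z.map Prod.fst := by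
  induction z with
  | nil => rfl
  | cons p z ih =>
    obtain ⟨a, f⟩ := p
    obtain ⟨h, Cs, e⟩ := chop_exists_cons z
    rw [e] at ih
    cases f
    · rw [chop_cons_false a e]; simpa using ih
    · rw [chop_cons_true a e]; simpa using ih

lemma chop_append {X Y : List (β × Bool)} {l h : List β} {As Cs : List (List β)}
    (hX : chop X = As ++ [l]) (hY : chop Y = h :: Cs) :
    chop (X ++ Y) = As ++ (l ++ h) :: Cs := by
  induction X generalizing As l with
  | nil =>
    obtain ⟨e1, e2⟩ := List.append_inj' (s₁ := []) hX rfl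
    simp only [List.cons.injEq, and_true] at e2
    simp [← e1, ← e2, hY]
  | cons p X ih =>
    obtain ⟨a, f⟩ := p
    obtain ⟨As', l', e⟩ := chop_exists_concat X
    have := ih e
    cases As' with
    | nil =>
      simp only [List.nil_append] at e this
      cases f
      · rw [chop_cons_false a e] at hX
        obtain ⟨e1, e2⟩ := List.append_inj' (s₁ := []) hX rfl
        simp only [List.cons.injEq, and_true] at e2
        rw [List.cons_append, chop_cons_false a this]
        simp [← e1, ← e2]
      · rw [chop_cons_true a e] at hX
        obtain ⟨e1, e2⟩ := List.append_inj' (s₁ := [[]]) hX rfl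
        simp only [List.cons.injEq, and_true] at e2
        rw [List.cons_append, chop_cons_true a this]
        simp [← e1, ← e2]
    | cons x As' =>
      simp only [List.cons_append] at e this
      cases f
      · rw [chop_cons_false a e, ← List.cons_append] at hX
        obtain ⟨e1, e2⟩ := List.append_inj' hX rfl
        simp only [List.cons.injEq, and_true] at e2
        rw [List.cons_append, chop_cons_false a this]
        simp [← e1, ← e2]
      · rw [chop_cons_true a e, ← List.cons_append, ← List.cons_append] at hX
        obtain ⟨e1, e2⟩ := List.append_inj' hX rfl
        simp only [List.cons.injEq, and_true] at e2
        rw [List.cons_append, chop_cons_true a this]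
        simp [← e1, ← e2]

lemma chop_map {γ : Type*} (f : β → γ) (z : List (β × Bool)) :
    chop (z.map (Prod.map f id)) = (chop z).map (List.map f) := by
  induction z with
  | nil => rfl
  | cons p z ih =>
    obtain ⟨a, b⟩ := p
    obtain ⟨h, Cs, e⟩ := chop_exists_cons z
    rw [e] at ih
    cases b
    · rw [chop_cons_false a e, List.map_cons]
      exact chop_cons_false (f a) ih
    · rw [chop_cons_true a e, List.map_cons]
      exact chop_cons_true (f a) ih

end Cutting

/-! ### The division of a string into pieces -/

section Pieces

variable {α : Type*}

/-- The word that a piece stands for. -/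
def Piece.word : Piece α → List α
  | .rep a r => List.replicate r a
  | .plain w => w

/-- A piece is a repetition with exponent at least two, or a nonempty word without equal consecutive
symbols. -/
def Piece.Valid : Piece α → Prop
  | .rep _ r => 2 ≤ r
  | .plain w => w ≠ [] ∧ NoRepeat w

/-- Whether a piece is a repetition. -/
def Piece.IsRep : Piece α → Prop
  | .rep _ _ => True
  | .plain _ => False

/-- The condition for two consecutive pieces of the division of a string: one of them is a
repetition, and different symbols meet at the border. -/
def Piece.Adj (p q : Piece α) : Prop :=
  (p.IsRep ∨ q.IsRep) ∧ ∀ a ∈ p.word.getLast?, ∀ b ∈ q.word.head?, a ≠ b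


/-- Putting a symbol in front of a division into pieces preserves its characteristic properties. -/
lemma consPiece_spec [DecidableEq α] (a : α) (ps : List (Piece α)) (hv : ∀ p ∈ ps, p.Valid)
    (hc : ps.IsChain Piece.Adj) :
    (consPiece a ps).flatMap Piece.word = a :: ps.flatMap Piece.word ∧
      (∀ p ∈ consPiece a ps, p.Valid) ∧ (consPiece a ps).IsChain Piece.Adj := by
  match ps, hv, hc with
  | [], _, _ => simp [consPiece, Piece.word, Piece.Valid, NoRepeat]
  | .rep b r :: ps, hv, hc =>
    have hr : 2 ≤ r := hv _ (List.mem_cons_self ..)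
    rw [List.isChain_cons] at hc
    simp only [consPiece]
    split_ifs with hab
    · subst hab
      refine ⟨by simp [Piece.word, List.replicate_succ], ?_, ?_⟩
      · intro p hp
        rcases List.mem_cons.1 hp with rfl | hp
        · exact Nat.le_succ_of_le hr
        · exact hv p (List.mem_cons_of_mem _ hp)
      · rw [List.isChain_cons]
        refine ⟨fun y hy => ⟨Or.inl trivial, ?_⟩, hc.2⟩
        have := (hc.1 y hy).2
        simpa [Piece.word, List.getLast?_replicate, (show r ≠ 0 by omega)] using this
    · refine ⟨by simp [Piece.word], ?_, ?_⟩
      · intro p hp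
        rcases List.mem_cons.1 hp with rfl | hp
        · simp [Piece.Valid, NoRepeat]
        · exact hv p hp
      · rw [List.isChain_cons]
        refine ⟨?_, List.isChain_cons.2 hc⟩
        simp [Piece.Adj, Piece.IsRep, Piece.word, List.head?_replicate, (show r ≠ 0 by omega), hab]
  | .plain [] :: ps, hv, _ => exact ((hv _ (List.mem_cons_self ..)).1 rfl).elim
  | .plain [b] :: ps, hv, hc =>
    rw [List.isChain_cons] at hc
    simp only [consPiece]
    split_ifs with hab
    · subst hab
      refine ⟨by simp [Piece.word, List.replicate_succ], ?_, ?_⟩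
      · intro p hp
        rcases List.mem_cons.1 hp with rfl | hp
        · exact le_rfl
        · exact hv p (List.mem_cons_of_mem _ hp)
      · rw [List.isChain_cons]
        refine ⟨fun y hy => ⟨Or.inl trivial, ?_⟩, hc.2⟩
        have := (hc.1 y hy).2
        simpa [Piece.word, List.getLast?_replicate] using this
    · refine ⟨by simp [Piece.word], ?_, ?_⟩
      · intro p hp
        rcases List.mem_cons.1 hp with rfl | hp
        · simp [Piece.Valid, NoRepeat, hab]
        · exact hv p (List.mem_cons_of_mem _ hp)
      · rw [List.isChain_cons]
        refine ⟨fun y hy => ⟨(hc.1 y hy).1, ?_⟩, hc.2⟩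
        simpa [Piece.word] using (hc.1 y hy).2
  | .plain (b :: c :: w) :: ps, hv, hc =>
    have hbv := (hv _ (List.mem_cons_self ..)).2
    rw [List.isChain_cons] at hc
    simp only [consPiece]
    split_ifs with hab
    · subst hab
      refine ⟨by simp [Piece.word, List.replicate_succ], ?_, ?_⟩
      · intro p hp
        rcases List.mem_cons.1 hp with rfl | hp
        · exact le_rfl
        · rcases List.mem_cons.1 hp with rfl | hp
          · exact ⟨by simp, (List.isChain_cons.1 hbv).2⟩
          · exact hv p (List.mem_cons_of_mem _ hp)
      · rw [List.isChain_cons, List.isChain_cons]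
        refine ⟨?_, fun y hy => ⟨(hc.1 y hy).1, ?_⟩, hc.2⟩
        · have : a ≠ c := by
            have := (List.isChain_cons.1 hbv).1
            simpa using this
          simp [Piece.Adj, Piece.IsRep, Piece.word, this]
        · simpa [Piece.word] using (hc.1 y hy).2
    · refine ⟨by simp [Piece.word], ?_, ?_⟩
      · intro p hp
        rcases List.mem_cons.1 hp with rfl | hp
        · exact ⟨by simp, List.isChain_cons.2 ⟨by simpa using hab, hbv⟩⟩
        · exact hv p (List.mem_cons_of_mem _ hp)
      · rw [List.isChain_cons]
        refine ⟨fun y hy => ⟨(hc.1 y hy).1, ?_⟩, hc.2⟩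
        simpa [Piece.word] using (hc.1 y hy).2

lemma pieces_spec [DecidableEq α] (B : List α) : (pieces B).flatMap Piece.word = B ∧
    (∀ p ∈ pieces B, p.Valid) ∧ (pieces B).IsChain Piece.Adj := by
  induction B with
  | nil => simp [pieces]
  | cons a B ih =>
    have := consPiece_spec a (pieces B) ih.2.1 ih.2.2
    rw [ih.1] at this
    exact this

lemma Piece.Valid.word_ne_nil {p : Piece α} (hp : p.Valid) : p.word ≠ [] := by
  cases p with
  | rep a r =>
    have : 2 ≤ r := hp
    simp [Piece.word]; omega
  | plain w => exact hp.1

/-- The marks of the symbols of a piece in front of which `Compress` cuts. -/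
def pieceFlags (F : List α → List ℕ) : Piece α → List Bool
  | .rep _ r => true :: List.replicate (r - 1) false
  | .plain w => if w.length = 1 then [true] else (F w).map fun c => decide (c = 1)

/-- The marks of the symbols of a string in front of which `Compress` cuts. -/
def flags [DecidableEq α] (F : List α → List ℕ) (B : List α) : List Bool := (pieces B).flatMap (pieceFlags F)

lemma length_pieceFlags {R : ℕ} {F : List α → List ℕ} (hF : IsLocalColoring R F) {p : Piece α}
    (hp : p.Valid) : (pieceFlags F p).length = p.word.length := by
  cases p with
  | rep a r =>
    have : 2 ≤ r := hp
    simp [pieceFlags, Piece.word]; omega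
  | plain w =>
    simp only [pieceFlags, Piece.word]
    split_ifs with h
    · simp [h]
    · simp [hF.length w hp.2]

lemma length_flatMap_pieceFlags {R : ℕ} {F : List α → List ℕ} (hF : IsLocalColoring R F)
    {ps : List (Piece α)} (hp : ∀ p ∈ ps, p.Valid) :
    (ps.flatMap (pieceFlags F)).length = (ps.flatMap Piece.word).length := by
  induction ps with
  | nil => rfl
  | cons p ps ih =>
    simp only [List.flatMap_cons, List.length_append]
    rw [ih fun q hq => hp q (List.mem_cons_of_mem _ hq),
      length_pieceFlags hF (hp p (List.mem_cons_self ..))]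

lemma length_flags [DecidableEq α] {R : ℕ} {F : List α → List ℕ} (hF : IsLocalColoring R F) (B : List α) :
    (flags F B).length = B.length := by
  rw [flags, length_flatMap_pieceFlags hF (pieces_spec B).2.1, (pieces_spec B).1]

lemma exists_flatMap_append {γ δ : Type*} (f : γ → List δ) (l : List γ) (i : ℕ)
    (hi : i < (l.flatMap f).length) : ∃ l₁ c l₂, l = l₁ ++ c :: l₂ ∧
      (l₁.flatMap f).length ≤ i ∧ i < (l₁.flatMap f).length + (f c).length := by
  induction l generalizing i with
  | nil => simp at hi
  | cons c l ih =>
    rcases lt_or_ge i (f c).length with h | h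
    · exact ⟨[], c, l, rfl, by simp, by simpa using h⟩
    · obtain ⟨l₁, d, l₂, e, h1, h2⟩ := ih (i - (f c).length) (by simp at hi ⊢; omega)
      refine ⟨c :: l₁, d, l₂, by simp [e], ?_, ?_⟩ <;>
      · simp only [List.flatMap_cons, List.length_append]
        omega

/-- The piece that contains a given position, with the conditions at its two borders. -/
lemma exists_piece [DecidableEq α] {R : ℕ} {F : List α → List ℕ} (hF : IsLocalColoring R F) (B : List α) (i : ℕ)
    (hi : i < B.length) : ∃ U p V, B = U ++ (p.word ++ V) ∧ p.Valid ∧ U.length ≤ i ∧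
      i < U.length + p.word.length ∧ (flags F B)[i]? = (pieceFlags F p)[i - U.length]? ∧
      (∀ a ∈ U.getLast?, ∀ b ∈ p.word.head?, a ≠ b) ∧
      (∀ a ∈ p.word.getLast?, ∀ b ∈ V.head?, a ≠ b) ∧
      (¬ p.IsRep → (U = [] ∨ ∃ U' b, U = U' ++ [b, b]) ∧ (V = [] ∨ ∃ b V', V = b :: b :: V')) := by
  obtain ⟨hw, hv, hc⟩ := pieces_spec B
  obtain ⟨ps, p, qs, e, h1, h2⟩ := exists_flatMap_append Piece.word (pieces B) i (by rwa [hw])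
  rw [e] at hv hc hw
  have hps : ∀ q ∈ ps, q.Valid := fun q hq => hv q (by simp [hq])
  have hqs : ∀ q ∈ qs, q.Valid := fun q hq => hv q (by simp [hq])
  have hl := length_flatMap_pieceFlags hF hps
  have hp := length_pieceFlags hF (hv p (by simp))
  have hc2 := (List.isChain_cons.1 hc.right_of_append).1
  refine ⟨ps.flatMap Piece.word, p, qs.flatMap Piece.word, by rw [← hw]; simp, hv p (by simp), h1,
    h2, ?_, ?_, ?_, ?_⟩
  · rw [flags, e, List.flatMap_append, List.flatMap_cons,
      List.getElem?_append_right (by omega), List.getElem?_append_left (by omega), hl]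
  · rcases List.eq_nil_or_concat ps with rfl | ⟨ps', q, rfl⟩
    · simp
    · have h0 := (hc.rel_getLast_head_of_append (by simp) (by simp))
      simp only [List.concat_eq_append, List.getLast_append_singleton, List.head_cons] at h0
      have hq := (hps q (by simp)).word_ne_nil
      have := h0.2
      simpa [List.getLast?_append, List.getLast?_eq_some_getLast hq] using this
  · cases qs with
    | nil => simp
    | cons q qs =>
      have h0 := hc2 q (by simp)
      have hq := (hqs q (by simp)).word_ne_nil
      have := h0.2
      simpa [List.head?_append, List.head?_eq_some_head hq] using this
  · intro hrep
    constructor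
    · rcases List.eq_nil_or_concat ps with rfl | ⟨ps', q, rfl⟩
      · simp
      · right
        have h0 := (hc.rel_getLast_head_of_append (by simp) (by simp))
        simp only [List.concat_eq_append, List.getLast_append_singleton, List.head_cons] at h0
        have hq := hps q (by simp)
        match q, h0.1.resolve_right hrep, hq with
        | .rep b r, _, hq =>
          have hr : 2 ≤ r := hq
          obtain ⟨r, rfl⟩ := Nat.exists_eq_add_of_le' hr
          refine ⟨ps'.flatMap Piece.word ++ List.replicate r b, b, ?_⟩
          simp [Piece.word, List.replicate_add]
    · cases qs with
      | nil => simp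
      | cons q qs =>
        right
        have h0 := hc2 q (by simp)
        have hq := hqs q (by simp)
        match q, h0.1.resolve_left hrep, hq with
        | .rep b r, _, hq =>
          have hr : 2 ≤ r := hq
          obtain ⟨r, rfl⟩ := Nat.exists_eq_add_of_le' hr
          refine ⟨b, List.replicate r b ++ qs.flatMap Piece.word, ?_⟩
          simp [Piece.word, List.replicate_succ]

end Pieces

/-! ### Locality of the cuts -/

section Locality

variable {α : Type*}

lemma symbolAt_append_left {U X : List α} {t : ℤ} (h : t < U.length) :
    symbolAt (U ++ X) t = symbolAt U t := by
  unfold symbolAt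
  split_ifs with h0
  · rw [List.getElem?_append_left (by omega)]
  · rfl

lemma symbolAt_append_right {U X : List α} {t : ℤ} (h : (U.length : ℤ) ≤ t) :
    symbolAt (U ++ X) t = symbolAt X (t - U.length) := by
  unfold symbolAt
  rw [if_pos (by omega), if_pos (by omega), List.getElem?_append_right (by omega)]
  congr 1
  omega

/-- The position `t` is not inside of a plain piece: it is outside of the string, or its symbol
is repeated. -/
def Blocked (B : List α) (t : ℤ) : Prop :=
  symbolAt B t = none ∨ symbolAt B t = symbolAt B (t - 1) ∨ symbolAt B t = symbolAt B (t + 1)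

lemma blocked_rep {U V : List α} {a : α} {r : ℕ} (hr : 2 ≤ r) {t : ℤ} (h0 : (U.length : ℤ) ≤ t)
    (h1 : t < U.length + r) : Blocked (U ++ (List.replicate r a ++ V)) t := by
  have key : ∀ q : ℤ, (U.length : ℤ) ≤ q → q < U.length + r →
      symbolAt (U ++ (List.replicate r a ++ V)) q = some a := by
    intro q h0 h1
    rw [symbolAt_append_right h0, symbolAt_append_left (by simp; omega), symbolAt,
      if_pos (by omega), List.getElem?_replicate, if_pos (by omega)]
  right
  rcases eq_or_lt_of_le h0 with h | h
  · right
    rw [key t h0 h1, key (t + 1) (by omega) (by omega)]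
  · left
    rw [key t h0 h1, key (t - 1) (by omega) (by omega)]

lemma symbolAt_sub_one_ne_iff_of_rep {U V : List α} {a : α} {r : ℕ}
    (hb : ∀ x ∈ U.getLast?, ∀ y ∈ (List.replicate r a).head?, x ≠ y) {t : ℤ}
    (h0 : (U.length : ℤ) ≤ t) (h1 : t < U.length + r) :
    symbolAt (U ++ (List.replicate r a ++ V)) (t - 1) ≠ symbolAt (U ++ (List.replicate r a ++ V)) t
      ↔ t = U.length := by
  have key : ∀ q : ℤ, (U.length : ℤ) ≤ q → q < U.length + r →
      symbolAt (U ++ (List.replicate r a ++ V)) q = some a := by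
    intro q h0 h1
    rw [symbolAt_append_right h0, symbolAt_append_left (by simp; omega), symbolAt,
      if_pos (by omega), List.getElem?_replicate, if_pos (by omega)]
  rw [key t h0 h1]
  constructor
  · intro h
    by_contra hne
    exact h (key (t - 1) (by omega) (by omega))
  · rintro rfl h
    rw [symbolAt_append_left (by omega)] at h
    have hpos : U.length ≠ 0 := by
      intro h0
      have := (symbolAt_ne_none_iff U (U.length - 1)).1 (by rw [h]; simp)
      omega
    refine hb a ?_ a ?_ rfl
    · rw [Option.mem_def, List.getLast?_eq_getElem?, ← symbolAt_natCast, ← h]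
      congr 1
      omega
    · simp only [Option.mem_def, List.head?_replicate]
      rw [if_neg (by omega)]

lemma symbolAt_succ_ne_of_plain {U w V : List α} (hw : NoRepeat w) (hw0 : w ≠ [])
    (hU : ∀ a ∈ U.getLast?, ∀ b ∈ w.head?, a ≠ b) (hV : ∀ a ∈ w.getLast?, ∀ b ∈ V.head?, a ≠ b)
    {t : ℤ} (h0 : (U.length : ℤ) - 1 ≤ t) (h1 : t < U.length + w.length) {a : α}
    (ht : symbolAt (U ++ (w ++ V)) t = some a) : symbolAt (U ++ (w ++ V)) (t + 1) ≠ some a := by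
  have hl : 0 < w.length := List.length_pos_iff.2 hw0
  intro ht'
  rcases lt_or_ge t U.length with h | h
  · have hneg := (symbolAt_ne_none_iff _ t).1 (by rw [ht]; simp)
    rw [symbolAt_append_left h] at ht
    rw [symbolAt_append_right (by omega), symbolAt_append_left (by omega)] at ht'
    refine hU a ?_ a ?_ rfl
    · rw [Option.mem_def, List.getLast?_eq_getElem?, ← symbolAt_natCast, ← ht]
      congr 1
      omega
    · rw [Option.mem_def, List.head?_eq_getElem?, ← symbolAt_natCast, ← ht']
      congr 1
      push_cast
      omega
  · rw [symbolAt_append_right h, symbolAt_append_left (by omega)] at ht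
    rw [symbolAt_append_right (by omega)] at ht'
    rcases lt_or_ge (t + 1) (U.length + w.length) with h2 | h2
    · rw [symbolAt_append_left (by omega)] at ht'
      refine hw.streamProper _ _ ht ?_
      rw [← ht']
      congr 1
      omega
    · rw [symbolAt_append_right (by omega)] at ht'
      refine hV a ?_ a ?_ rfl
      · rw [Option.mem_def, List.getLast?_eq_getElem?, ← symbolAt_natCast, ← ht]
        congr 1
        omega
      · rw [Option.mem_def, List.head?_eq_getElem?, ← symbolAt_natCast, ← ht']
        congr 1
        push_cast
        omega

/-- Together with `blocked_rep`, `blocked_left` and `blocked_right`: the plain pieces are the maximal stretches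
of positions that are not blocked. -/
lemma not_blocked_plain {U w V : List α} (hw : NoRepeat w) (hw0 : w ≠ [])
    (hU : ∀ a ∈ U.getLast?, ∀ b ∈ w.head?, a ≠ b) (hV : ∀ a ∈ w.getLast?, ∀ b ∈ V.head?, a ≠ b)
    {t : ℤ} (h0 : (U.length : ℤ) ≤ t) (h1 : t < U.length + w.length) :
    ¬ Blocked (U ++ (w ++ V)) t := by
  obtain ⟨a, ha⟩ := Option.ne_none_iff_exists'.1
    ((symbolAt_ne_none_iff (U ++ (w ++ V)) t).2 (by simp; omega))
  rintro (h | h | h)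
  · simp [ha] at h
  · refine symbolAt_succ_ne_of_plain hw hw0 hU hV (t := t - 1) (by omega) (by omega)
      (h.symm.trans ha) ?_
    rw [sub_add_cancel, ha]
  · exact symbolAt_succ_ne_of_plain hw hw0 hU hV (t := t) (by omega) h1 ha (h.symm.trans ha)

lemma blocked_left {U X : List α} (h : U = [] ∨ ∃ U' b, U = U' ++ [b, b]) :
    Blocked (U ++ X) ((U.length : ℤ) - 1) := by
  rcases h with rfl | ⟨U', b, rfl⟩
  · left
    rw [symbolAt_eq_none_iff]
    simp
  · right; left
    have e : U' ++ [b, b] ++ X = U' ++ b :: b :: X := by simp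
    rw [e, symbolAt_append_right (by simp), symbolAt_append_right (by simp; omega)]
    have e1 : ((U' ++ [b, b]).length : ℤ) - 1 - U'.length = (1 : ℕ) := by simp; omega
    have e2 : ((U' ++ [b, b]).length : ℤ) - 1 - 1 - U'.length = (0 : ℕ) := by simp; omega
    rw [e1, e2, symbolAt_natCast, symbolAt_natCast]
    rfl

lemma blocked_right {U V : List α} (h : V = [] ∨ ∃ b V', V = b :: b :: V') :
    Blocked (U ++ V) (U.length : ℤ) := by
  rcases h with rfl | ⟨b, V', rfl⟩
  · left
    rw [symbolAt_eq_none_iff]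
    simp
  · right; right
    rw [symbolAt_append_right (by omega), symbolAt_append_right (by omega)]
    have e1 : (U.length : ℤ) - U.length = (0 : ℕ) := by simp
    have e2 : (U.length : ℤ) + 1 - U.length = (1 : ℕ) := by simp
    rw [e1, e2, symbolAt_natCast, symbolAt_natCast]
    rfl

variable [DecidableEq α]

/-- Whether `Compress` cuts in front of a position depends only on the symbols at distance at most
`R + 2` from it: those at distance one more than `R` tell which of the symbols at distance at most
`R` belong to the same plain piece. -/
theorem flags_local {R : ℕ} {F : List α → List ℕ} (hF : IsLocalColoring R F) {B B' : List α}
    {i i' : ℕ} (hi : i < B.length) (hi' : i' < B'.length)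
    (h : ∀ d : ℤ, |d| ≤ (R : ℤ) + 2 → symbolAt B (i + d) = symbolAt B' (i' + d)) :
    (flags F B)[i]? = (flags F B')[i']? := by
  have hbl : ∀ d : ℤ, |d| ≤ (R : ℤ) + 1 → (Blocked B (i + d) ↔ Blocked B' (i' + d)) := by
    intro d hd
    rw [abs_le] at hd
    have e0 := h d (by rw [abs_le]; omega)
    have e1 := h (d - 1) (by rw [abs_le]; omega)
    have e2 := h (d + 1) (by rw [abs_le]; omega)
    rw [← add_sub_assoc, ← add_sub_assoc] at e1
    rw [← add_assoc, ← add_assoc] at e2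
    rw [Blocked, Blocked, e0, e1, e2]
  obtain ⟨U, p, V, eB, hp, hUi, hiU, hfl, hbU, hbV, hrep⟩ := exists_piece hF B i hi
  obtain ⟨U', p', V', eB', hp', hUi', hiU', hfl', hbU', hbV', hrep'⟩ := exists_piece hF B' i' hi'
  rw [hfl, hfl']
  have hb0 : Blocked B i ↔ Blocked B' i' := by simpa using hbl 0 (by simp; positivity)
  match p, p' with
  | .rep a r, .rep a' r' =>
    have hr : 2 ≤ r := hp
    have hr' : 2 ≤ r' := hp'
    simp only [Piece.word, List.length_replicate] at hiU hiU' hbU hbU' eB eB'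
    have k1 := symbolAt_sub_one_ne_iff_of_rep (V := V) hbU (t := i) (by omega) (by omega)
    have k2 := symbolAt_sub_one_ne_iff_of_rep (V := V') hbU' (t := i') (by omega) (by omega)
    rw [← eB] at k1
    rw [← eB'] at k2
    have e1 := h (-1) (by simp; omega)
    have e0 := h 0 (by simp; positivity)
    simp only [add_zero, ← sub_eq_add_neg] at e0 e1
    rw [e0, e1, k2] at k1
    have key : ∀ (s j : ℕ), j < s → (pieceFlags F (.rep a s))[j]? = some (decide (j = 0)) := by
      intro s j hj
      cases j with
      | zero => rfl
      | succ j =>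
        simp only [pieceFlags, List.getElem?_cons_succ, List.getElem?_replicate]
        rw [if_pos (by omega)]
        simp
    have key' : ∀ (s j : ℕ), j < s → (pieceFlags F (.rep a' s))[j]? = some (decide (j = 0)) := by
      intro s j hj
      cases j with
      | zero => rfl
      | succ j =>
        simp only [pieceFlags, List.getElem?_cons_succ, List.getElem?_replicate]
        rw [if_pos (by omega)]
        simp
    rw [key _ _ (by omega), key' _ _ (by omega)]
    congr 2
    apply propext
    omega
  | .rep a r, .plain w' =>
    exfalso
    have b1 := blocked_rep (U := U) (a := a) (V := V) (show 2 ≤ r from hp) (t := i) (by omega)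
      (by simp only [Piece.word, List.length_replicate] at hiU; omega)
    have b2 := not_blocked_plain hp'.2 hp'.1 hbU' hbV' (t := i') (by omega) (by
      simp only [Piece.word] at hiU'; omega)
    simp only [Piece.word] at eB eB'
    rw [← eB] at b1
    rw [← eB'] at b2
    exact b2 (hb0.1 b1)
  | .plain w, .rep a' r' =>
    exfalso
    have b1 := blocked_rep (U := U') (a := a') (V := V') (show 2 ≤ r' from hp') (t := i') (by omega)
      (by simp only [Piece.word, List.length_replicate] at hiU'; omega)
    have b2 := not_blocked_plain hp.2 hp.1 hbU hbV (t := i) (by omega) (by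
      simp only [Piece.word] at hiU; omega)
    simp only [Piece.word] at eB eB'
    rw [← eB'] at b1
    rw [← eB] at b2
    exact b2 (hb0.2 b1)
  | .plain w, .plain w' =>
    simp only [Piece.word] at *
    have nb : ∀ t : ℤ, (U.length : ℤ) ≤ t → t < U.length + w.length → ¬ Blocked B t := by
      intro t h0 h1
      rw [eB]
      exact not_blocked_plain hp.2 hp.1 hbU hbV h0 h1
    have nb' : ∀ t : ℤ, (U'.length : ℤ) ≤ t → t < U'.length + w'.length → ¬ Blocked B' t := by
      intro t h0 h1
      rw [eB']
      exact not_blocked_plain hp'.2 hp'.1 hbU' hbV' h0 h1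
    have bl : Blocked B ((U.length : ℤ) - 1) := by
      rw [eB]; exact blocked_left (hrep id).1
    have bl' : Blocked B' ((U'.length : ℤ) - 1) := by
      rw [eB']; exact blocked_left (hrep' id).1
    have br : Blocked B ((U.length : ℤ) + w.length) := by
      have := blocked_right (U := U ++ w) (hrep id).2
      rw [List.append_assoc, ← eB] at this
      simpa using this
    have br' : Blocked B' ((U'.length : ℤ) + w'.length) := by
      have := blocked_right (U := U' ++ w') (hrep' id).2
      rw [List.append_assoc, ← eB'] at this
      simpa using this
    -- the two plain pieces extend equally far, as far as one can see
    have hin : ∀ d : ℤ, |d| ≤ (R : ℤ) + 1 →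
        (((U.length : ℤ) ≤ i + d ∧ (i : ℤ) + d < U.length + w.length) ↔
          ((U'.length : ℤ) ≤ i' + d ∧ (i' : ℤ) + d < U'.length + w'.length)) := by
      intro d hd
      rw [abs_le] at hd
      constructor
      · rintro ⟨h0, h1⟩
        by_contra hcon
        rcases lt_or_ge ((i' : ℤ) + d) U'.length with h2 | h2
        · refine nb (i + ((U'.length : ℤ) - 1 - i')) (by omega) (by omega) ?_
          rw [hbl _ (by rw [abs_le]; omega)]
          convert bl' using 1
          ring
        · refine nb (i + ((U'.length : ℤ) + w'.length - i')) (by omega) (by omega) ?_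
          rw [hbl _ (by rw [abs_le]; omega)]
          convert br' using 1
          ring
      · rintro ⟨h0, h1⟩
        by_contra hcon
        rcases lt_or_ge ((i : ℤ) + d) U.length with h2 | h2
        · refine nb' (i' + ((U.length : ℤ) - 1 - i)) (by omega) (by omega) ?_
          rw [← hbl _ (by rw [abs_le]; omega)]
          convert bl using 1
          ring
        · refine nb' (i' + ((U.length : ℤ) + w.length - i)) (by omega) (by omega) ?_
          rw [← hbl _ (by rw [abs_le]; omega)]
          convert br using 1
          ring
    have hsym : ∀ d : ℤ, |d| ≤ (R : ℤ) + 1 →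
        symbolAt w ((i - U.length : ℕ) + d) = symbolAt w' ((i' - U'.length : ℕ) + d) := by
      intro d hd
      have hd' := abs_le.1 hd
      by_cases hI : (U.length : ℤ) ≤ i + d ∧ (i : ℤ) + d < U.length + w.length
      · have hI' := (hin d hd).1 hI
        have e := h d (by rw [abs_le]; omega)
        rw [eB, eB', symbolAt_append_right hI.1, symbolAt_append_left (by omega),
          symbolAt_append_right hI'.1, symbolAt_append_left (by omega)] at e
        convert e using 2 <;> omega
      · have hI' := mt (hin d hd).2 hI
        rw [(symbolAt_eq_none_iff _ _).2 (by omega), (symbolAt_eq_none_iff _ _).2 (by omega)]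
    have hlen : w.length = 1 ↔ w'.length = 1 := by
      have i0 := hin (-1) (by rw [abs_le]; omega)
      have i1 := hin 1 (by rw [abs_le]; omega)
      omega
    simp only [pieceFlags]
    by_cases h1 : w.length = 1
    · rw [if_pos h1, if_pos (hlen.1 h1)]
      have h2 := hlen.1 h1
      congr 1
      omega
    · rw [if_neg h1, if_neg (fun hh => h1 (hlen.2 hh)), List.getElem?_map, List.getElem?_map,
        ← symbolAt_natCast, ← symbolAt_natCast,
        hF.local_dep w w' hp.2 hp'.2 _ _ fun d hd => hsym d (by omega)]

/-- The marks of a common prefix agree, except near its right end. -/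
lemma take_flags_append {R : ℕ} {F : List α → List ℕ} (hF : IsLocalColoring R F)
    {P Y : List α} (Z Z' : List α) (hP : P = [] ∨ R + 2 ≤ Y.length) :
    (flags F (P ++ (Y ++ Z))).take P.length = (flags F (P ++ (Y ++ Z'))).take P.length := by
  rcases hP with rfl | hY
  · simp
  apply List.ext_getElem?
  intro i
  rw [List.getElem?_take, List.getElem?_take]
  split_ifs with hi
  · apply flags_local hF (by simp; omega) (by simp; omega)
    intro d hd
    rw [abs_le] at hd
    have key : ∀ W, symbolAt (P ++ (Y ++ W)) (i + d) = symbolAt (P ++ Y) (i + d) := fun W => by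
      rw [← List.append_assoc, symbolAt_append_left (by simp; omega)]
    rw [key, key]
  · rfl

/-- The marks of a common suffix agree, except near its left end. -/
lemma drop_flags_append {R : ℕ} {F : List α → List ℕ} (hF : IsLocalColoring R F)
    {Y Q : List α} (Z Z' : List α) (hQ : Q = [] ∨ R + 2 ≤ Y.length) :
    (flags F (Z ++ (Y ++ Q))).drop (Z ++ Y).length =
      (flags F (Z' ++ (Y ++ Q))).drop (Z' ++ Y).length := by
  rcases hQ with rfl | hY
  · rw [List.drop_eq_nil_of_le, List.drop_eq_nil_of_le] <;> simp [length_flags hF]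
  apply List.ext_getElem?
  intro i
  rw [List.getElem?_drop, List.getElem?_drop]
  rcases lt_or_ge i Q.length with hi | hi
  · apply flags_local hF (by simp; omega) (by simp; omega)
    intro d hd
    rw [abs_le] at hd
    rw [symbolAt_append_right (U := Z) (by simp; omega),
      symbolAt_append_right (U := Z') (by simp; omega)]
    congr 1
    simp
    ring
  · rw [List.getElem?_eq_none (by simp [length_flags hF]; omega),
      List.getElem?_eq_none (by simp [length_flags hF]; omega)]

end Locality

/-! ### The parts that are compressed -/

section Chunks

variable {α : Type*}

/-- A repetition with exponent at least two. -/
def RepChunk (c : List α) : Prop := ∃ a r, 2 ≤ r ∧ c = List.replicate r a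

/-- A part of two or three symbols that starts with two different symbols. -/
def ShortChunk (c : List α) : Prop := ∃ a b, a ≠ b ∧ (c = [a, b] ∨ ∃ d, c = [a, b, d])

/-- The sequences of parts into which strings are cut: repetitions, parts of two or three symbols, and
single symbols; the neighbors of a single symbol are repetitions. -/
def GoodChunks (cs : List (List α)) : Prop :=
  (∀ c ∈ cs, c.length = 1 ∨ RepChunk c ∨ ShortChunk c) ∧
    cs.IsChain fun c d => (c.length = 1 → RepChunk d) ∧ (d.length = 1 → RepChunk c)

lemma RepChunk.length {c : List α} (h : RepChunk c) : 2 ≤ c.length := by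
  obtain ⟨a, r, hr, rfl⟩ := h
  simpa using hr

lemma ShortChunk.length {c : List α} (h : ShortChunk c) : 2 ≤ c.length := by
  obtain ⟨a, b, _, rfl | ⟨d, rfl⟩⟩ := h <;> simp

/-- The condition on the colors of a plain piece of at least two symbols that is used for cutting
it. -/
structure ColoredPiece (z : List (α × ℕ)) : Prop where
  noRepeat : NoRepeat (z.map Prod.fst)
  proper : NoRepeat (z.map Prod.snd)
  one_in_three : ∀ p q a b c, z.map Prod.snd = p ++ [a, b, c] ++ q → a = 1 ∨ b = 1 ∨ c = 1
  first : (z.map Prod.snd).head? = some 1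
  last : ∀ c ∈ (z.map Prod.snd).getLast?, c ≠ 1

lemma ColoredPiece.of_append {y z : List (α × ℕ)} (h : ColoredPiece (y ++ z))
    (hz : (z.map Prod.snd).head? = some 1) : ColoredPiece z := by
  have hne : z.map Prod.snd ≠ [] := by rintro e; simp [e] at hz
  constructor
  · have := h.noRepeat
    rw [List.map_append] at this
    exact this.right_of_append
  · have := h.proper
    rw [List.map_append] at this
    exact this.right_of_append
  · intro p q a b c e
    exact h.one_in_three (y.map Prod.snd ++ p) q a b c (by simp [e])
  · exact hz
  · have := h.last
    rw [List.map_append, List.getLast?_append_of_ne_nil _ hne] at this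
    exact this

end Chunks

section Compress

variable {S : Type*} {n : ℕ}

lemma coloredPiece_zip {R : ℕ} {F : List (Gam S n) → List ℕ} (hF : IsLocalColoring R F)
    {w : List (Gam S n)} (hw : NoRepeat w) (h2 : 2 ≤ w.length) : ColoredPiece (w.zip (F w)) := by
  have hl := hF.length w hw
  have e1 : (w.zip (F w)).map Prod.fst = w := List.map_fst_zip (by omega)
  have e2 : (w.zip (F w)).map Prod.snd = F w := List.map_snd_zip (by omega)
  refine ⟨?_, ?_, ?_, ?_, ?_⟩
  · rw [e1]; exact hw
  · rw [e2]; exact hF.proper w hw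
  · rw [e2]; exact hF.one_in_three w hw
  · rw [e2]; exact hF.first w hw h2
  · rw [e2]
    intro c hc
    rcases hF.last w hw h2 with h | h <;>
    · rw [Option.mem_def, h] at hc
      simp at hc
      omega

variable [DecidableEq S]

/-- The symbols that replace a part of a string: one for a repetition `a ^ r`, `C(ab)` or `C(ab) c` for
a part that starts with two different symbols. -/
noncomputable def chunkOut (C : Gam S n × Gam S n → Comp n) : List (Gam S n) → List (Gam S n)
  | [] => []
  | [a] => [a]
  | a :: b :: w =>
      if a = b then [repeatSymbol a (w.length + 2)] else compSym (C (a, b)) :: w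

/-- A colored piece is cut in front of its symbols of color `1` into parts of two or three symbols, since
there is a color `1` in each window of three but never twice in a row. -/
lemma exists_chunks_plain (z : List (Gam S n × ℕ)) (hz : ColoredPiece z) :
    ∃ cs, chop (z.map fun p => (p.1, decide (p.2 = 1))) = [] :: cs ∧
      (∀ C, compressPlain C z = cs.flatMap (chunkOut C)) ∧ (∀ c ∈ cs, ShortChunk c) ∧ cs ≠ [] := by
  induction hl : z.length using Nat.strong_induction_on generalizing z with
  | _ m ih =>
  subst hl
  match z, hz, ih with
  | [], hz, _ => have := hz.first; simp at this
  | [(a, col)], hz, _ =>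
    have h1 := hz.first
    have h2 := hz.last
    simp at h1 h2
    exact (h2 h1).elim
  | [(a, col), (b, col')], hz, _ =>
    have h1 : col = 1 := by simpa using hz.first
    have h2 : col' ≠ 1 := by simpa using hz.last
    have h3 : a ≠ b := by simpa [NoRepeat] using hz.noRepeat
    exact ⟨[[a, b]], by simp [chop, consHead, h1, h2], by simp [compressPlain, chunkOut, h3],
      by simpa using ⟨a, b, h3, Or.inl rfl⟩, by simp⟩
  | (a, col) :: (b, col') :: (c, col'') :: w, hz, ih =>
    have h1 : col = 1 := by simpa using hz.first
    have h2 : col' ≠ 1 := by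
      have := hz.proper
      simp [NoRepeat, h1] at this
      exact fun h => this.1 h.symm
    have h3 : a ≠ b := by
      have := hz.noRepeat
      simp [NoRepeat] at this
      exact this.1
    by_cases h4 : col'' = 1
    · obtain ⟨cs, e1, e2, e3, e4⟩ := ih _ (by simp) ((c, col'') :: w)
        (ColoredPiece.of_append (y := [(a, col), (b, col')]) hz (by simpa using h4)) rfl
      refine ⟨[a, b] :: cs, ?_, ?_, ?_, by simp⟩
      · rw [List.map_cons, List.map_cons]
        simp only [h1, h2, decide_true, decide_false]
        exact chop_cons_true a (chop_cons_false b e1)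
      · intro C
        rw [compressPlain, if_pos h4, e2 C]
        simp [chunkOut, h3]
      · intro d hd
        rcases List.mem_cons.1 hd with rfl | hd
        · exact ⟨a, b, h3, Or.inl rfl⟩
        · exact e3 d hd
    · have hw : ∃ cs, chop (w.map fun p => (p.1, decide (p.2 = 1))) = [] :: cs ∧
          (∀ C, compressPlain C w = cs.flatMap (chunkOut C)) ∧ (∀ c ∈ cs, ShortChunk c) := by
        cases w with
        | nil => exact ⟨[], rfl, by simp [compressPlain], by simp⟩
        | cons d w =>
          have h5 : d.2 = 1 := by
            have := hz.one_in_three [1] (w.map Prod.snd) col' col'' d.2 (by simp [h1])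
            tauto
          obtain ⟨cs, e1, e2, e3, e4⟩ := ih _ (by simp) (d :: w)
            (ColoredPiece.of_append (y := [(a, col), (b, col'), (c, col'')]) hz (by simpa using h5))
            rfl
          exact ⟨cs, e1, e2, e3⟩
      obtain ⟨cs, e1, e2, e3⟩ := hw
      refine ⟨[a, b, c] :: cs, ?_, ?_, ?_, by simp⟩
      · rw [List.map_cons, List.map_cons, List.map_cons]
        simp only [h1, h2, h4, decide_true, decide_false]
        exact chop_cons_true a (chop_cons_false b (chop_cons_false c e1))
      · intro C
        rw [compressPlain, if_neg h4, e2 C]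
        simp [chunkOut, h3]
      · intro d hd
        rcases List.mem_cons.1 hd with rfl | hd
        · exact ⟨a, b, h3, Or.inr ⟨c, rfl⟩⟩
        · exact e3 d hd

lemma chunkOut_replicate (C : Gam S n × Gam S n → Comp n) (a : Gam S n) {r : ℕ} (hr : 2 ≤ r) :
    chunkOut C (List.replicate r a) = [repeatSymbol a r] := by
  obtain ⟨r, rfl⟩ := Nat.exists_eq_add_of_le' hr
  simp [List.replicate_succ, chunkOut]

lemma chop_map_false {β : Type*} (l : List β) :
    chop (l.zip (List.replicate l.length false)) = [l] := by
  induction l with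
  | nil => rfl
  | cons a l ih => exact chop_cons_false a ih

/-- The symbols that replace a piece. -/
noncomputable def pieceOut (F : List (Gam S n) → List ℕ) (C : Gam S n × Gam S n → Comp n) :
    Piece (Gam S n) → List (Gam S n)
  | .rep a r => [repeatSymbol a r]
  | .plain w => compressPlain C (w.zip (F w))

lemma exists_chunks_piece {R : ℕ} {F : List (Gam S n) → List ℕ} (hF : IsLocalColoring R F)
    {p : Piece (Gam S n)} (hp : p.Valid) :
    ∃ cs, chop (p.word.zip (pieceFlags F p)) = [] :: cs ∧
      (∀ C, pieceOut F C p = cs.flatMap (chunkOut C)) ∧ cs ≠ [] ∧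
      ((p.IsRep ∧ ∃ c, RepChunk c ∧ cs = [c]) ∨ (¬ p.IsRep ∧ ∃ a, cs = [[a]]) ∨
        (¬ p.IsRep ∧ ∀ c ∈ cs, ShortChunk c)) := by
  match p, hp with
  | .rep a r, hp =>
    have hr : 2 ≤ r := hp
    refine ⟨[List.replicate r a], ?_, ?_, by simp, Or.inl ⟨trivial, _, ⟨a, r, hr, rfl⟩, rfl⟩⟩
    · obtain ⟨r, rfl⟩ := Nat.exists_eq_add_of_le' hr
      have := chop_map_false (List.replicate (r + 1) a)
      rw [List.length_replicate] at this
      exact chop_cons_true a this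
    · intro C
      simp [pieceOut, chunkOut_replicate C a hr]
  | .plain w, hp =>
    by_cases h1 : w.length = 1
    · obtain ⟨a, rfl⟩ := List.length_eq_one_iff.1 h1
      refine ⟨[[a]], by simp [Piece.word, pieceFlags, chop, consHead], ?_, by simp,
        Or.inr (Or.inl ⟨id, a, rfl⟩)⟩
      simp [pieceOut, hF.single, compressPlain, chunkOut]
    · have h2 : 2 ≤ w.length := by
        have := List.length_pos_iff.2 hp.1
        omega
      obtain ⟨cs, e1, e2, e3, e4⟩ := exists_chunks_plain _ (coloredPiece_zip hF hp.2 h2)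
      refine ⟨cs, ?_, e2, e4, Or.inr (Or.inr ⟨id, e3⟩)⟩
      simp only [Piece.word, pieceFlags, if_neg h1]
      rw [← e1]
      congr 1
      rw [List.zip_map_right]
      apply List.map_congr_left
      intro p _
      rfl

/-- `Compress` cuts a string at its marks and replaces the resulting parts one by one. -/
lemma exists_chunks {R : ℕ} {F : List (Gam S n) → List ℕ} (hF : IsLocalColoring R F)
    (B : List (Gam S n)) :
    ∃ cs, chop (B.zip (flags F B)) = [] :: cs ∧
      (∀ C, compress F C B = cs.flatMap (chunkOut C)) ∧ GoodChunks cs := by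
  obtain ⟨hw, hv, hc⟩ := pieces_spec B
  have key : ∀ ps : List (Piece (Gam S n)), (∀ p ∈ ps, p.Valid) → ps.IsChain Piece.Adj →
      ∃ cs, chop ((ps.flatMap Piece.word).zip (ps.flatMap (pieceFlags F))) = [] :: cs ∧
      (∀ C, ps.flatMap (pieceOut F C) = cs.flatMap (chunkOut C)) ∧ GoodChunks cs ∧
      (∀ q ∈ ps.head?, q.IsRep → ∀ c ∈ cs.head?, RepChunk c) := by
    intro ps
    induction ps with
    | nil =>
      intro _ _
      exact ⟨[], rfl, by simp, ⟨by simp, by simp⟩, by simp⟩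
    | cons p ps ih =>
      intro hv hc
      rw [List.isChain_cons] at hc
      obtain ⟨cs, e1, e2, e3, e4⟩ := ih (fun q hq => hv q (List.mem_cons_of_mem _ hq)) hc.2
      obtain ⟨ds, f1, f2, f3, f4⟩ := exists_chunks_piece hF (hv p (List.mem_cons_self ..))
      refine ⟨ds ++ cs, ?_, ?_, ⟨?_, ?_⟩, ?_⟩
      · rw [List.flatMap_cons, List.flatMap_cons,
          List.zip_append (length_pieceFlags hF (hv p (List.mem_cons_self ..))).symm]
        obtain ⟨As, l, e⟩ := exists_eq_append_singleton f3
        rw [e, ← List.cons_append] at f1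
        rw [chop_append f1 e1, e]
        simp
      · intro C
        rw [List.flatMap_cons, List.flatMap_append, f2, e2]
      · intro c hc
        rcases List.mem_append.1 hc with hc | hc
        · rcases f4 with ⟨_, d, hd, rfl⟩ | ⟨_, a, rfl⟩ | ⟨_, h⟩
          · rw [List.mem_singleton.1 hc]
            exact Or.inr (Or.inl hd)
          · rw [List.mem_singleton.1 hc]
            exact Or.inl rfl
          · exact Or.inr (Or.inr (h c hc))
        · exact e3.1 c hc
      · -- at the border between two pieces one of the two parts is a repetition
        have hnext : ¬ p.IsRep → ∀ d ∈ cs.head?, RepChunk d := by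
          intro hp d hd
          cases ps with
          | nil =>
            simp [chop] at e1
            simp [e1] at hd
          | cons q ps => exact e4 q (by simp) ((hc.1 q (by simp)).1.resolve_left hp) d hd
        refine List.IsChain.append ?_ e3.2 ?_
        · rcases f4 with ⟨_, d, hd, rfl⟩ | ⟨_, a, rfl⟩ | ⟨_, h⟩
          · simp
          · simp
          · rw [List.isChain_iff_getElem]
            intro i hi
            have h1 := (h _ (List.getElem_mem (Nat.lt_of_succ_lt hi))).length
            have h2 := (h _ (List.getElem_mem hi)).length
            exact ⟨fun h => by omega, fun h => by omega⟩
        · intro c hc d hd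
          rcases f4 with ⟨_, d', hd', rfl⟩ | ⟨hp, a, rfl⟩ | ⟨hp, h⟩
          · simp only [List.getLast?_singleton, Option.mem_def, Option.some.injEq] at hc
            subst hc
            have := hd'.length
            exact ⟨fun h => by omega, fun _ => hd'⟩
          · have := hnext hp d hd
            exact ⟨fun _ => this, fun h => by have := this.length; omega⟩
          · have h1 := hnext hp d hd
            have h2 := (h c (List.mem_of_mem_getLast? hc)).length
            exact ⟨fun _ => h1, fun h => by have := h1.length; omega⟩
      · intro q hq hrep c hc
        simp only [List.head?_cons, Option.mem_def, Option.some.injEq] at hq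
        subst hq
        rcases f4 with ⟨_, d', hd', rfl⟩ | ⟨hp, _⟩ | ⟨hp, _⟩
        · simp only [List.cons_append, List.head?_cons, Option.mem_def, Option.some.injEq] at hc
          rw [← hc]; exact hd'
        · exact (hp hrep).elim
        · exact (hp hrep).elim
  obtain ⟨cs, e1, e2, e3, -⟩ := key _ hv hc
  rw [hw] at e1
  refine ⟨cs, e1, fun C => ?_, e3⟩
  rw [← e2 C, compress]
  congr 1

lemma length_chunkOut_le_two (C : Gam S n × Gam S n → Comp n) {c : List (Gam S n)}
    (hc : c.length = 1 ∨ RepChunk c ∨ ShortChunk c) :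
    (chunkOut C c).length ≤ 2 ∧ (c.length ≠ 1 → 3 * (chunkOut C c).length ≤ 2 * c.length) ∧
      (RepChunk c → 3 * (chunkOut C c).length + 1 ≤ 2 * c.length) ∧
      (chunkOut C c).length ≤ c.length := by
  have hrep : RepChunk c → (chunkOut C c).length = 1 ∧ 2 ≤ c.length := by
    rintro ⟨a, r, hr, rfl⟩
    rw [chunkOut_replicate C a hr]
    simpa using hr
  rcases hc with hc | hc | ⟨a, b, hab, rfl | ⟨d, rfl⟩⟩
  · obtain ⟨a, rfl⟩ := List.length_eq_one_iff.1 hc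
    refine ⟨by simp [chunkOut], by simp, fun h => ?_, by simp [chunkOut]⟩
    have := h.length
    simp at this
  · have := hrep hc
    refine ⟨?_, fun _ => ?_, fun _ => ?_, ?_⟩ <;> omega
  · have e : (chunkOut C [a, b]).length = 1 := by simp [chunkOut, hab]
    rw [e]
    simp
  · have e : (chunkOut C [a, b, d]).length = 2 := by simp [chunkOut, hab]
    rw [e]
    refine ⟨le_rfl, by simp, fun h => ?_, by simp⟩
    have := hrep h
    omega

/-- Compression shortens a string by a factor of `2 / 3`, up to an additive constant. A single symbol, which is
not shortened at all, is paid for by the repetition behind it; there is none behind the last part. -/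
lemma GoodChunks.length_flatMap_le {cs : List (List (Gam S n))} (h : GoodChunks cs)
    (C : Gam S n × Gam S n → Comp n) :
    3 * (cs.flatMap (chunkOut C)).length ≤ 2 * cs.flatten.length + 1 ∧
      ((∀ c ∈ cs.head?, c.length ≠ 1) →
        3 * (cs.flatMap (chunkOut C)).length ≤ 2 * cs.flatten.length) := by
  induction cs with
  | nil => simp
  | cons c cs ih =>
    obtain ⟨h1, h2⟩ := h
    rw [List.isChain_cons] at h2
    have ih := ih ⟨fun d hd => h1 d (List.mem_cons_of_mem _ hd), h2.2⟩
    obtain ⟨k1, k2, k3, k4⟩ := length_chunkOut_le_two C (h1 c (List.mem_cons_self ..))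
    simp only [List.flatMap_cons, List.flatten_cons, List.length_append, List.head?_cons,
      Option.mem_def, Option.some.injEq, forall_eq']
    by_cases hr : RepChunk c
    · have := k3 hr
      exact ⟨by omega, fun _ => by omega⟩
    · have hd : ∀ d ∈ cs.head?, d.length ≠ 1 := fun d hd hl => hr ((h2.1 d hd).2 hl)
      have := ih.2 hd
      by_cases hl : c.length = 1
      · refine ⟨?_, fun hc => (hc hl).elim⟩
        omega
      · have := k2 hl
        exact ⟨by omega, fun _ => by omega⟩

lemma length_compress_le {R : ℕ} {F : List (Gam S n) → List ℕ} (hF : IsLocalColoring R F)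
    (C : Gam S n × Gam S n → Comp n) (B : List (Gam S n)) : (compress F C B).length ≤ B.length := by
  obtain ⟨cs, e1, e2, e3⟩ := exists_chunks hF B
  have hB : cs.flatten = B := by
    have := flatten_chop (B.zip (flags F B))
    rw [e1, List.map_fst_zip (by rw [length_flags hF])] at this
    simpa using this
  rw [e2]
  conv_rhs => rw [← hB]
  have : ∀ c ∈ cs, (chunkOut C c).length ≤ c.length := fun c hc =>
    (length_chunkOut_le_two C (e3.1 c hc)).2.2.2
  clear e1 e2 e3 hB
  induction cs with
  | nil => simp
  | cons c cs ih =>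
    have h1 := this c (List.mem_cons_self ..)
    have h2 := ih fun d hd => this d (List.mem_cons_of_mem _ hd)
    simp only [List.flatMap_cons, List.flatten_cons, List.length_append]
    omega

end Compress

/-! ### Strings of symbols with expansions -/

section Annotated

variable {S : Type*} {n : ℕ} {T : Type*}

/-- A symbol of the working alphabet, together with the word over `T` that it stands for. -/
abbrev Ann (S : Type*) (n : ℕ) (T : Type*) : Type _ := Gam S n × List T

/-- The word that a string of annotated symbols stands for. -/
def flat (B : List (Ann S n T)) : List T := B.flatMap Prod.snd

/-- The symbols of a string of annotated symbols. -/
abbrev syms (B : List (Ann S n T)) : List (Gam S n) := B.map Prod.fst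

@[simp] lemma flat_nil : flat ([] : List (Ann S n T)) = [] := rfl

@[simp] lemma flat_append (A B : List (Ann S n T)) : flat (A ++ B) = flat A ++ flat B :=
  List.flatMap_append ..

@[simp] lemma flat_cons (a : Ann S n T) (B : List (Ann S n T)) : flat (a :: B) = a.2 ++ flat B := rfl

lemma flat_flatten (Bs : List (List (Ann S n T))) : flat Bs.flatten = (Bs.map flat).flatten := by
  induction Bs with
  | nil => rfl
  | cons B Bs ih => simp [ih]

/-- Cutting a string that consists of three parts: the outer blocks come from the outer parts, and all but
two of the blocks `K` between them lie inside of the middle part. -/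
lemma chop_three {β : Type*} {X Y W : List (β × Bool)} {l h : List β} {As Cs : List (List β)}
    (hX : chop X = As ++ [l]) (hW : chop W = h :: Cs) :
    ∃ K, chop (X ++ (Y ++ W)) = As ++ (K ++ Cs) ∧ K.flatten = l ++ (Y.map Prod.fst ++ h) ∧
      ((∃ c, K = [c]) ∨ ∃ c Mid d, K = c :: (Mid ++ [d]) ∧ Mid.flatten.length ≤ Y.length) := by
  obtain ⟨y, Ys, hY⟩ := chop_exists_cons Y
  have hf := flatten_chop Y
  rcases List.eq_nil_or_concat Ys with rfl | ⟨Mid, t, rfl⟩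
  · refine ⟨[l ++ (y ++ h)], ?_, ?_, Or.inl ⟨_, rfl⟩⟩
    · have := chop_append (As := []) hY hW
      rw [chop_append hX this]
      simp
    · rw [hY] at hf
      rw [← hf]
      simp
  · rw [List.concat_eq_append] at hY
    have h1 := chop_append (As := y :: Mid) hY hW
    refine ⟨(l ++ y) :: (Mid ++ [t ++ h]), ?_, ?_, Or.inr ⟨_, Mid, _, rfl, ?_⟩⟩
    · rw [List.cons_append] at h1
      rw [chop_append hX h1]
      simp
    · rw [hY] at hf
      rw [← hf]
      simp
    · have := congrArg List.length hf
      rw [hY] at this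
      simp only [List.flatten_cons, List.flatten_append, List.flatten_nil, List.append_nil,
        List.length_append, List.length_map] at this
      omega

variable [DecidableEq S]

/-- The annotated symbols that replace a part of an annotated string. -/
noncomputable def annOut (C : Gam S n × Gam S n → Comp n) : List (Ann S n T) → List (Ann S n T)
  | [] => []
  | [a] => [a]
  | a :: b :: w =>
      if a.1 = b.1 then [(repeatSymbol a.1 (w.length + 2), flat (a :: b :: w))]
      else (compSym (C (a.1, b.1)), a.2 ++ b.2) :: w

lemma syms_annOut (C : Gam S n × Gam S n → Comp n) (c : List (Ann S n T)) :
    syms (annOut C c) = chunkOut C (syms c) := by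
  match c with
  | [] => rfl
  | [a] => rfl
  | a :: b :: w =>
    simp only [annOut, syms, List.map_cons, chunkOut]
    split_ifs <;> simp

lemma flat_annOut (C : Gam S n × Gam S n → Comp n) (c : List (Ann S n T)) :
    flat (annOut C c) = flat c := by
  match c with
  | [] => rfl
  | [a] => rfl
  | a :: b :: w =>
    simp only [annOut]
    split_ifs <;> simp

lemma flat_flatMap_annOut (C : Gam S n × Gam S n → Comp n) (cs : List (List (Ann S n T))) :
    flat (cs.flatMap (annOut C)) = flat cs.flatten := by
  induction cs with
  | nil => rfl
  | cons c cs ih => simp [ih, flat_annOut]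

lemma syms_flatMap_annOut (C : Gam S n × Gam S n → Comp n) (cs : List (List (Ann S n T))) :
    syms (cs.flatMap (annOut C)) = (cs.map syms).flatMap (chunkOut C) := by
  induction cs with
  | nil => rfl
  | cons c cs ih =>
    simp only [syms, List.flatMap_cons, List.map_append, List.map_cons] at ih ⊢
    rw [ih]
    congr 1
    exact syms_annOut C c

/-- `Compress` on annotated strings: the new symbols are annotated with what they stand for. -/
noncomputable def annCompress (F : List (Gam S n) → List ℕ) (C : Gam S n × Gam S n → Comp n)
    (B : List (Ann S n T)) : List (Ann S n T) :=
  (chop (B.zip (flags F (syms B)))).flatMap (annOut C)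

lemma exists_annChunks {R : ℕ} {F : List (Gam S n) → List ℕ} (hF : IsLocalColoring R F)
    (B : List (Ann S n T)) :
    ∃ cs, chop (B.zip (flags F (syms B))) = [] :: cs ∧ GoodChunks (cs.map syms) ∧
      ∀ C, compress F C (syms B) = (cs.map syms).flatMap (chunkOut C) := by
  obtain ⟨cs, e1, e2, e3⟩ := exists_chunks hF (syms B)
  have h := chop_map Prod.fst (B.zip (flags F (syms B)))
  rw [← List.zip_map_left, e1] at h
  obtain ⟨d, ds, e⟩ := chop_exists_cons (B.zip (flags F (syms B)))
  rw [e, List.map_cons] at h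
  obtain ⟨h1, h2⟩ := List.cons.inj h
  have hd : d = [] := List.map_eq_nil_iff.1 h1.symm
  subst hd
  refine ⟨ds, e, ?_, ?_⟩
  · rw [h2] at e3; exact e3
  · rw [h2] at e2; exact e2

lemma syms_annCompress {R : ℕ} {F : List (Gam S n) → List ℕ} (hF : IsLocalColoring R F)
    (C : Gam S n × Gam S n → Comp n) (B : List (Ann S n T)) :
    syms (annCompress F C B) = compress F C (syms B) := by
  obtain ⟨cs, e1, e2, e3⟩ := exists_annChunks hF B
  rw [annCompress, e1, e3 C, List.flatMap_cons]
  exact syms_flatMap_annOut C cs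

lemma flatten_annChunks {R : ℕ} {F : List (Gam S n) → List ℕ} (hF : IsLocalColoring R F)
    (B : List (Ann S n T)) : (chop (B.zip (flags F (syms B)))).flatten = B := by
  rw [flatten_chop, List.map_fst_zip]
  rw [length_flags hF, List.length_map]

lemma flat_annCompress {R : ℕ} {F : List (Gam S n) → List ℕ} (hF : IsLocalColoring R F)
    (C : Gam S n × Gam S n → Comp n) (B : List (Ann S n T)) : flat (annCompress F C B) = flat B := by
  rw [annCompress, flat_flatMap_annOut, flatten_annChunks hF]

/-- When the string `X Y W` is compressed, then all but a middle part of the result, of length about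
`2 / 3` times that of `Y`, depends only on the marks of `X` or of `W`. -/
lemma annCompress_three {R : ℕ} {F : List (Gam S n) → List ℕ} (hF : IsLocalColoring R F)
    (C : Gam S n × Gam S n → Comp n) {X Y W : List (Ann S n T)} {l h : List (Ann S n T)}
    {As Cs : List (List (Ann S n T))}
    (hX : chop (X.zip ((flags F (syms (X ++ (Y ++ W)))).take X.length)) = As ++ [l])
    (hW : chop (W.zip ((flags F (syms (X ++ (Y ++ W)))).drop (X ++ Y).length)) = h :: Cs) :
    ∃ M, annCompress F C (X ++ (Y ++ W)) =
        As.flatMap (annOut C) ++ (M ++ Cs.flatMap (annOut C)) ∧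
      flat M = flat l ++ (flat Y ++ flat h) ∧ 3 * M.length ≤ 2 * Y.length + 13 := by
  obtain ⟨cs, e1, e2, -⟩ := exists_annChunks hF (X ++ (Y ++ W))
  have hlen := length_flags hF (syms (X ++ (Y ++ W)))
  rw [annCompress]
  generalize flags F (syms (X ++ (Y ++ W))) = fl at *
  simp only [List.length_map, List.length_append] at hlen hW
  have hsplit : (X ++ (Y ++ W)).zip fl = X.zip (fl.take X.length) ++
      (Y.zip ((fl.drop X.length).take Y.length) ++ W.zip (fl.drop (X.length + Y.length))) := by
    conv_lhs => rw [← List.take_append_drop X.length fl,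
      ← List.take_append_drop Y.length (fl.drop X.length), List.drop_drop]
    rw [List.zip_append (by simp; omega), List.zip_append (by simp; omega)]
  obtain ⟨K, k1, k2, k3⟩ := chop_three (Y := Y.zip ((fl.drop X.length).take Y.length)) hX hW
  rw [← hsplit] at k1
  rw [List.map_fst_zip (by simp; omega)] at k2
  rw [k1]
  refine ⟨K.flatMap (annOut C), by simp [List.flatMap_append], ?_, ?_⟩
  · rw [flat_flatMap_annOut, k2]
    simp
  rw [e1] at k1
  have hout : ∀ c, c = [] ∨ c ∈ cs → (annOut C c).length ≤ 2 := by
    rintro c (rfl | hc)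
    · simp [annOut]
    · have := (length_chunkOut_le_two C (e2.1 (syms c) (List.mem_map_of_mem hc))).1
      rwa [← syms_annOut, List.length_map] at this
  have hmem : ∀ c ∈ K, c = [] ∨ c ∈ cs := by
    intro c hc
    have : c ∈ [] :: cs := by rw [k1]; simp [hc]
    simpa using this
  rcases k3 with ⟨c, rfl⟩ | ⟨c, Mid, d, rfl, hMid⟩
  · have := hout c (hmem c (by simp))
    simp only [List.flatMap_cons, List.flatMap_nil, List.append_nil]
    omega
  · have h1 := hout c (hmem c (by simp))
    have h2 := hout d (hmem d (by simp))
    have hinf : Mid <:+: cs := by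
      cases As with
      | nil =>
        obtain ⟨-, h0⟩ := List.cons.inj k1
        exact ⟨[], [d] ++ Cs, by rw [h0]; simp⟩
      | cons a As =>
        obtain ⟨-, h0⟩ := List.cons.inj k1
        exact ⟨As ++ [c], [d] ++ Cs, by rw [h0]; simp⟩
    have hgood : GoodChunks (Mid.map syms) :=
      ⟨fun e he => e2.1 e ((hinf.map syms).subset he), e2.2.infix (hinf.map syms)⟩
    have h3 := (hgood.length_flatMap_le C).1
    rw [← syms_flatMap_annOut, List.length_map] at h3
    have h4 : (Mid.map syms).flatten.length = Mid.flatten.length := by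
      simp [List.length_flatten, Function.comp_def]
    have h5 : (Y.zip ((fl.drop X.length).take Y.length)).length ≤ Y.length := by simp
    simp only [List.flatMap_cons, List.flatMap_append, List.flatMap_nil, List.append_nil,
      List.length_append]
    omega

/-- If a string is changed between a prefix `P` and a suffix `Q`, then the compressed string changes
only between a prefix and a suffix that stand for almost all of `P` and `Q`. -/
lemma annCompress_between {R : ℕ} {F : List (Gam S n) → List ℕ} (hF : IsLocalColoring R F)
    (C : Gam S n × Gam S n → Comp n) (P Q : List (Ann S n T)) :
    ∃ (P₁ Q₁ : List (Ann S n T)) (a b : List T), flat P₁ ++ a = flat P ∧ b ++ flat Q₁ = flat Q ∧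
      ∀ M, ∃ M₁, annCompress F C (P ++ (M ++ Q)) = P₁ ++ (M₁ ++ Q₁) ∧
        flat M₁ = a ++ (flat M ++ b) ∧ 3 * M₁.length ≤ 2 * M.length + 4 * R + 21 := by
  set Pa := P.take (P.length - (R + 2)) with hPa
  set Pb := P.drop (P.length - (R + 2)) with hPb
  set Qa := Q.take (R + 2) with hQa
  set Qb := Q.drop (R + 2) with hQb
  have hP : Pa ++ Pb = P := List.take_append_drop ..
  have hQ : Qa ++ Qb = Q := List.take_append_drop ..
  have hPc : syms Pa = [] ∨ R + 2 ≤ (syms Pb).length := by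
    rcases le_total P.length (R + 2) with h | h
    · left; simp [hPa, Nat.sub_eq_zero_of_le h]
    · right; simp [hPb]; omega
  have hQc : syms Qb = [] ∨ R + 2 ≤ (syms Qa).length := by
    rcases le_total Q.length (R + 2) with h | h
    · left; simp [hQb, h]
    · right; simp [hQa, h]
  have hlPb : Pb.length ≤ R + 2 := by simp [hPb]; omega
  have hlQa : Qa.length ≤ R + 2 := by simp [hQa]
  obtain ⟨As, l, hX⟩ := chop_exists_concat
    (Pa.zip ((flags F (syms Pa ++ (syms Pb ++ []))).take (syms Pa).length))
  obtain ⟨h, Cs, hW⟩ := chop_exists_cons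
    (Qb.zip ((flags F ([] ++ (syms Qa ++ syms Qb))).drop ([] ++ syms Qa).length))
  have fP : flat Pa = flat (As.flatMap (annOut C)) ++ flat l := by
    have := flatten_chop (Pa.zip ((flags F (syms Pa ++ (syms Pb ++ []))).take (syms Pa).length))
    rw [hX, List.map_fst_zip (by simp [length_flags hF])] at this
    rw [flat_flatMap_annOut, ← this]
    simp
  have fQ : flat Qb = flat h ++ flat (Cs.flatMap (annOut C)) := by
    have := flatten_chop
      (Qb.zip ((flags F ([] ++ (syms Qa ++ syms Qb))).drop ([] ++ syms Qa).length))
    rw [hW, List.map_fst_zip (by simp [length_flags hF])] at this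
    rw [flat_flatMap_annOut, ← this]
    simp
  refine ⟨As.flatMap (annOut C), Cs.flatMap (annOut C), flat l ++ flat Pb, flat Qa ++ flat h, ?_, ?_,
    fun M => ?_⟩
  · rw [← hP, flat_append, fP]
    simp
  · rw [← hQ, flat_append, fQ]
    simp
  · have hB : P ++ (M ++ Q) = Pa ++ ((Pb ++ (M ++ Qa)) ++ Qb) := by
      rw [← hP, ← hQ]; simp
    rw [take_flags_append hF [] (syms M ++ (syms Qa ++ syms Qb)) hPc] at hX
    rw [drop_flags_append hF [] (syms Pa ++ (syms Pb ++ syms M)) hQc] at hW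
    obtain ⟨M₁, m1, m2, m3⟩ := annCompress_three hF C (X := Pa) (Y := Pb ++ (M ++ Qa)) (W := Qb)
      (As := As) (l := l) (h := h) (Cs := Cs)
      (by rw [← hX]; simp [syms]) (by rw [← hW]; simp [syms])
    refine ⟨M₁, by rw [hB, m1], by rw [m2]; simp, ?_⟩
    simp only [List.length_append] at m3
    omega

/-- If a string is changed in front of a suffix `Q`, then the compressed string changes only in front of
a suffix that stands for almost all of `Q`. -/
lemma annCompress_before {R : ℕ} {F : List (Gam S n) → List ℕ} (hF : IsLocalColoring R F)
    (C : Gam S n × Gam S n → Comp n) (Q : List (Ann S n T)) :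
    ∃ (Q₁ : List (Ann S n T)) (b : List T), b ++ flat Q₁ = flat Q ∧ (Q = [] → Q₁ = []) ∧
      ∀ J N, ∃ (J₁ N₁ : List (Ann S n T)) (a : List T),
        annCompress F C (J ++ (N ++ Q)) = J₁ ++ (N₁ ++ Q₁) ∧
        flat J₁ ++ a = flat J ∧ flat N₁ = a ++ (flat N ++ b) ∧ (J = [] → J₁ = []) ∧
        3 * N₁.length ≤ 2 * (N.length + min (R + 2) Q.length) + 13 := by
  set Qa := Q.take (R + 2) with hQa
  set Qb := Q.drop (R + 2) with hQb
  have hQ : Qa ++ Qb = Q := List.take_append_drop ..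
  have hQc : syms Qb = [] ∨ R + 2 ≤ (syms Qa).length := by
    rcases le_total Q.length (R + 2) with h | h
    · left; simp [hQb, h]
    · right; simp [hQa, h]
  have hlQa : Qa.length = min (R + 2) Q.length := by simp [hQa]
  obtain ⟨h, Cs, hW⟩ := chop_exists_cons
    (Qb.zip ((flags F ([] ++ (syms Qa ++ syms Qb))).drop ([] ++ syms Qa).length))
  have fQ : flat Qb = flat h ++ flat (Cs.flatMap (annOut C)) := by
    have := flatten_chop
      (Qb.zip ((flags F ([] ++ (syms Qa ++ syms Qb))).drop ([] ++ syms Qa).length))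
    rw [hW, List.map_fst_zip (by simp [length_flags hF])] at this
    rw [flat_flatMap_annOut, ← this]
    simp
  refine ⟨Cs.flatMap (annOut C), flat Qa ++ flat h, ?_, ?_, fun J N => ?_⟩
  · rw [← hQ, flat_append, fQ]
    simp
  · rintro rfl
    have : Qb = [] := by simp [hQb]
    rw [this] at hW
    obtain ⟨-, e⟩ := List.cons.inj hW
    simp [← e]
  · have hB : J ++ (N ++ Q) = J ++ ((N ++ Qa) ++ Qb) := by
      rw [← hQ]; simp
    obtain ⟨As, l, hX⟩ := chop_exists_concat
      (J.zip ((flags F (syms (J ++ ((N ++ Qa) ++ Qb)))).take J.length))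
    rw [drop_flags_append hF [] (syms J ++ syms N) hQc] at hW
    obtain ⟨M₁, m1, m2, m3⟩ := annCompress_three hF C (X := J) (Y := N ++ Qa) (W := Qb)
      (h := h) (Cs := Cs) hX (by rw [← hW]; simp [syms])
    refine ⟨As.flatMap (annOut C), M₁, flat l, by rw [hB, m1], ?_, by rw [m2]; simp, ?_, ?_⟩
    · have := flatten_chop (J.zip ((flags F (syms (J ++ ((N ++ Qa) ++ Qb)))).take J.length))
      rw [hX, List.map_fst_zip (by simp [length_flags hF])] at this
      rw [flat_flatMap_annOut]
      conv_rhs => rw [← this]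
      simp
    · rintro rfl
      obtain ⟨e, -⟩ := List.append_inj' (s₁ := []) (t₁ := [[]]) hX rfl
      simp [← e]
    · simp only [List.length_append] at m3
      omega

end Annotated

/-! ### Adaptive choices -/

section Adaptive

variable {S : Type*} {n : ℕ} {T : Type*}

/-- The functions that are used on one level: a compression function and a splitting function. -/
abbrev LevelHash (S : Type*) (n : ℕ) : Type _ :=
  (Gam S n × Gam S n → Comp n) × (Gam S n × Gam S n → ℕ)

/-- `Adaptive c m Φ`: the property `Φ` of the functions on `m` levels can be enforced as follows. On
each level, when its compression function and all functions on the levels below are known, one may name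
`c` pairs on which the splitting function of that level must not vanish. -/
def Adaptive (c : ℕ) : ℕ → (List (LevelHash S n) → Prop) → Prop
  | 0, Φ => Φ []
  | m + 1, Φ => ∀ C, ∃ bad : List (Gam S n × Gam S n), bad.length ≤ c ∧
      ∀ H, (∀ p ∈ bad, H p ≠ 0) → Adaptive c m fun l => Φ ((C, H) :: l)

/-- As `Adaptive`, with an additional splitting function that comes before all others. -/
def AdaptiveFrom (c m : ℕ) (Φ : (Gam S n × Gam S n → ℕ) → List (LevelHash S n) → Prop) : Prop :=
  ∃ bad : List (Gam S n × Gam S n), bad.length ≤ c ∧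
    ∀ H, (∀ p ∈ bad, H p ≠ 0) → Adaptive c m (Φ H)

lemma Adaptive.mono {c c' m : ℕ} (hc : c ≤ c') {Φ Ψ : List (LevelHash S n) → Prop}
    (h : Adaptive c m Φ) (hΦ : ∀ l, Φ l → Ψ l) : Adaptive c' m Ψ := by
  induction m generalizing Φ Ψ with
  | zero => exact hΦ _ h
  | succ m ih =>
    intro C
    obtain ⟨bad, hb, h⟩ := h C
    exact ⟨bad, hb.trans hc, fun H hH => ih (h H hH) fun l hl => hΦ _ hl⟩

lemma Adaptive.of_forall {c m : ℕ} {Φ : List (LevelHash S n) → Prop} (h : ∀ l, Φ l) :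
    Adaptive c m Φ := by
  induction m generalizing Φ with
  | zero => exact h _
  | succ m ih => exact fun C => ⟨[], by simp, fun H _ => ih fun l => h _⟩

lemma Adaptive.and {c c' m : ℕ} {Φ Ψ : List (LevelHash S n) → Prop}
    (h : Adaptive c m Φ) (h' : Adaptive c' m Ψ) : Adaptive (c + c') m fun l => Φ l ∧ Ψ l := by
  induction m generalizing Φ Ψ with
  | zero => exact ⟨h, h'⟩
  | succ m ih =>
    intro C
    obtain ⟨bad, hb, h⟩ := h C
    obtain ⟨bad', hb', h'⟩ := h' C
    refine ⟨bad ++ bad', by simp; omega, fun H hH => ih (h H ?_) (h' H ?_)⟩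
    · exact fun p hp => hH p (by simp [hp])
    · exact fun p hp => hH p (by simp [hp])

lemma AdaptiveFrom.mono {c c' m : ℕ} (hc : c ≤ c')
    {Φ Ψ : (Gam S n × Gam S n → ℕ) → List (LevelHash S n) → Prop}
    (h : AdaptiveFrom c m Φ) (hΦ : ∀ H l, Φ H l → Ψ H l) : AdaptiveFrom c' m Ψ := by
  obtain ⟨bad, hb, h⟩ := h
  exact ⟨bad, hb.trans hc, fun H hH => (h H hH).mono hc (hΦ H)⟩

lemma AdaptiveFrom.and {c c' m : ℕ}
    {Φ Ψ : (Gam S n × Gam S n → ℕ) → List (LevelHash S n) → Prop}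
    (h : AdaptiveFrom c m Φ) (h' : AdaptiveFrom c' m Ψ) :
    AdaptiveFrom (c + c') m fun H l => Φ H l ∧ Ψ H l := by
  obtain ⟨bad, hb, h⟩ := h
  obtain ⟨bad', hb', h'⟩ := h'
  refine ⟨bad ++ bad', by simp; omega, fun H hH => (h H ?_).and (h' H ?_)⟩
  · exact fun p hp => hH p (by simp [hp])
  · exact fun p hp => hH p (by simp [hp])

/-! ### The blocks of the decomposition -/

/-- `Split` on annotated strings. -/
def annSplit (H : Gam S n × Gam S n → ℕ) (B : List (Ann S n T)) : List (List (Ann S n T)) :=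
  split (fun p => H (Prod.map Prod.fst Prod.fst p)) B

lemma annSplit_between (H : Gam S n × Gam S n → ℕ) {P M Q l h : List (Ann S n T)}
    {As Cs : List (List (Ann S n T))}
    (hM : ∀ p ∈ adjPairs (syms (P.getLast?.toList ++ (M ++ Q.take 2))), H p ≠ 0)
    (hP : annSplit H P = As ++ [l]) (hQ : annSplit H Q = h :: Cs) :
    annSplit H (P ++ (M ++ Q)) = As ++ (l ++ (M ++ h)) :: Cs := by
  refine split_between _ (fun p hp => hM _ ?_) hP hQ
  rw [syms, adjPairs_map]
  exact List.mem_map_of_mem hp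

lemma annSplit_exists_cons (H : Gam S n × Gam S n → ℕ) (B : List (Ann S n T)) :
    ∃ h Cs, annSplit H B = h :: Cs := split_exists_cons _ B

lemma annSplit_exists_concat (H : Gam S n × Gam S n → ℕ) (B : List (Ann S n T)) :
    ∃ As l, annSplit H B = As ++ [l] := split_exists_concat _ B

lemma flatten_annSplit (H : Gam S n × Gam S n → ℕ) (B : List (Ann S n T)) :
    (annSplit H B).flatten = B := flatten_split _ B

/-- If no cut is made inside of `N` or at its right end, then the blocks behind the one that contains `N`
do not depend on what stands in front of them. -/
lemma annSplit_before (H : Gam S n × Gam S n → ℕ) (J : List (Ann S n T)) {N Q h : List (Ann S n T)}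
    {Cs : List (List (Ann S n T))} (hN : ∀ p ∈ adjPairs (syms (N ++ Q.take 2)), H p ≠ 0)
    (hQ : annSplit H Q = h :: Cs) :
    ∃ As J', As.flatten ++ J' = J ∧ (J = [] → As = []) ∧
      annSplit H (J ++ (N ++ Q)) = As ++ (J' ++ (N ++ h)) :: Cs := by
  have h1 : annSplit H ([] ++ (N ++ Q)) = [] ++ ([] ++ (N ++ h)) :: Cs :=
    annSplit_between H (P := []) (by simpa using hN) (by simp [annSplit, split]) hQ
  simp only [List.nil_append] at h1
  exact split_append_left _ J h1

/-- The blocks of a decomposition are aligned with the border between two parts `u` and `z` of the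
string: the last letter of `u` is in the block `E` (or `E` is the first block), and `w` is the part of
`E` that belongs to `u`. -/
structure Bordered (Bs : List (List (Ann S n T))) (u : List T) (As : List (List (Ann S n T)))
    (w : List T) (E : List (Ann S n T)) (z : List T) (Cs : List (List (Ann S n T))) : Prop where
  eq : Bs = As ++ E :: Cs
  block : flat E = w ++ z
  left : flat As.flatten ++ w = u
  first : w = [] → As = []

lemma Bordered.append {Bs As : List (List (Ann S n T))} {u w z : List T} {E : List (Ann S n T)}
    {Cs : List (List (Ann S n T))} (h : Bordered Bs u As w E z Cs) (Bs₁ Bs₂ : List (List (Ann S n T)))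
    (h₁ : u = [] → Bs₁ = []) :
    Bordered (Bs₁ ++ (Bs ++ Bs₂)) (flat Bs₁.flatten ++ u) (Bs₁ ++ As) w E z (Cs ++ Bs₂) where
  eq := by simp [h.eq]
  block := h.block
  left := by simp [← h.left]
  first := fun hw => by
    have hA := h.first hw
    have hu : u = [] := by rw [← h.left, hA, hw]; rfl
    rw [hA, h₁ hu]
    rfl

variable [DecidableEq S]

/-- The blocks that `Process` turns into grammars, on annotated strings. -/
noncomputable def annProcess (F : List (Gam S n) → List ℕ) :
    List (LevelHash S n) → List (Ann S n T) → List (List (Ann S n T))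
  | [], B => [B]
  | (C, H) :: rest, B =>
      if B.length ≤ 2 then [B] else (annSplit H (annCompress F C B)).flatMap (annProcess F rest)

lemma annProcess_of_length_le (F : List (Gam S n) → List ℕ) (l : List (LevelHash S n))
    {B : List (Ann S n T)} (hB : B.length ≤ 2) : annProcess F l B = [B] := by
  match l with
  | [] => rfl
  | (C, H) :: l => rw [annProcess, if_pos hB]

lemma flat_annProcess {R : ℕ} {F : List (Gam S n) → List ℕ} (hF : IsLocalColoring R F)
    (l : List (LevelHash S n)) (B : List (Ann S n T)) :
    flat (annProcess F l B).flatten = flat B := by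
  induction l generalizing B with
  | nil => simp [annProcess]
  | cons q l ih =>
    obtain ⟨C, H⟩ := q
    rw [annProcess]
    split_ifs with h
    · simp
    · rw [← flat_annCompress hF C B]
      conv_rhs => rw [← flatten_annSplit H (annCompress F C B)]
      generalize annSplit H (annCompress F C B) = Bs
      induction Bs with
      | nil => rfl
      | cons B Bs ihB => simp [ih, ihB]

lemma flat_flatMap_annProcess {R : ℕ} {F : List (Gam S n) → List ℕ} (hF : IsLocalColoring R F)
    (l : List (LevelHash S n)) (Bs : List (List (Ann S n T))) :
    flat (Bs.flatMap (annProcess F l)).flatten = flat Bs.flatten := by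
  induction Bs with
  | nil => rfl
  | cons B Bs ih => simp [flat_annProcess hF, ih]

/-- A string `N` of bounded length at the end is never split, if the splitting functions do
not vanish on boundedly many pairs on each level. The bound `13` is the fixed point of the estimate
`3 N₁ ≤ 2 N + 13` for the compressed length. -/
lemma adaptive_oneSided {R : ℕ} {F : List (Gam S n) → List ℕ} (hF : IsLocalColoring R F) {c : ℕ}
    (hc : 13 ≤ c) (z : List T) (m : ℕ) : ∀ (J N : List (Ann S n T)) (a : List T), N.length ≤ c →
      flat N = a ++ z → (a = [] → J = []) →
      Adaptive c m fun l => ∃ As w E, Bordered (annProcess F l (J ++ N)) (flat J ++ a) As w E z [] := by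
  have unsplit : ∀ (J N : List (Ann S n T)) (a : List T), flat N = a ++ z → (a = [] → J = []) →
      ∀ l, annProcess F l (J ++ N) = [J ++ N] →
        ∃ As w E, Bordered (annProcess F l (J ++ N)) (flat J ++ a) As w E z [] := by
    intro J N a hN _ l hl
    exact ⟨[], flat J ++ a, J ++ N, by rw [hl]; rfl, by simp [hN], by simp, fun _ => rfl⟩
  induction m with
  | zero => exact fun J N a _ hN hJ => unsplit J N a hN hJ [] rfl
  | succ m ih =>
    intro J N a hl hN hJ
    by_cases hB : (J ++ N).length ≤ 2
    · exact Adaptive.of_forall fun l => unsplit J N a hN hJ l (annProcess_of_length_le F l hB)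
    intro C
    obtain ⟨Q₁, b, hb, hQ, hcomp⟩ := annCompress_before hF C ([] : List (Ann S n T))
    obtain ⟨J₁, N₁, a', e1, e2, e3, e4, e5⟩ := hcomp J N
    obtain rfl : b = [] := by simpa using (List.append_eq_nil_iff.1 hb).1
    rw [hQ rfl] at e1
    simp only [List.append_nil, List.length_nil, Nat.min_zero, add_zero] at e1 e3 e5
    refine ⟨adjPairs (syms N₁), by rw [length_adjPairs, List.length_map]; omega, fun H hH => ?_⟩
    obtain ⟨As₁, J', f1, f2, f3⟩ := annSplit_before H J₁ (N := N₁) (Q := []) (by simpa using hH)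
      (by simp [annSplit, split]; exact ⟨rfl, rfl⟩)
    simp only [List.append_nil] at f3
    refine (ih J' N₁ (a' ++ a) (by omega) (by rw [e3, hN]; simp) ?_).mono le_rfl ?_
    · intro h0
      have := hJ (List.append_eq_nil_iff.1 h0).2
      rw [e4 this] at f1
      exact (List.append_eq_nil_iff.1 f1).2
    · rintro l ⟨As, w, E, h⟩
      have h' := h.append (As₁.flatMap (annProcess F l)) [] ?_
      · have eB : annProcess F ((C, H) :: l) (J ++ N) = As₁.flatMap (annProcess F l) ++
            (annProcess F l (J' ++ N₁) ++ []) := by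
          rw [annProcess, if_neg hB, e1, f3]
          simp
        have eu : flat (As₁.flatMap (annProcess F l)).flatten ++ (flat J' ++ (a' ++ a)) =
            flat J ++ a := by
          rw [flat_flatMap_annProcess hF, ← e2, ← f1]
          simp
        rw [← eB, eu] at h'
        exact ⟨_, w, E, h'⟩
      · intro h0
        have ha : a = [] := (List.append_eq_nil_iff.1 (List.append_eq_nil_iff.1 h0).2).2
        rw [f2 (e4 (hJ ha))]
        rfl

/-- Two strings with a common suffix `Q`: the blocks that come after the one that contains the last
symbols in front of `Q` agree. The part `N` in front of `Q` keeps length at most `2 R + 17`, the fixed point of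
`3 N₁ ≤ 2 (N + R + 2) + 13`. -/
lemma adaptive_prefix {R : ℕ} {F : List (Gam S n) → List ℕ} (hF : IsLocalColoring R F) (m : ℕ) :
    ∀ (J N J' N' Q : List (Ann S n T)) (a a' b : List T), N.length ≤ 2 * R + 17 →
      N'.length ≤ 2 * R + 17 → flat N = a ++ b → flat N' = a' ++ b → (a = [] → J = []) →
      (a' = [] → J' = []) →
      Adaptive (4 * R + 36) m fun l => ∃ As w E As' w' E' z Cs,
        Bordered (annProcess F l (J ++ (N ++ Q))) (flat J ++ a) As w E z Cs ∧
        Bordered (annProcess F l (J' ++ (N' ++ Q))) (flat J' ++ a') As' w' E' z Cs := by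
  have unsplit : ∀ (J N Q : List (Ann S n T)) (a b : List T), flat N = a ++ b →
      ∀ l, annProcess F l (J ++ (N ++ Q)) = [J ++ (N ++ Q)] →
        Bordered (annProcess F l (J ++ (N ++ Q))) (flat J ++ a) [] (flat J ++ a) (J ++ (N ++ Q))
          (b ++ flat Q) [] := by
    intro J N Q a b hN l hl
    exact ⟨by rw [hl]; rfl, by simp [hN], by simp, fun _ => rfl⟩
  induction m with
  | zero =>
    intro J N J' N' Q a a' b _ _ hN hN' _ _
    exact ⟨_, _, _, _, _, _, _, _, unsplit J N Q a b hN [] rfl, unsplit J' N' Q a' b hN' [] rfl⟩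
  | succ m ih =>
    intro J N J' N' Q a a' b hl hl' hN hN' hJ hJ'
    -- Where only one of the two strings is short enough for a grammar, the other one is not much longer behind
    -- the border, so that it is enough to keep that part together.
    by_cases hB : (J ++ (N ++ Q)).length ≤ 2
    · have hQ : Q.length ≤ 2 := by simp at hB; omega
      refine (adaptive_oneSided hF (c := 2 * R + 19) (by omega) (b ++ flat Q) (m + 1) J' (N' ++ Q) a'
        (by simp; omega) (by simp [hN']) hJ').mono (by omega) ?_
      rintro l ⟨As', w', E', h⟩
      exact ⟨_, _, _, _, _, _, _, _, unsplit J N Q a b hN l (annProcess_of_length_le F l hB), h⟩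
    by_cases hB' : (J' ++ (N' ++ Q)).length ≤ 2
    · have hQ : Q.length ≤ 2 := by simp at hB'; omega
      refine (adaptive_oneSided hF (c := 2 * R + 19) (by omega) (b ++ flat Q) (m + 1) J (N ++ Q) a
        (by simp; omega) (by simp [hN]) hJ).mono (by omega) ?_
      rintro l ⟨As, w, E, h⟩
      exact ⟨_, _, _, _, _, _, _, _, h, unsplit J' N' Q a' b hN' l (annProcess_of_length_le F l hB')⟩
    intro C
    obtain ⟨Q₁, q, -, -, hcomp⟩ := annCompress_before hF C Q
    obtain ⟨J₁, N₁, p, e1, e2, e3, e4, e5⟩ := hcomp J N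
    obtain ⟨J₁', N₁', p', e1', e2', e3', e4', e5'⟩ := hcomp J' N'
    have hmin := min_le_left (R + 2) Q.length
    refine ⟨adjPairs (syms (N₁ ++ Q₁.take 2)) ++ adjPairs (syms (N₁' ++ Q₁.take 2)), ?_, fun H hH => ?_⟩
    · simp only [List.length_append, length_adjPairs, List.length_map, List.length_take]
      omega
    obtain ⟨h, Cs₁, hQ₁⟩ := annSplit_exists_cons H Q₁
    obtain ⟨As₁, Jr, f1, f2, f3⟩ := annSplit_before H J₁ (N := N₁) (Q := Q₁)
      (fun p hp => hH p (List.mem_append_left _ hp)) hQ₁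
    obtain ⟨As₁', Jr', f1', f2', f3'⟩ := annSplit_before H J₁' (N := N₁') (Q := Q₁)
      (fun p hp => hH p (List.mem_append_right _ hp)) hQ₁
    refine (ih Jr N₁ Jr' N₁' h (p ++ a) (p' ++ a') (b ++ q) (by omega) (by omega)
      (by rw [e3, hN]; simp) (by rw [e3', hN']; simp) ?_ ?_).mono le_rfl ?_
    · intro h0
      have := hJ (List.append_eq_nil_iff.1 h0).2
      rw [e4 this] at f1
      exact (List.append_eq_nil_iff.1 f1).2
    · intro h0
      have := hJ' (List.append_eq_nil_iff.1 h0).2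
      rw [e4' this] at f1'
      exact (List.append_eq_nil_iff.1 f1').2
    · rintro l ⟨As, w, E, As', w', E', z, Cs, g, g'⟩
      have k := g.append (As₁.flatMap (annProcess F l)) (Cs₁.flatMap (annProcess F l)) ?_
      have k' := g'.append (As₁'.flatMap (annProcess F l)) (Cs₁.flatMap (annProcess F l)) ?_
      · have eB : annProcess F ((C, H) :: l) (J ++ (N ++ Q)) = As₁.flatMap (annProcess F l) ++
            (annProcess F l (Jr ++ (N₁ ++ h)) ++ Cs₁.flatMap (annProcess F l)) := by
          rw [annProcess, if_neg hB, e1, f3]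
          simp
        have eB' : annProcess F ((C, H) :: l) (J' ++ (N' ++ Q)) = As₁'.flatMap (annProcess F l) ++
            (annProcess F l (Jr' ++ (N₁' ++ h)) ++ Cs₁.flatMap (annProcess F l)) := by
          rw [annProcess, if_neg hB', e1', f3']
          simp
        have eu : flat (As₁.flatMap (annProcess F l)).flatten ++ (flat Jr ++ (p ++ a)) =
            flat J ++ a := by
          rw [flat_flatMap_annProcess hF, ← e2, ← f1]
          simp
        have eu' : flat (As₁'.flatMap (annProcess F l)).flatten ++ (flat Jr' ++ (p' ++ a')) =
            flat J' ++ a' := by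
          rw [flat_flatMap_annProcess hF, ← e2', ← f1']
          simp
        rw [← eB, eu] at k
        rw [← eB', eu'] at k'
        exact ⟨_, w, E, _, w', E', z, _, k, k'⟩
      · intro h0
        have ha : a' = [] := (List.append_eq_nil_iff.1 (List.append_eq_nil_iff.1 h0).2).2
        rw [f2' (e4' (hJ' ha))]
        rfl
      · intro h0
        have ha : a = [] := (List.append_eq_nil_iff.1 (List.append_eq_nil_iff.1 h0).2).2
        rw [f2 (e4 (hJ ha))]
        rfl

/-- `BlockEdit Bs Bs' u x x'`: the sequences of blocks differ in one block only, in which `x` is replaced by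
`x'` behind the part `u` of the string. -/
def BlockEdit (Bs Bs' : List (List (Ann S n T))) (u x x' : List T) : Prop :=
  ∃ As E E' Cs a b, Bs = As ++ E :: Cs ∧ Bs' = As ++ E' :: Cs ∧ flat E = a ++ (x ++ b) ∧
    flat E' = a ++ (x' ++ b) ∧ flat As.flatten ++ a = u

/-- Two strings that differ only in a bounded part between a prefix and a suffix: their blocks
agree, except for those that contain that part. Its length stays at most `4 R + 21`, the fixed point of
`3 M₁ ≤ 2 M + 4 R + 21`. -/
lemma adaptive_edit {R : ℕ} {F : List (Gam S n) → List ℕ} (hF : IsLocalColoring R F)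
    (x x' : List T) (m : ℕ) :
    ∀ (P M M' Q : List (Ann S n T)) (a b : List T), M.length ≤ 4 * R + 21 →
      M'.length ≤ 4 * R + 21 → flat M = a ++ (x ++ b) → flat M' = a ++ (x' ++ b) →
      Adaptive (8 * R + 46) m fun l =>
        BlockEdit (annProcess F l (P ++ (M ++ Q))) (annProcess F l (P ++ (M' ++ Q))) (flat P ++ a)
          x x' := by
  have unsplit : ∀ (P M M' Q : List (Ann S n T)) (a b : List T), flat M = a ++ (x ++ b) →
      flat M' = a ++ (x' ++ b) → ∀ l E E', annProcess F l (P ++ (M ++ Q)) = [E] →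
        annProcess F l (P ++ (M' ++ Q)) = [E'] →
        BlockEdit (annProcess F l (P ++ (M ++ Q))) (annProcess F l (P ++ (M' ++ Q))) (flat P ++ a)
          x x' := by
    intro P M M' Q a b hM hM' l E E' hl hl'
    have e := flat_annProcess hF l (P ++ (M ++ Q))
    have e' := flat_annProcess hF l (P ++ (M' ++ Q))
    rw [hl] at e
    rw [hl'] at e'
    simp only [List.flatten_cons, List.flatten_nil, List.append_nil, flat_append] at e e'
    exact ⟨[], E, E', [], flat P ++ a, b ++ flat Q, by rw [hl]; rfl, by rw [hl']; rfl,
      by rw [e, hM]; simp, by rw [e', hM']; simp, by simp⟩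
  induction m with
  | zero => exact fun P M M' Q a b _ _ hM hM' => unsplit P M M' Q a b hM hM' [] _ _ rfl rfl
  | succ m ih =>
    intro P M M' Q a b hl hl' hM hM'
    have one : ∀ B : List (Ann S n T), B.length ≤ 4 * R + 23 → Adaptive (8 * R + 46) (m + 1) fun l =>
        ∃ E, annProcess F l B = [E] := by
      intro B hB
      refine (adaptive_oneSided hF (c := 4 * R + 23) (by omega) (flat B) (m + 1) [] B [] hB rfl
        fun _ => rfl).mono (by omega) ?_
      rintro l ⟨As, w, E, h⟩
      have hw : w = [] := (List.append_eq_nil_iff.1 h.left).2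
      have := h.eq
      rw [h.first hw] at this
      exact ⟨E, this⟩
    -- Where only one of the two strings is short enough for a grammar, the other one is kept in one block.
    by_cases hB : (P ++ (M ++ Q)).length ≤ 2
    · refine (one (P ++ (M' ++ Q)) (by simp at hB ⊢; omega)).mono le_rfl ?_
      rintro l ⟨E', h⟩
      exact unsplit P M M' Q a b hM hM' l _ E' (annProcess_of_length_le F l hB) h
    by_cases hB' : (P ++ (M' ++ Q)).length ≤ 2
    · refine (one (P ++ (M ++ Q)) (by simp at hB' ⊢; omega)).mono le_rfl ?_
      rintro l ⟨E, h⟩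
      exact unsplit P M M' Q a b hM hM' l E _ h (annProcess_of_length_le F l hB')
    intro C
    obtain ⟨P₁, Q₁, p, q, hp, hq, hcomp⟩ := annCompress_between hF C P Q
    obtain ⟨M₁, e1, e2, e3⟩ := hcomp M
    obtain ⟨M₁', e1', e2', e3'⟩ := hcomp M'
    refine ⟨adjPairs (syms (P₁.getLast?.toList ++ (M₁ ++ Q₁.take 2))) ++
      adjPairs (syms (P₁.getLast?.toList ++ (M₁' ++ Q₁.take 2))), ?_, fun H hH => ?_⟩
    · have : P₁.getLast?.toList.length ≤ 1 := Option.length_toList_le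
      simp only [List.length_append, length_adjPairs, List.length_map, List.length_take]
      omega
    obtain ⟨h, Cs₁, hQ₁⟩ := annSplit_exists_cons H Q₁
    obtain ⟨As₁, r, hP₁⟩ := annSplit_exists_concat H P₁
    have f := annSplit_between H (fun p hp => hH p (List.mem_append_left _ hp)) hP₁ hQ₁
    have f' := annSplit_between H (fun p hp => hH p (List.mem_append_right _ hp)) hP₁ hQ₁
    refine (ih r M₁ M₁' h (p ++ a) (b ++ q) (by omega) (by omega) (by rw [e2, hM]; simp)
      (by rw [e2', hM']; simp)).mono le_rfl ?_
    rintro l ⟨As, E, E', Cs, a₁, b₁, g1, g2, g3, g4, g5⟩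
    refine ⟨As₁.flatMap (annProcess F l) ++ As, E, E', Cs ++ Cs₁.flatMap (annProcess F l), a₁, b₁,
      ?_, ?_, g3, g4, ?_⟩
    · rw [annProcess, if_neg hB, e1, f]
      simp [g1]
    · rw [annProcess, if_neg hB', e1', f']
      simp [g2]
    · have hfl := flatten_annSplit H P₁
      rw [hP₁] at hfl
      rw [List.flatten_append, flat_append, flat_flatMap_annProcess hF, List.append_assoc, g5, ← hp,
        ← hfl]
      simp

end Adaptive

/-! ### The blocks of the whole decomposition -/

section TopLevel

variable {S : Type*} {n : ℕ}

/-- A word over `Σ` as a string of annotated symbols; each letter stands for itself. -/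
def annLetters (n : ℕ) (x : List S) : List (Ann S n S) := x.map fun a => (letter a, [a])

@[simp] lemma annLetters_append (x y : List S) :
    annLetters n (x ++ y) = annLetters n x ++ annLetters n y := List.map_append

@[simp] lemma length_annLetters (x : List S) : (annLetters n x).length = x.length := List.length_map _

@[simp] lemma flat_annLetters (x : List S) : flat (annLetters n x) = x := by
  induction x with
  | nil => rfl
  | cons a x ih =>
    simp only [annLetters] at ih
    simp [annLetters, ih]

@[simp] lemma syms_annLetters (x : List S) : syms (annLetters n x) = x.map letter := by
  simp [annLetters]

variable [DecidableEq S]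

/-- The blocks of the decomposition of `x` that are turned into grammars, on annotated strings. The
splitting function `H` is that of the input level. -/
noncomputable def annDecompose (F : List (Gam S n) → List ℕ) (H : Gam S n × Gam S n → ℕ)
    (l : List (LevelHash S n)) (x : List S) : List (List (Ann S n S)) :=
  (annSplit H (annLetters n x)).flatMap (annProcess F l)

lemma flat_annDecompose {R : ℕ} {F : List (Gam S n) → List ℕ} (hF : IsLocalColoring R F)
    (H : Gam S n × Gam S n → ℕ) (l : List (LevelHash S n)) (x : List S) :
    flat (annDecompose F H l x).flatten = x := by
  rw [annDecompose, flat_flatMap_annProcess hF, flatten_annSplit, flat_annLetters]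

lemma annDecompose_ne_nil (F : List (Gam S n) → List ℕ) (H : Gam S n × Gam S n → ℕ)
    (l : List (LevelHash S n)) (x : List S) : annDecompose F H l x ≠ [] := by
  have key : ∀ (l : List (LevelHash S n)) (B : List (Ann S n S)), annProcess F l B ≠ [] := by
    intro l
    induction l with
    | nil => simp [annProcess]
    | cons q l ih =>
      intro B
      obtain ⟨C, H⟩ := q
      obtain ⟨h, Cs, e⟩ := annSplit_exists_cons H (annCompress F C B)
      rw [annProcess, e]
      split_ifs
      · simp
      · simp [ih]
  obtain ⟨h, Cs, e⟩ := annSplit_exists_cons H (annLetters n x)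
  rw [annDecompose, e]
  simp [key]

lemma adaptive_annDecompose_single {R : ℕ} {F : List (Gam S n) → List ℕ} (hF : IsLocalColoring R F)
    (m : ℕ) {c : ℕ} (hc : 13 ≤ c) {x : List S} (hx : x.length ≤ c) :
    AdaptiveFrom c m fun H l => ∃ E, annDecompose F H l x = [E] := by
  refine ⟨adjPairs (syms (annLetters n x)), by simp [length_adjPairs]; omega, fun H hH => ?_⟩
  have hs : annSplit H (annLetters n x) = [annLetters n x] := by
    refine split_eq_singleton _ _ fun p hp => hH _ ?_
    rw [syms, adjPairs_map]
    exact List.mem_map_of_mem hp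
  refine (adaptive_oneSided hF hc x m [] (annLetters n x) [] (by simpa using hx) (by simp)
    fun _ => rfl).mono le_rfl ?_
  rintro l ⟨As, w, E, h⟩
  have hw : w = [] := (List.append_eq_nil_iff.1 h.left).2
  have := h.eq
  rw [h.first hw] at this
  exact ⟨E, by rw [annDecompose, hs]; simpa using this⟩

lemma adaptive_annDecompose_edit {R : ℕ} {F : List (Gam S n) → List ℕ} (hF : IsLocalColoring R F)
    (m : ℕ) (p q : List S) {x x' : List S} (hx : x.length ≤ 1) (hx' : x'.length ≤ 1) :
    AdaptiveFrom (8 * R + 46) m fun H l =>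
      BlockEdit (annDecompose F H l (p ++ (x ++ q))) (annDecompose F H l (p ++ (x' ++ q))) p x x' := by
  set P := annLetters n p
  set Q := annLetters n q
  set M := annLetters n x
  set M' := annLetters n x'
  have hM : M.length ≤ 1 := by simpa [M] using hx
  have hM' : M'.length ≤ 1 := by simpa [M'] using hx'
  refine ⟨adjPairs (syms (P.getLast?.toList ++ (M ++ Q.take 2))) ++
      adjPairs (syms (P.getLast?.toList ++ (M' ++ Q.take 2))), ?_, fun H hH => ?_⟩
  · have : P.getLast?.toList.length ≤ 1 := Option.length_toList_le
    simp only [List.length_append, length_adjPairs, List.length_map, List.length_take]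
    omega
  obtain ⟨h, Cs₁, hQ₁⟩ := annSplit_exists_cons H Q
  obtain ⟨As₁, r, hP₁⟩ := annSplit_exists_concat H P
  have f := annSplit_between H (fun p hp => hH p (List.mem_append_left _ hp)) hP₁ hQ₁
  have f' := annSplit_between H (fun p hp => hH p (List.mem_append_right _ hp)) hP₁ hQ₁
  refine (adaptive_edit hF x x' m r M M' h [] [] (by omega) (by omega) (by simp [M])
    (by simp [M'])).mono le_rfl ?_
  rintro l ⟨As, E, E', Cs, a₁, b₁, g1, g2, g3, g4, g5⟩
  refine ⟨As₁.flatMap (annProcess F l) ++ As, E, E', Cs ++ Cs₁.flatMap (annProcess F l), a₁, b₁,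
    ?_, ?_, g3, g4, ?_⟩
  · rw [annDecompose, annLetters_append, annLetters_append, f]
    simp [g1]
  · rw [annDecompose, annLetters_append, annLetters_append, f']
    simp [g2]
  · have hfl := flatten_annSplit H P
    rw [hP₁] at hfl
    rw [List.flatten_append, flat_append, flat_flatMap_annProcess hF, List.append_assoc, g5,
      ← flat_annLetters (n := n) p]
    change _ = flat P
    rw [← hfl]
    simp

lemma adaptive_annDecompose_prefix {R : ℕ} {F : List (Gam S n) → List ℕ} (hF : IsLocalColoring R F)
    (m : ℕ) (u v y : List S) :
    AdaptiveFrom (4 * R + 36) m fun H l => ∃ As w E As' w' E' z Cs,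
      Bordered (annDecompose F H l (u ++ y)) u As w E z Cs ∧
      Bordered (annDecompose F H l (v ++ y)) v As' w' E' z Cs := by
  have last : ∀ u : List S, ∃ u₁ u₂, u = u₁ ++ u₂ ∧ u₂.length ≤ 1 ∧ (u₂ = [] → u₁ = []) := by
    intro u
    rcases List.eq_nil_or_concat u with rfl | ⟨u₁, a, rfl⟩
    · exact ⟨[], [], by simp⟩
    · exact ⟨u₁, [a], by simp⟩
  obtain ⟨u₁, u₂, hu, hu2, hu0⟩ := last u
  obtain ⟨v₁, v₂, hv, hv2, hv0⟩ := last v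
  set J := annLetters n u₁ with hJ
  set N := annLetters n u₂ with hN
  set J' := annLetters n v₁ with hJ'
  set N' := annLetters n v₂ with hN'
  set Q := annLetters n y
  have lN : N.length ≤ 1 := by simpa [N] using hu2
  have lN' : N'.length ≤ 1 := by simpa [N'] using hv2
  have J0 : u₂ = [] → J = [] := fun h => by rw [hJ, hu0 h]; rfl
  have J0' : v₂ = [] → J' = [] := fun h => by rw [hJ', hv0 h]; rfl
  refine ⟨adjPairs (syms (N ++ Q.take 2)) ++ adjPairs (syms (N' ++ Q.take 2)), ?_, fun H hH => ?_⟩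
  · simp only [List.length_append, length_adjPairs, List.length_map, List.length_take]
    omega
  obtain ⟨h, Cs₁, hQ₁⟩ := annSplit_exists_cons H Q
  obtain ⟨As₁, Jr, f1, f2, f3⟩ := annSplit_before H J (N := N) (Q := Q)
    (fun p hp => hH p (List.mem_append_left _ hp)) hQ₁
  obtain ⟨As₁', Jr', f1', f2', f3'⟩ := annSplit_before H J' (N := N') (Q := Q)
    (fun p hp => hH p (List.mem_append_right _ hp)) hQ₁
  refine (adaptive_prefix hF m Jr N Jr' N' h u₂ v₂ [] (by omega) (by omega)
    (by simp [hN]) (by simp [hN']) ?_ ?_).mono le_rfl ?_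
  · intro h0
    rw [J0 h0] at f1
    exact (List.append_eq_nil_iff.1 f1).2
  · intro h0
    rw [J0' h0] at f1'
    exact (List.append_eq_nil_iff.1 f1').2
  · rintro l ⟨As, w, E, As', w', E', z, Cs, g, g'⟩
    have k := g.append (As₁.flatMap (annProcess F l)) (Cs₁.flatMap (annProcess F l)) ?_
    have k' := g'.append (As₁'.flatMap (annProcess F l)) (Cs₁.flatMap (annProcess F l)) ?_
    · have eB : annDecompose F H l (u ++ y) = As₁.flatMap (annProcess F l) ++
          (annProcess F l (Jr ++ (N ++ h)) ++ Cs₁.flatMap (annProcess F l)) := by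
        rw [hu, annDecompose, annLetters_append, annLetters_append, List.append_assoc, f3]
        simp
      have eB' : annDecompose F H l (v ++ y) = As₁'.flatMap (annProcess F l) ++
          (annProcess F l (Jr' ++ (N' ++ h)) ++ Cs₁.flatMap (annProcess F l)) := by
        rw [hv, annDecompose, annLetters_append, annLetters_append, List.append_assoc, f3']
        simp
      have eu : flat (As₁.flatMap (annProcess F l)).flatten ++ (flat Jr ++ u₂) = u := by
        rw [flat_flatMap_annProcess hF, ← List.append_assoc, ← flat_append, f1, hJ, flat_annLetters,
          ← hu]
      have eu' : flat (As₁'.flatMap (annProcess F l)).flatten ++ (flat Jr' ++ v₂) = v := by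
        rw [flat_flatMap_annProcess hF, ← List.append_assoc, ← flat_append, f1', hJ', flat_annLetters,
          ← hv]
      rw [← eB, eu] at k
      rw [← eB', eu'] at k'
      exact ⟨_, w, E, _, w', E', z, _, k, k'⟩
    · intro h0
      rw [f2' (J0' (List.append_eq_nil_iff.1 h0).2)]
      rfl
    · intro h0
      rw [f2 (J0 (List.append_eq_nil_iff.1 h0).2)]
      rfl

end TopLevel

/-! ### Edit distance -/

section EditDistance

variable {α : Type*}

lemma EditStep.append_left (a : List α) {x y : List α} (h : EditStep x y) :
    EditStep (a ++ x) (a ++ y) := by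
  cases h with
  | insert p q c => simpa using EditStep.insert (a ++ p) q c
  | delete p q c => simpa using EditStep.delete (a ++ p) q c
  | subst p q c d => simpa using EditStep.subst (a ++ p) q c d

lemma EditStep.append_right (a : List α) {x y : List α} (h : EditStep x y) :
    EditStep (x ++ a) (y ++ a) := by
  cases h with
  | insert p q c => simpa using EditStep.insert p (q ++ a) c
  | delete p q c => simpa using EditStep.delete p (q ++ a) c
  | subst p q c d => simpa using EditStep.subst p (q ++ a) c d

lemma EditPath.append_left (a : List α) {m : ℕ} {x y : List α} (h : EditPath m x y) :
    EditPath m (a ++ x) (a ++ y) := by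
  induction h with
  | refl x => exact .refl _
  | step _ h ih => exact .step ih (h.append_left a)

lemma EditPath.append_right (a : List α) {m : ℕ} {x y : List α} (h : EditPath m x y) :
    EditPath m (x ++ a) (y ++ a) := by
  induction h with
  | refl x => exact .refl _
  | step _ h ih => exact .step ih (h.append_right a)

lemma EditPath.trans {m m' : ℕ} {x y z : List α} (h : EditPath m x y) (h' : EditPath m' y z) :
    EditPath (m + m') x z := by
  induction h' with
  | refl x => exact h
  | step _ hs ih => exact .step (ih h) hs

lemma exists_editPath (x y : List α) : ∃ m, EditPath m x y := by
  have h1 : ∀ x : List α, ∃ m, EditPath m x [] := by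
    intro x
    induction x with
    | nil => exact ⟨0, .refl _⟩
    | cons a x ih =>
      obtain ⟨m, hm⟩ := ih
      exact ⟨_, (EditPath.step (.refl _) (.delete [] x a)).trans hm⟩
  have h2 : ∀ y : List α, ∃ m, EditPath m [] y := by
    intro y
    induction y with
    | nil => exact ⟨0, .refl _⟩
    | cons a y ih =>
      obtain ⟨m, hm⟩ := ih
      exact ⟨_, .step hm (.insert [] y a)⟩
  obtain ⟨m, hm⟩ := h1 x
  obtain ⟨m', hm'⟩ := h2 y
  exact ⟨_, hm.trans hm'⟩

lemma editPath_editDist (x y : List α) : EditPath (editDist x y) x y :=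
  Nat.sInf_mem (s := {m | EditPath m x y}) (exists_editPath x y)

lemma EditPath.editDist_le {m : ℕ} {x y : List α} (h : EditPath m x y) : editDist x y ≤ m :=
  Nat.sInf_le h

@[simp] lemma editDist_self (x : List α) : editDist x x = 0 :=
  Nat.le_zero.1 (EditPath.refl x).editDist_le

lemma editDist_triangle (x y z : List α) : editDist x z ≤ editDist x y + editDist y z :=
  ((editPath_editDist x y).trans (editPath_editDist y z)).editDist_le

lemma editDist_append_le (a b c d : List α) :
    editDist (a ++ b) (c ++ d) ≤ editDist a c + editDist b d :=
  (((editPath_editDist a c).append_right b).trans ((editPath_editDist b d).append_left c)).editDist_le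

lemma EditStep.exists_replace {x y : List α} (h : EditStep x y) : ∃ p q b b' : List α,
    x = p ++ (b ++ q) ∧ y = p ++ (b' ++ q) ∧ b.length ≤ 1 ∧ b'.length ≤ 1 ∧ editDist b b' ≤ 1 := by
  cases h with
  | insert p q c =>
    exact ⟨p, q, [], [c], rfl, rfl, by simp, by simp,
      (EditPath.step (.refl _) (EditStep.insert [] [] c)).editDist_le⟩
  | delete p q c =>
    exact ⟨p, q, [c], [], rfl, rfl, by simp, by simp,
      (EditPath.step (.refl _) (EditStep.delete [] [] c)).editDist_le⟩
  | subst p q c d =>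
    exact ⟨p, q, [c], [d], rfl, rfl, by simp, by simp,
      (EditPath.step (.refl _) (EditStep.subst [] [] c d)).editDist_le⟩

lemma editDist_replace_le (p q b b' : List α) :
    editDist (p ++ (b ++ q)) (p ++ (b' ++ q)) ≤ editDist b b' :=
  (((editPath_editDist b b').append_right q).append_left p).editDist_le

lemma editDist_flatten_le (Xs Ys : List (List α)) (h : Xs.length = Ys.length) :
    editDist Xs.flatten Ys.flatten ≤ (List.zipWith editDist Xs Ys).sum := by
  induction Xs generalizing Ys with
  | nil =>
    obtain rfl : Ys = [] := List.length_eq_zero_iff.1 h.symm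
    simp
  | cons X Xs ih =>
    match Ys, h with
    | Y :: Ys, h =>
      have h1 := ih Ys (by simpa using h)
      have h2 := editDist_append_le X Xs.flatten Y Ys.flatten
      simp only [List.flatten_cons, List.zipWith_cons_cons, List.sum_cons]
      omega

lemma sum_editDist_self (Xs : List (List α)) : (List.zipWith editDist Xs Xs).sum = 0 := by
  simp

lemma sum_editDist_triangle (Xs Ys Zs : List (List α)) (h : Xs.length = Ys.length)
    (h' : Ys.length = Zs.length) : (List.zipWith editDist Xs Zs).sum ≤
      (List.zipWith editDist Xs Ys).sum + (List.zipWith editDist Ys Zs).sum := by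
  induction Xs generalizing Ys Zs with
  | nil => simp
  | cons X Xs ih =>
    match Ys, Zs, h, h' with
    | Y :: Ys, Z :: Zs, h, h' =>
      have h1 := ih Ys Zs (by simpa using h) (by simpa using h')
      have h2 := editDist_triangle X Y Z
      simp only [List.zipWith_cons_cons, List.sum_cons]
      omega

end EditDistance

/-! ### Alignment of blocks -/

section Alignment

variable {S : Type*} {n : ℕ} {T : Type*}

lemma Bordered.exists_of_flat_eq {Bs : List (List (Ann S n T))} {u x : List T} (hB : Bs ≠ [])
    (h : flat Bs.flatten = u ++ x) : ∃ As w E z Cs, Bordered Bs u As w E z Cs := by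
  induction Bs generalizing u with
  | nil => exact (hB rfl).elim
  | cons E Bs ih =>
    rw [List.flatten_cons, flat_append] at h
    rcases List.append_eq_append_iff.1 h with ⟨u', hu, hx⟩ | ⟨z, hz, -⟩
    · rcases eq_or_ne u' [] with rfl | hu'
      · exact ⟨[], u, E, [], Bs, rfl, by simp [hu], rfl, fun _ => rfl⟩
      · obtain ⟨As, w, E', z, Cs, g⟩ := ih (by rintro rfl; simp at hx; exact hu' hx.1) hx
        refine ⟨E :: As, w, E', z, Cs, by rw [g.eq]; rfl, g.block, by simp [g.left, hu], ?_⟩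
        intro hw
        refine (hu' ?_).elim
        rw [← g.left, g.first hw, hw]
        rfl
    · exact ⟨[], u, E, z, Bs, rfl, hz, rfl, fun _ => rfl⟩

/-- A block that reaches to the border, or lies behind it, does not come before the block that contains the
last letter in front of the border. -/
lemma Bordered.length_le {Bs As As₁ Cs Cs₁ : List (List (Ann S n T))} {E E₁ : List (Ann S n T)}
    {u w z p a b : List T} (h : Bordered Bs u As w E z Cs) (e : Bs = As₁ ++ E₁ :: Cs₁)
    (hE : flat E₁ = a ++ b) (hA : flat As₁.flatten ++ a = u ++ p) : As.length ≤ As₁.length := by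
  by_contra! hlt
  rw [h.eq] at e
  rcases List.append_eq_append_iff.1 e with ⟨D, rfl, -⟩ | ⟨D, rfl, hD⟩
  · simp at hlt
  -- Otherwise `E₁` is in front of `E` and reaches to the border, so that no letter of `u` is left for `w`.
  · match D, hD with
    | [], _ => simp at hlt
    | E' :: D, hD =>
      obtain ⟨rfl, -⟩ := by simpa using hD
      have hl := h.left
      simp only [List.flatten_append, List.flatten_cons, flat_append, hE] at hl
      rw [← hl] at hA
      have hlen := congrArg List.length hA
      simp only [List.length_append] at hlen
      have hw : w = [] := List.length_eq_zero_iff.1 (by omega)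
      exact List.append_ne_nil_of_right_ne_nil _ (by simp) (h.first hw)

/-- The first block that reaches to the border is determined by the sequence of blocks. -/
lemma Bordered.unique {Bs As As₁ Cs Cs₁ : List (List (Ann S n T))} {E E₁ : List (Ann S n T)}
    {u w w₁ z z₁ : List T} (h : Bordered Bs u As w E z Cs) (h₁ : Bordered Bs u As₁ w₁ E₁ z₁ Cs₁) :
    z = z₁ ∧ Cs = Cs₁ := by
  have hl := h.length_le (p := []) h₁.eq h₁.block (by rw [h₁.left, List.append_nil])
  have hl' := h₁.length_le (p := []) h.eq h.block (by rw [h.left, List.append_nil])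
  obtain ⟨rfl, e⟩ := List.append_inj (h.eq.symm.trans h₁.eq) (le_antisymm hl hl')
  simp only [List.cons.injEq] at e
  obtain ⟨rfl, rfl⟩ := e
  obtain rfl : w = w₁ := List.append_cancel_left (h.left.trans h₁.left.symm)
  exact ⟨List.append_cancel_left (h.block.symm.trans h₁.block), rfl⟩

lemma Bordered.flat_eq {Bs As Cs : List (List (Ann S n T))} {E : List (Ann S n T)}
    {u w z x : List T} (h : Bordered Bs u As w E z Cs) (hx : flat Bs.flatten = u ++ x) :
    x = z ++ (Cs.map flat).flatten := by
  refine List.append_cancel_left (as := u) ?_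
  rw [← hx, h.eq, ← flat_flatten]
  simp [h.block, ← h.left]

/-- The blocks behind the border are aligned, with total edit distance at most `m`. -/
def CloseBehind (m : ℕ) (Bs Bs' : List (List (Ann S n T))) (u v : List T) : Prop :=
  ∃ As w E z Cs As' w' E' z' Cs', Bordered Bs u As w E z Cs ∧ Bordered Bs' v As' w' E' z' Cs' ∧
    Cs.length = Cs'.length ∧
    editDist z z' + (List.zipWith editDist (Cs.map flat) (Cs'.map flat)).sum ≤ m

lemma CloseBehind.trans {m m' : ℕ} {Bs Bs' Bs'' : List (List (Ann S n T))} {u v w : List T}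
    (h : CloseBehind m Bs Bs' u v) (h' : CloseBehind m' Bs' Bs'' v w) :
    CloseBehind (m + m') Bs Bs'' u w := by
  obtain ⟨_, _, _, _, _, _, _, _, z, Cs, b1, b2, hl, hm⟩ := h
  obtain ⟨_, _, _, _, _, _, _, _, _, _, b1', b2', hl', hm'⟩ := h'
  obtain ⟨rfl, rfl⟩ := b2.unique b1'
  refine ⟨_, _, _, _, _, _, _, _, _, _, b1, b2', hl.trans hl', ?_⟩
  have h2 := sum_editDist_triangle _ _ _ ((List.length_map flat).trans
    (hl.trans (List.length_map flat).symm)) ((List.length_map flat).trans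
    (hl'.trans (List.length_map flat).symm))
  refine (add_le_add (editDist_triangle _ z _) h2).trans ?_
  omega

lemma CloseBehind.refl {Bs : List (List (Ann S n T))} {u x : List T} (hB : Bs ≠ [])
    (h : flat Bs.flatten = u ++ x) : CloseBehind 0 Bs Bs u u := by
  obtain ⟨As, w, E, z, Cs, g⟩ := Bordered.exists_of_flat_eq hB h
  exact ⟨_, _, _, _, _, _, _, _, _, _, g, g, rfl, by rw [sum_editDist_self, editDist_self]⟩

/-- A change behind the border leaves the blocks in front of it alone, and the part of the bordering block that
is in front of the border. -/
lemma BlockEdit.closeBehind {Bs Bs' : List (List (Ann S n T))} {u p b b' x : List T}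
    (h : BlockEdit Bs Bs' (u ++ p) b b') (hx : flat Bs.flatten = u ++ x) :
    CloseBehind (editDist b b') Bs Bs' u u := by
  obtain ⟨As₁, E₁, E₁', Cs₁, a, c, e, e', hE, hE', hA⟩ := h
  obtain ⟨As, w, E, z, Cs, g⟩ := Bordered.exists_of_flat_eq (by rw [e]; simp) hx
  have hle := g.length_le e hE hA
  have hcut := g.eq.symm.trans e
  rcases List.append_eq_append_iff.1 hcut with ⟨D, rfl, hD⟩ | ⟨D, rfl, hD⟩
  · match D, hD with
    | [], hD =>
      simp only [List.nil_append, List.cons.injEq] at hD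
      obtain ⟨rfl, rfl⟩ := hD
      simp only [List.append_nil] at hA e'
      have ha : a = w ++ p := by
        rw [← g.left, List.append_assoc] at hA
        exact List.append_cancel_left hA
      have hz : z = p ++ (b ++ c) := by
        have := g.block.symm.trans hE
        rw [ha, List.append_assoc] at this
        exact List.append_cancel_left this
      refine ⟨As, w, E, z, Cs, As, w, E₁', p ++ (b' ++ c), Cs, g, ⟨e', by rw [hE', ha]; simp, g.left,
        g.first⟩, rfl, ?_⟩
      rw [sum_editDist_self, hz]
      exact editDist_replace_le ..
    | E' :: D, hD =>
      simp only [List.cons_append, List.cons.injEq] at hD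
      obtain ⟨rfl, rfl⟩ := hD
      refine ⟨As, w, E, z, _, As, w, E, z, D ++ E₁' :: Cs₁, g, ⟨by simp [e'], g.block, g.left, g.first⟩,
        by simp, ?_⟩
      rw [List.map_append, List.map_append, List.zipWith_append rfl]
      simp only [List.map_cons, List.zipWith_cons_cons, List.sum_append, sum_editDist_self,
        List.sum_cons, editDist_self, hE, hE']
      have := editDist_replace_le a c b b'
      omega
  · obtain rfl : D = [] := by
      rw [List.length_append] at hle
      exact List.length_eq_zero_iff.1 (by omega)
    simp only [List.nil_append, List.cons.injEq] at hD
    obtain ⟨rfl, rfl⟩ := hD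
    simp only [List.append_nil] at g
    have ha : a = w ++ p := by
      rw [← g.left, List.append_assoc] at hA
      exact List.append_cancel_left hA
    have hz : z = p ++ (b ++ c) := by
      have := g.block.symm.trans hE
      rw [ha, List.append_assoc] at this
      exact List.append_cancel_left this
    refine ⟨As₁, w, E₁, z, Cs₁, As₁, w, E₁', p ++ (b' ++ c), Cs₁, g, ⟨e', by rw [hE', ha]; simp, g.left,
      g.first⟩, rfl, ?_⟩
    rw [sum_editDist_self, hz]
    exact editDist_replace_le ..

variable [DecidableEq S]

lemma adaptive_closeBehind_of_editPath {R : ℕ} {F : List (Gam S n) → List ℕ}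
    (hF : IsLocalColoring R F) (m : ℕ) (u : List S) {d : ℕ} {x y : List S} (h : EditPath d x y) :
    AdaptiveFrom ((8 * R + 46) * d) m fun H l =>
      CloseBehind d (annDecompose F H l (u ++ x)) (annDecompose F H l (u ++ y)) u u := by
  induction h with
  | refl x =>
    exact ⟨[], by simp, fun H _ => Adaptive.of_forall fun l =>
      CloseBehind.refl (annDecompose_ne_nil _ _ _ _) (flat_annDecompose hF ..)⟩
  | @step d x y z _ hs ih =>
    obtain ⟨p, q, b, b', rfl, rfl, hb, hb', hbb⟩ := hs.exists_replace
    refine (ih.and (adaptive_annDecompose_edit hF m (u ++ p) q hb hb')).mono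
      (by rw [Nat.mul_succ]) ?_
    rintro H l ⟨h1, h2⟩
    rw [List.append_assoc, List.append_assoc] at h2
    obtain ⟨_, _, _, _, _, _, _, _, _, _, b1, b2, hl, hm⟩ :=
      h1.trans (h2.closeBehind (flat_annDecompose hF ..))
    exact ⟨_, _, _, _, _, _, _, _, _, _, b1, b2, hl, hm.trans (by omega)⟩

/-- The blocks of the decompositions of `u ++ x` and `v ++ y` can be aligned at the price of boundedly
many constraints for each of the edit operations that change `x` into `y`: these operations are
made one after another, and at last the prefix is exchanged. -/
lemma adaptive_closeBehind {R : ℕ} {F : List (Gam S n) → List ℕ} (hF : IsLocalColoring R F) (m : ℕ)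
    (u v x y : List S) {k : ℕ} (hk : editDist x y ≤ k) :
    AdaptiveFrom ((8 * R + 46) * k + (4 * R + 36)) m fun H l =>
      CloseBehind (editDist x y) (annDecompose F H l (u ++ x)) (annDecompose F H l (v ++ y)) u v := by
  refine ((adaptive_closeBehind_of_editPath hF m u (editPath_editDist x y)).and
    (adaptive_annDecompose_prefix hF m u v y)).mono (by gcongr) ?_
  rintro H l ⟨h1, As, w, E, As', w', E', z, Cs, g, g'⟩
  exact h1.trans (m' := 0) ⟨_, _, _, _, _, _, _, _, _, _, g, g', rfl, by rw [sum_editDist_self, editDist_self]⟩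

lemma adaptive_closeBehind_of_length_le {R : ℕ} {F : List (Gam S n) → List ℕ}
    (hF : IsLocalColoring R F) (m : ℕ) {c : ℕ} (hc : 13 ≤ c) (u v x y : List S)
    (hx : (u ++ x).length ≤ c) (hy : (v ++ y).length ≤ c) :
    AdaptiveFrom (c + c) m fun H l =>
      CloseBehind (editDist x y) (annDecompose F H l (u ++ x)) (annDecompose F H l (v ++ y)) u v := by
  refine ((adaptive_annDecompose_single hF m hc hx).and
    (adaptive_annDecompose_single hF m hc hy)).mono le_rfl ?_
  rintro H l ⟨⟨E, h⟩, ⟨E', h'⟩⟩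
  have e := flat_annDecompose hF H l (u ++ x)
  have e' := flat_annDecompose hF H l (v ++ y)
  rw [h, List.flatten_singleton] at e
  rw [h', List.flatten_singleton] at e'
  exact ⟨[], u, E, x, [], [], v, E', y, [], ⟨h, e, rfl, fun _ => rfl⟩, ⟨h', e', rfl, fun _ => rfl⟩,
    rfl, by simp⟩

end Alignment

/-! ### Words derived from partial grammars -/

section Expansion

variable {S : Type*} {n : ℕ}

/-- The extension of an expansion relation from `Σ ∪ Σ_c` to the working alphabet: the expansions of
`r_{b,r}` consist of `r` expansions of `b`, which may differ. -/
def LiftExp (E : Base S n → List S → Prop) : Gam S n → List S → Prop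
  | Sum.inl b, z => E b z
  | Sum.inr (b, r), z => ∃ es : List (List S), es.length = r ∧ (∀ e ∈ es, E b e) ∧ z = es.flatten

/-- `BaseExp Ds b z`: the word `z` is derived from the symbol `b` by the rules of the partial grammars
`Ds`, if the symbols on the right-hand side of each rule are rewritten by later elements of `Ds`
only. -/
def BaseExp : List (PartialGramm S n) → Base S n → List S → Prop
  | [], b, z => ∃ a, b = Sum.inl a ∧ z = [a]
  | D :: Ds, b, z => BaseExp Ds b z ∨ ∃ c p z₁ z₂, b = Sum.inr c ∧ (c, p) ∈ D ∧
      LiftExp (BaseExp Ds) p.1 z₁ ∧ LiftExp (BaseExp Ds) p.2 z₂ ∧ z = z₁ ++ z₂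

/-- As `BaseExp`, for all symbols of the working alphabet. -/
abbrev Expands (Ds : List (PartialGramm S n)) : Gam S n → List S → Prop := LiftExp (BaseExp Ds)

lemma LiftExp.mono {E E' : Base S n → List S → Prop} (h : ∀ b z, E b z → E' b z) {a : Gam S n}
    {z : List S} (ha : LiftExp E a z) : LiftExp E' a z := by
  match a, ha with
  | Sum.inl b, ha => exact h _ _ ha
  | Sum.inr (b, r), ⟨es, h1, h2, h3⟩ => exact ⟨es, h1, fun e he => h _ _ (h2 e he), h3⟩

lemma Expands.cons {D : PartialGramm S n} {Ds : List (PartialGramm S n)} {a : Gam S n} {z : List S}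
    (h : Expands Ds a z) : Expands (D :: Ds) a z := h.mono fun _ _ => Or.inl

lemma length_le_length_flatten {α : Type*} {es : List (List α)} (h : ∀ e ∈ es, 1 ≤ e.length) :
    es.length ≤ es.flatten.length := by
  induction es with
  | nil => simp
  | cons e es ih =>
    have h1 := h e (by simp)
    have h2 := ih fun e he => h e (by simp [he])
    simp only [List.length_cons, List.flatten_cons, List.length_append]
    omega

lemma LiftExp.one_le_length {E : Base S n → List S → Prop} (h : ∀ b z, E b z → 1 ≤ z.length)
    {a : Gam S n} {z : List S} (ha : LiftExp E a z) : 1 ≤ z.length := by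
  match a, ha with
  | Sum.inl b, ha => exact h _ _ ha
  | Sum.inr (b, r), ⟨es, h1, h2, h3⟩ =>
    have h4 := length_le_length_flatten fun e he => h _ _ (h2 e he)
    have h5 := (Finset.mem_Icc.1 r.2).1
    rw [h3]
    omega

lemma BaseExp.one_le_length {Ds : List (PartialGramm S n)} {b : Base S n} {z : List S}
    (h : BaseExp Ds b z) : 1 ≤ z.length := by
  induction Ds generalizing b z with
  | nil =>
    obtain ⟨a, -, rfl⟩ := h
    simp
  | cons D Ds ih =>
    rcases h with h | ⟨c, p, z₁, z₂, -, -, h1, -, rfl⟩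
    · exact ih h
    · have := h1.one_le_length fun _ _ => ih
      rw [List.length_append]
      omega

/-- A repetition of a symbol, at least two and altogether at most `n` letters long when expanded, is
replaced by a symbol of `Σ_r` with the same expansion. -/
lemma liftExp_repeatSymbol {E : Base S n → List S → Prop} (hE : ∀ b z, E b z → 1 ≤ z.length)
    (a : Gam S n) (c : List (Ann S n S)) (h2 : 2 ≤ c.length) (hn : (flat c).length ≤ n)
    (hc : ∀ q ∈ c, q.1 = a ∧ LiftExp E q.1 q.2) : LiftExp E (repeatSymbol a c.length) (flat c) := by
  match a with
  | Sum.inl b =>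
    have hes : ∀ e ∈ c.map Prod.snd, E b e := by
      intro e he
      obtain ⟨q, hq, rfl⟩ := List.mem_map.1 he
      have := hc q hq
      rw [this.1] at this
      exact this.2
    have hl := length_le_length_flatten fun e he => hE _ _ (hes e he)
    have hf : flat c = (c.map Prod.snd).flatten := List.flatMap_def ..
    rw [← hf, List.length_map] at hl
    rw [repeatSymbol, dif_pos (Finset.mem_Icc.2 ⟨h2, hl.trans hn⟩)]
    exact ⟨c.map Prod.snd, by simp, hes, hf⟩
  | Sum.inr (b, s) =>
    have key : ∃ es : List (List S), es.length = c.length * s ∧ (∀ e ∈ es, E b e) ∧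
        flat c = es.flatten := by
      clear h2 hn
      induction c with
      | nil => exact ⟨[], by simp, by simp, rfl⟩
      | cons q c ih =>
        obtain ⟨es, g1, g2, g3⟩ := ih fun q hq => hc q (by simp [hq])
        have := hc q (by simp)
        rw [this.1] at this
        obtain ⟨-, es', g1', g2', g3'⟩ := this
        refine ⟨es' ++ es, by rw [List.length_append, g1, g1', List.length_cons]; ring, ?_, ?_⟩
        · intro e he
          rcases List.mem_append.1 he with he | he
          · exact g2' e he
          · exact g2 e he
        · rw [flat_cons, g3, g3', List.flatten_append]
    obtain ⟨es, g1, g2, g3⟩ := key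
    have hl := length_le_length_flatten fun e he => hE _ _ (g2 e he)
    rw [← g3, g1] at hl
    have hs := (Finset.mem_Icc.1 s.2).1
    have h1 : 2 ≤ c.length * s := by nlinarith
    rw [repeatSymbol, dif_pos (Finset.mem_Icc.2 ⟨h1, hl.trans hn⟩)]
    exact ⟨es, g1, g2, g3⟩

lemma expands_annOut {Ds : List (PartialGramm S n)} {D : PartialGramm S n}
    [DecidableEq S] (C : Gam S n × Gam S n → Comp n) (c : List (Ann S n S))
    (hc : (syms c).length = 1 ∨ RepChunk (syms c) ∨ ShortChunk (syms c))
    (hn : (flat c).length ≤ n) (hD : ∀ p ∈ adjPairs (syms c), (C p, p) ∈ D)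
    (hE : ∀ q ∈ c, Expands Ds q.1 q.2) : ∀ q ∈ annOut C c, Expands (D :: Ds) q.1 q.2 := by
  match c with
  | [] => simp [annOut]
  | [a] =>
    intro q hq
    obtain rfl : q = a := by simpa [annOut] using hq
    exact (hE q (by simp)).cons
  | a :: b :: w =>
    intro q hq
    rw [annOut] at hq
    split_ifs at hq with hab
    · obtain rfl : q = _ := List.mem_singleton.1 hq
      have hrep : RepChunk (syms (a :: b :: w)) := by
        rcases hc with hc | hc | ⟨x, y, hxy, hc⟩
        · simp at hc
        · exact hc
        · rcases hc with hc | ⟨d, hc⟩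
          · simp only [syms, List.map_cons, List.cons.injEq] at hc
            exact (hxy (by rw [← hc.1, ← hc.2.1, hab])).elim
          · simp only [syms, List.map_cons, List.cons.injEq] at hc
            exact (hxy (by rw [← hc.1, ← hc.2.1, hab])).elim
      obtain ⟨x, r, -, hr⟩ := hrep
      have hall : ∀ q ∈ a :: b :: w, q.1 = x := by
        intro q hq
        refine List.eq_of_mem_replicate (n := r) ?_
        rw [← hr]
        exact List.mem_map_of_mem hq
      have := liftExp_repeatSymbol (fun _ _ => BaseExp.one_le_length) x (a :: b :: w) (by simp) hn
        fun q hq => ⟨hall q hq, hE q hq⟩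
      rw [← hall a (by simp)] at this
      exact Expands.cons this
    · rcases List.mem_cons.1 hq with rfl | hq
      · refine Or.inr ⟨_, (a.1, b.1), a.2, b.2, rfl, hD _ ?_, hE a (by simp), hE b (by simp), rfl⟩
        simp [adjPairs]
      · exact (hE q (by simp [hq])).cons

lemma expands_annCompress [DecidableEq S] {R : ℕ} {F : List (Gam S n) → List ℕ}
    (hF : IsLocalColoring R F) {Ds : List (PartialGramm S n)} (C : Gam S n × Gam S n → Comp n)
    (B : List (Ann S n S)) (hn : (flat B).length ≤ n) (hE : ∀ q ∈ B, Expands Ds q.1 q.2) :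
    ∀ q ∈ annCompress F C B, Expands (dictRules C (syms B) :: Ds) q.1 q.2 := by
  intro q hq
  obtain ⟨cs, e1, e2, -⟩ := exists_annChunks hF B
  have hfl := flatten_annChunks hF B
  rw [e1] at hfl
  rw [annCompress, e1] at hq
  obtain ⟨c, hc, hqc⟩ := List.mem_flatMap.1 hq
  rcases List.mem_cons.1 hc with rfl | hc
  · simp [annOut] at hqc
  obtain ⟨s, t, rfl⟩ := List.append_of_mem hc
  have hB : B = s.flatten ++ (c ++ t.flatten) := by simp [← hfl]
  refine expands_annOut C c ?_ ?_ ?_ ?_ q hqc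
  · exact e2.1 (syms c) (List.mem_map_of_mem hc)
  · rw [hB] at hn
    simp only [flat_append, List.length_append] at hn
    omega
  · intro p hp
    refine ⟨mem_adjPairs_of_infix ⟨syms s.flatten, syms t.flatten, ?_⟩ p hp, rfl⟩
    rw [hB]
    simp
  · intro q hq
    exact hE q (by rw [hB]; simp [hq])

end Expansion

/-! ### Evaluation of the grammars -/

section Evaluation

variable {S : Type*} {n : ℕ}

lemma produces_liftExp {G : Gramm S n} {K : Set (Comp n)} {E : Base S n → List S → Prop}
    (hE : ∀ b z, E b z → compOf (Sum.inl b) ⊆ K → ∀ f zf, Produces G f zf →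
      Produces G (some (Sum.inl b) :: f) (z ++ zf)) {a : Gam S n} {z : List S} (ha : LiftExp E a z)
    (hK : compOf a ⊆ K)
    (hr : ∀ b r, a = repSym b r → (some (repSym b r), List.replicate (r : ℕ) (Sum.inl b)) ∈ G)
    {f : List (Option (Gam S n))} {zf : List S} (hf : Produces G f zf) :
    Produces G (some a :: f) (z ++ zf) := by
  match a, ha with
  | Sum.inl b, ha => exact hE b z ha hK f zf hf
  | Sum.inr (b, r), ⟨es, h1, h2, h3⟩ =>
    refine Produces.rewrite (hr b r rfl) ?_
    have hK' : compOf (Sum.inl b : Gam S n) ⊆ K := by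
      cases b <;> exact hK
    rw [h3, ← h1]
    clear h1 h3
    induction es with
    | nil => simpa using hf
    | cons e es ih =>
      simp only [List.length_cons, List.replicate_succ, List.map_cons, List.cons_append,
        List.flatten_cons, List.append_assoc]
      exact hE b e (h2 e (by simp)) hK' _ _ (ih fun e he => h2 e (by simp [he]))

/-- The rules that are collected for a set of symbols suffice for rewriting these symbols. -/
lemma produces_baseExp {G : Gramm S n} (Ds : List (PartialGramm S n)) (K : Set (Comp n))
    (hG : collectRules Ds K ⊆ G)
    (hr : ∀ σ ∈ collectRules Ds K, ∀ b r, repSym b r ∈ σ.2 →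
      (some (repSym b r), List.replicate (r : ℕ) (Sum.inl b)) ∈ G) :
    ∀ b z, BaseExp Ds b z → compOf (Sum.inl b) ⊆ K → ∀ f zf, Produces G f zf →
      Produces G (some (Sum.inl b) :: f) (z ++ zf) := by
  induction Ds generalizing K with
  | nil =>
    rintro b z ⟨a, rfl, rfl⟩ - f zf hf
    exact Produces.terminal a hf
  | cons D Ds ih =>
    have ih' := ih _ (fun ρ hρ => hG (Or.inr hρ)) fun σ hσ => hr σ (Or.inr hσ)
    rintro b z (hb | ⟨c, ⟨a₁, a₂⟩, z₁, z₂, rfl, hD, h1, h2, rfl⟩) hK f zf hf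
    · exact ih' b z hb (hK.trans Set.subset_union_left) f zf hf
    · have hc : c ∈ K := hK rfl
      have hrule : (some (compSym c), [a₁, a₂]) ∈ collectRules (D :: Ds) K :=
        Or.inl ⟨c, a₁, a₂, hc, hD, rfl⟩
      refine Produces.rewrite (hG hrule) ?_
      rw [List.append_assoc]
      refine produces_liftExp ih' h1 (fun c' hc' => Or.inr ⟨c, a₁, a₂, hc, hD, Or.inl hc'⟩) ?_
        (produces_liftExp ih' h2 (fun c' hc' => Or.inr ⟨c, a₁, a₂, hc, hD, Or.inr hc'⟩) ?_ hf)
      · rintro b r rfl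
        exact hr _ hrule b r (by simp)
      · rintro b r rfl
        exact hr _ hrule b r (by simp)

/-- No symbol is the left-hand side of two different rules. -/
def RulesFunctional (Ds : List (PartialGramm S n)) : Prop :=
  ∀ D ∈ Ds, ∀ D' ∈ Ds, ∀ c p p', (c, p) ∈ D → (c, p') ∈ D' → p = p'

lemma exists_of_mem_collectRules {Ds : List (PartialGramm S n)} {K : Set (Comp n)}
    {ρ : Option (Gam S n) × List (Gam S n)} (h : ρ ∈ collectRules Ds K) :
    ∃ D ∈ Ds, ∃ c a b, (c, (a, b)) ∈ D ∧ ρ = (some (compSym c), [a, b]) := by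
  induction Ds generalizing K with
  | nil => exact h.elim
  | cons D Ds ih =>
    rcases h with ⟨c, a, b, -, h1, h2⟩ | h
    · exact ⟨D, by simp, c, a, b, h1, h2⟩
    · obtain ⟨D', hD', h⟩ := ih h
      exact ⟨D', by simp [hD'], h⟩

lemma deterministic_grammarOf {Ds : List (PartialGramm S n)} (h : RulesFunctional Ds)
    (B : List (Gam S n)) : Deterministic (grammarOf B Ds) := by
  have key : ∀ ρ ∈ grammarOf B Ds, ρ = (none, B) ∨
      (∃ D ∈ Ds, ∃ c a b, (c, (a, b)) ∈ D ∧ ρ = (some (compSym c), [a, b])) ∨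
      ∃ b r, ρ = (some (repSym b r), List.replicate (r : ℕ) (Sum.inl b)) := by
    rintro ρ ((hρ | hρ) | ⟨b, r, -, hρ⟩)
    · exact Or.inl hρ
    · exact Or.inr (Or.inl (exists_of_mem_collectRules hρ))
    · exact Or.inr (Or.inr ⟨b, r, hρ⟩)
  constructor
  · intro a w hw
    rcases key _ hw with h | ⟨D, _, c, a, b, _, h⟩ | ⟨b, r, h⟩ <;> simp [Prod.ext_iff] at h
  · intro c w w' hw hw'
    rcases key _ hw with e | ⟨D, hD, d, a, b, hd, e⟩ | ⟨b, r, e⟩ <;>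
    rcases key _ hw' with e' | ⟨D', hD', d', a', b', hd', e'⟩ | ⟨b', r', e'⟩ <;>
    obtain ⟨e1, e2⟩ := Prod.ext_iff.1 e <;> obtain ⟨e1', e2'⟩ := Prod.ext_iff.1 e' <;>
    simp only at e1 e2 e1' e2' <;> rw [e1] at e1' <;> simp at e1'
    · rw [e2, e2']
    · subst e1'
      have := h D hD D' hD' _ _ _ hd hd'
      simp only [Prod.mk.injEq] at this
      rw [e2, e2', this.1, this.2]
    · rw [e2, e2', e1'.1, e1'.2]

lemma isEval_grammarOf {Ds : List (PartialGramm S n)} (h : RulesFunctional Ds)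
    {B : List (Ann S n S)} (hB : ∀ q ∈ B, Expands Ds q.1 q.2) :
    IsEval (grammarOf (syms B) Ds) (flat B) := by
  refine ⟨deterministic_grammarOf h _, Produces.rewrite (w := syms B) (Or.inl (Or.inl rfl)) ?_⟩
  have hrep : ∀ σ ∈ coreGrammar (syms B) Ds, ∀ b r, repSym b r ∈ σ.2 →
      (some (repSym b r), List.replicate (r : ℕ) (Sum.inl b)) ∈ grammarOf (syms B) Ds :=
    fun σ hσ b r hb => Or.inr ⟨b, r, ⟨σ, hσ, hb⟩, rfl⟩
  have base := produces_baseExp Ds {c | ∃ a ∈ syms B, c ∈ compOf a}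
    (G := grammarOf (syms B) Ds) (fun ρ hρ => Or.inl (Or.inr hρ)) fun σ hσ => hrep σ (Or.inr hσ)
  have hsub : ∀ B' : List (Ann S n S), B' ⊆ B →
      Produces (grammarOf (syms B) Ds) ((syms B').map some ++ []) (flat B') := by
    intro B' hB'
    induction B' with
    | nil => exact Produces.nil
    | cons q B' ih =>
      have hq : q ∈ B := hB' (by simp)
      refine produces_liftExp base (hB q hq) (fun c hc => ⟨q.1, List.mem_map_of_mem hq, hc⟩) ?_
        (ih fun a ha => hB' (by simp [ha]))
      intro b r e
      exact hrep _ (Or.inl rfl) b r (by rw [← e]; exact List.mem_map_of_mem hq)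
  exact hsub B fun _ h => h

lemma annSplit_map_syms {T : Type*} (H : Gam S n × Gam S n → ℕ) (B : List (Ann S n T)) :
    (annSplit H B).map syms = split H (syms B) := (split_map H Prod.fst B).symm

lemma flat_length_le_of_mem {T : Type*} {B : List (Ann S n T)} {Bs : List (List (Ann S n T))}
    (hB : B ∈ Bs) : (flat B).length ≤ (flat Bs.flatten).length := by
  obtain ⟨s, t, rfl⟩ := List.append_of_mem hB
  simp
  omega

lemma forall₂_flatMap {α γ δ : Type*} {r : γ → δ → Prop} (Bs : List α) (f : α → List γ)
    (g : α → List δ) (h : ∀ B ∈ Bs, List.Forall₂ r (f B) (g B)) :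
    List.Forall₂ r (Bs.flatMap f) (Bs.flatMap g) := by
  induction Bs with
  | nil => exact .nil
  | cons B Bs ih =>
    exact List.rel_append (h B (by simp)) (ih fun B hB => h B (by simp [hB]))

/-! ### Collisions -/

/-- The pairs of elements of a list, in the order of their occurrence. -/
def listPairs {α : Type*} : List α → List (α × α)
  | [] => []
  | a :: l => l.map (fun b => (a, b)) ++ listPairs l

lemma two_mul_length_listPairs {α : Type*} (l : List α) :
    2 * (listPairs l).length = l.length * (l.length - 1) := by
  induction l with
  | nil => rfl
  | cons a l ih =>
    simp only [listPairs, List.length_append, List.length_map, List.length_cons, Nat.add_sub_cancel]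
    rw [mul_add, ih]
    cases l.length with
    | zero => rfl
    | succ m =>
      simp only [Nat.add_sub_cancel]
      ring

lemma injOn_of_listPairs {α β : Type*} {C : α → β} {l : List α}
    (h : ∀ e ∈ listPairs l, e.1 ≠ e.2 → C e.1 ≠ C e.2) : Set.InjOn C {p | p ∈ l} := by
  induction l with
  | nil => simp
  | cons a l ih =>
    have h1 : ∀ b ∈ l, C a = C b → a = b := by
      intro b hb e
      by_contra hab
      exact h (a, b) (by simp [listPairs, hb]) hab e
    have h2 := ih fun e he => h e (by simp [listPairs, he])
    intro p hp q hq e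
    rcases List.mem_cons.1 hp with rfl | hp' <;> rcases List.mem_cons.1 hq with rfl | hq'
    · rfl
    · exact h1 q hq' e
    · exact (h1 p hp' e.symm).symm
    · exact h2 hp' hq' e

lemma pairCount_add_le (a b : ℕ) :
    (a - 1) * (a - 2) + (b - 1) * (b - 2) ≤ (a + b - 1) * (a + b - 2) := by
  rcases a with _ | _ | a
  · simp
  · simpa using Nat.mul_le_mul (by omega) (by omega)
  · rcases b with _ | _ | b
    · simp
    · simpa using Nat.mul_le_mul (by omega) (by omega)
    · simp only [show a + 1 + 1 - 1 = a + 1 by omega, show a + 1 + 1 - 2 = a by omega,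
        show b + 1 + 1 - 1 = b + 1 by omega, show b + 1 + 1 - 2 = b by omega,
        show a + 1 + 1 + (b + 1 + 1) - 1 = a + b + 3 by omega,
        show a + 1 + 1 + (b + 1 + 1) - 2 = a + b + 2 by omega]
      nlinarith [Nat.zero_le (a * b)]

lemma two_mul_length_flatMap_le {α γ : Type*} (f : List α → List γ)
    (hf : ∀ B, 2 * (f B).length ≤ (B.length - 1) * (B.length - 2)) (Bs : List (List α)) :
    2 * (Bs.flatMap f).length ≤ (Bs.flatten.length - 1) * (Bs.flatten.length - 2) := by
  induction Bs with
  | nil => simp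
  | cons B Bs ih =>
    rw [List.flatMap_cons, List.flatten_cons, List.length_append, List.length_append]
    have := pairCount_add_le B.length Bs.flatten.length
    have := hf B
    omega

variable [DecidableEq S]

/-- The blocks that the algorithm compresses, or turns into grammars, after `pre.length` further levels,
starting from the block `B`. -/
noncomputable def blocksAt (F : List (Gam S n) → List ℕ) :
    List (LevelHash S n) → List (Gam S n) → List (List (Gam S n))
  | [], B => [B]
  | (C, H) :: pre, B =>
      if B.length ≤ 2 then [] else (split H (compress F C B)).flatMap (blocksAt F pre)

/-- No compression function maps two pairs that occur in the same block to the same symbol. -/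
def CollisionFree (F : List (Gam S n) → List ℕ) (l : List (LevelHash S n)) (B : List (Gam S n)) : Prop :=
  ∀ pre C H rest, l = pre ++ (C, H) :: rest →
    ∀ B' ∈ blocksAt F pre B, Set.InjOn C {p | p ∈ adjPairs B'}

lemma CollisionFree.of_mem_split {F : List (Gam S n) → List ℕ} {l : List (LevelHash S n)}
    {B B' : List (Gam S n)} {C : Gam S n × Gam S n → Comp n} {H : Gam S n × Gam S n → ℕ}
    (h : CollisionFree F ((C, H) :: l) B) (hB : ¬ B.length ≤ 2) (hB' : B' ∈ split H (compress F C B)) :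
    CollisionFree F l B' := by
  rintro pre C' H' rest rfl B'' hB''
  refine h ((C, H) :: pre) C' H' rest rfl B'' ?_
  rw [blocksAt, if_neg hB]
  exact List.mem_flatMap.2 ⟨B', hB', hB''⟩

/-- Without collisions, the grammars evaluate to the words that the blocks stand for. -/
lemma forall₂_isEval_process {R : ℕ} {F : List (Gam S n) → List ℕ} (hF : IsLocalColoring R F)
    (l : List (LevelHash S n)) : ∀ (B : List (Ann S n S)) (Ds : List (PartialGramm S n)),
      (∀ i (hi : i < l.length), ∀ p, ((l[i].1 p).1 : ℕ) = Ds.length + i) → RulesFunctional Ds →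
      (∀ D ∈ Ds, ∀ ρ ∈ D, (ρ.1.1 : ℕ) < Ds.length) → (∀ q ∈ B, Expands Ds q.1 q.2) →
      (flat B).length ≤ n → CollisionFree F l (syms B) →
      List.Forall₂ IsEval (process F l (syms B) Ds) ((annProcess F l B).map flat) := by
  induction l with
  | nil =>
    intro B Ds _ hfun _ hE _ _
    exact .cons (isEval_grammarOf hfun hE) .nil
  | cons q l ih =>
    obtain ⟨C, H⟩ := q
    intro B Ds hl hfun hlev hE hn hcol
    rw [process, annProcess, List.length_map]
    split_ifs with hB
    · exact .cons (isEval_grammarOf hfun hE) .nil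
    · rw [← syms_annCompress hF, ← annSplit_map_syms, List.flatMap_map, List.map_flatMap]
      have hC : ∀ p, ((C p).1 : ℕ) = Ds.length := fun p => hl 0 (by simp) p
      refine forall₂_flatMap _ _ _ fun B' hB' => ih B' _ ?_ ?_ ?_ ?_ ?_ ?_
      · intro i hi p
        have := hl (i + 1) (by simpa using hi) p
        simp only [List.getElem_cons_succ] at this
        rw [this, List.length_cons]
        ring
      · have inj := hcol [] C H l rfl (syms B) (by simp [blocksAt])
        intro D hD D' hD' c p p' hp hp'
        rcases List.mem_cons.1 hD with rfl | hD <;> rcases List.mem_cons.1 hD' with rfl | hD'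
        · exact inj hp.1 hp'.1 (hp.2.symm.trans hp'.2)
        · have h1 := hlev D' hD' _ hp'
          have h2 : c = C p := hp.2
          rw [h2, hC] at h1
          exact (lt_irrefl _ h1).elim
        · have h1 := hlev D hD _ hp
          have h2 : c = C p' := hp'.2
          rw [h2, hC] at h1
          exact (lt_irrefl _ h1).elim
        · exact hfun D hD D' hD' c p p' hp hp'
      · intro D hD ρ hρ
        rw [List.length_cons]
        rcases List.mem_cons.1 hD with rfl | hD
        · rw [hρ.2, hC]
          omega
        · have := hlev D hD ρ hρ
          omega
      · intro q hq
        refine expands_annCompress hF C B hn hE q ?_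
        rw [← flatten_annSplit H (annCompress F C B)]
        exact List.mem_flatten.2 ⟨B', hB', hq⟩
      · refine (flat_length_le_of_mem hB').trans ?_
        rwa [flatten_annSplit, flat_annCompress hF]
      · refine hcol.of_mem_split (by rwa [List.length_map]) ?_
        rw [← syms_annCompress hF, ← annSplit_map_syms]
        exact List.mem_map_of_mem hB'

/-- The pairs of pairs of symbols that must not collide under the compression function on the level after
`pre`. -/
noncomputable def collisionPairs (F : List (Gam S n) → List ℕ) (pre : List (LevelHash S n))
    (B : List (Gam S n)) : List ((Gam S n × Gam S n) × (Gam S n × Gam S n)) :=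
  (blocksAt F pre B).flatMap fun B' => listPairs (adjPairs B')

lemma two_mul_length_collisionPairs_le {R : ℕ} {F : List (Gam S n) → List ℕ}
    (hF : IsLocalColoring R F) (pre : List (LevelHash S n)) (B : List (Gam S n)) :
    2 * (collisionPairs F pre B).length ≤ (B.length - 1) * (B.length - 2) := by
  induction pre generalizing B with
  | nil =>
    simp only [collisionPairs, blocksAt, List.flatMap_cons, List.flatMap_nil, List.append_nil]
    rw [two_mul_length_listPairs, length_adjPairs]
    exact le_of_eq (by rw [Nat.sub_sub])
  | cons q pre ih =>
    obtain ⟨C, H⟩ := q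
    rw [collisionPairs, blocksAt]
    split_ifs with hB
    · simp
    · rw [List.flatMap_assoc]
      refine (two_mul_length_flatMap_le _ ih _).trans ?_
      rw [flatten_split]
      have := length_compress_le hF C B
      gcongr

lemma collisionFree_of_collisionPairs {F : List (Gam S n) → List ℕ} {l : List (LevelHash S n)}
    {B : List (Gam S n)} (h : ∀ pre C H rest, l = pre ++ (C, H) :: rest →
      ∀ e ∈ collisionPairs F pre B, e.1 ≠ e.2 → C e.1 ≠ C e.2) : CollisionFree F l B :=
  fun pre C H rest hl B' hB' => injOn_of_listPairs fun e he =>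
    h pre C H rest hl e (List.mem_flatMap.2 ⟨B', hB', he⟩)

end Evaluation

/-! ### Uniform probability -/

section Probability

variable {Ω : Type*}

lemma uniformProb_eq (A : Finset Ω) (P : Ω → Prop) [DecidablePred P] :
    uniformProb A P = ((A.filter P).card : ℝ) / (A.card : ℝ) := by
  unfold uniformProb
  congr

lemma uniformProb_mono {A : Finset Ω} {P Q : Ω → Prop} (h : ∀ ω ∈ A, P ω → Q ω) :
    uniformProb A P ≤ uniformProb A Q := by
  classical
  rw [uniformProb_eq, uniformProb_eq]
  refine div_le_div_of_nonneg_right (Nat.cast_le.2 (Finset.card_le_card fun ω hω => ?_)) (by positivity)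
  rw [Finset.mem_filter] at hω ⊢
  exact ⟨hω.1, h ω hω.1 hω.2⟩

lemma uniformProb_or_le (A : Finset Ω) (P Q : Ω → Prop) :
    uniformProb A (fun ω => P ω ∨ Q ω) ≤ uniformProb A P + uniformProb A Q := by
  classical
  rw [uniformProb_eq, uniformProb_eq, uniformProb_eq, ← add_div]
  gcongr
  rw [Finset.filter_or]
  exact_mod_cast Finset.card_union_le _ _

lemma uniformProb_false (A : Finset Ω) : uniformProb A (fun _ => False) = 0 := by
  simp [uniformProb]

lemma uniformProb_exists_mem_list_le {β : Type*} (A : Finset Ω) (l : List β) (P : β → Ω → Prop)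
    {q : ℝ} (h : ∀ b ∈ l, uniformProb A (P b) ≤ q) :
    uniformProb A (fun ω => ∃ b ∈ l, P b ω) ≤ l.length * q := by
  induction l with
  | nil => simp [uniformProb_false]
  | cons b l ih =>
    have h1 : uniformProb A (fun ω => ∃ b' ∈ b :: l, P b' ω) ≤
        uniformProb A (fun ω => P b ω ∨ ∃ b' ∈ l, P b' ω) :=
      uniformProb_mono fun ω _ => by simp
    have h2 := uniformProb_or_le A (P b) fun ω => ∃ b' ∈ l, P b' ω
    have h3 := h b (by simp)
    have h4 := ih fun b hb => h b (by simp [hb])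
    rw [List.length_cons, Nat.cast_succ]
    linarith

lemma uniformProb_exists_fin_le (A : Finset Ω) {m : ℕ} (P : Fin m → Ω → Prop) {q : ℝ}
    (h : ∀ i, uniformProb A (P i) ≤ q) : uniformProb A (fun ω => ∃ i, P i ω) ≤ m * q := by
  have := uniformProb_exists_mem_list_le A (List.finRange m) P fun i _ => h i
  rw [List.length_finRange] at this
  exact (uniformProb_mono fun ω _ => by simp).trans this

lemma one_sub_le_uniformProb {A : Finset Ω} (hA : A.Nonempty) {P Q : Ω → Prop} {q : ℝ}
    (hQ : uniformProb A Q ≤ q) (h : ∀ ω ∈ A, ¬ Q ω → P ω) : 1 - q ≤ uniformProb A P := by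
  classical
  have hc : (0 : ℝ) < A.card := by exact_mod_cast hA.card_pos
  have h1 : uniformProb A P + uniformProb A Q ≥ 1 := by
    unfold uniformProb
    rw [← add_div, ge_iff_le, le_div_iff₀ hc, one_mul]
    have hsub : A ⊆ A.filter P ∪ A.filter Q := by
      intro ω hω
      by_cases hq : Q ω
      · simp [hω, hq]
      · simp [hω, h ω hω hq]
    exact_mod_cast (Finset.card_le_card hsub).trans (Finset.card_union_le _ _)
  linarith

lemma uniformProb_eq_sum {V : Type*} [Fintype V] (A : Finset Ω) (P : Ω → Prop) (g : Ω → V) :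
    uniformProb A P = ∑ v, uniformProb A (fun ω => P ω ∧ g ω = v) := by
  classical
  simp only [uniformProb_eq]
  rw [← Finset.sum_div]
  congr 1
  rw [Finset.card_eq_sum_card_fiberwise (f := g) (t := Finset.univ) fun _ _ => Finset.mem_univ _]
  simp [Finset.filter_filter]

/-- If an event has probability at most `q` whenever all but one of the independent random choices are
fixed, then it has probability at most `q`. The choice in question is read off by `get` and
replaced by `set`. -/
lemma uniformProb_le_of_resample {X : Type*} {A : Finset Ω} {B : Finset X} (hA : A.Nonempty)
    (hB : B.Nonempty) (get : Ω → X) (set : Ω → X → Ω) (hget : ∀ ω ∈ A, get ω ∈ B)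
    (hset : ∀ ω ∈ A, ∀ x ∈ B, set ω x ∈ A) (get_set : ∀ ω x, get (set ω x) = x)
    (set_get : ∀ ω, set ω (get ω) = ω) (set_set : ∀ ω x y, set (set ω x) y = set ω y)
    (N : Ω → X → Prop) (hN : ∀ ω x y, N (set ω x) y ↔ N ω y) {q : ℝ}
    (hq : ∀ ω ∈ A, uniformProb B (N ω) ≤ q) : uniformProb A (fun ω => N ω (get ω)) ≤ q := by
  classical
  have cA : (0 : ℝ) < A.card := by exact_mod_cast hA.card_pos
  have cB : (0 : ℝ) < B.card := by exact_mod_cast hB.card_pos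
  have h1 : ((A ×ˢ B).filter fun e => N e.1 e.2).card =
      ((A ×ˢ B).filter fun e => N e.1 (get e.1)).card := by
    refine Finset.card_bij' (fun e _ => (set e.1 e.2, get e.1)) (fun e _ => (set e.1 e.2, get e.1))
      ?_ ?_ ?_ ?_
    · rintro ⟨ω, x⟩ he
      simp only [Finset.mem_filter, Finset.mem_product] at he ⊢
      exact ⟨⟨hset _ he.1.1 _ he.1.2, hget _ he.1.1⟩, by rw [get_set, hN]; exact he.2⟩
    · rintro ⟨ω, x⟩ he
      simp only [Finset.mem_filter, Finset.mem_product] at he ⊢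
      exact ⟨⟨hset _ he.1.1 _ he.1.2, hget _ he.1.1⟩, by rw [hN]; exact he.2⟩
    · rintro ⟨ω, x⟩ -
      simp [get_set, set_get, set_set]
    · rintro ⟨ω, x⟩ -
      simp [get_set, set_get, set_set]
  have h2 : ((A ×ˢ B).filter fun e => N e.1 (get e.1)).card =
      (A.filter fun ω => N ω (get ω)).card * B.card := by
    rw [← Finset.card_product]
    congr 1
    ext ⟨ω, x⟩
    simp only [Finset.mem_filter, Finset.mem_product]
    tauto
  have h3 : ((A ×ˢ B).filter fun e => N e.1 e.2).card = ∑ ω ∈ A, (B.filter (N ω)).card := by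
    simp only [Finset.card_filter, Finset.sum_product]
  have h4 : ∀ ω ∈ A, ((B.filter (N ω)).card : ℝ) ≤ q * B.card := by
    intro ω hω
    have := hq ω hω
    rwa [uniformProb_eq, div_le_iff₀ cB] at this
  have h5 : (((A.filter fun ω => N ω (get ω)).card : ℝ)) * B.card ≤ A.card * (q * B.card) := by
    rw [← Nat.cast_mul, ← h2, ← h1, h3, Nat.cast_sum, ← nsmul_eq_mul]
    exact Finset.sum_le_card_nsmul A _ _ h4
  rw [uniformProb_eq, div_le_iff₀ cA]
  refine le_of_mul_le_mul_right ?_ cB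
  linarith

variable {U V : Type*} [Fintype V] {F : Finset (U → V)}

lemma PairwiseIndependent.uniformProb_apply_eq [Nontrivial U] (h : PairwiseIndependent F) (u : U)
    (v : V) : uniformProb F (fun f => f u = v) = 1 / (Fintype.card V : ℝ) := by
  obtain ⟨u', hu⟩ := exists_ne u
  have hV : (0 : ℝ) < Fintype.card V := by exact_mod_cast Fintype.card_pos_iff.2 ⟨v⟩
  rw [uniformProb_eq_sum F _ fun f => f u']
  simp only [h.2 u u' hu.symm]
  rw [Finset.sum_const, Finset.card_univ, nsmul_eq_mul]
  field_simp

lemma PairwiseIndependent.uniformProb_apply_eq_apply (h : PairwiseIndependent F) {u u' : U}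
    (hu : u ≠ u') : uniformProb F (fun f => f u = f u') = 1 / (Fintype.card V : ℝ) := by
  obtain ⟨f, hf⟩ := h.1
  have hV : (0 : ℝ) < Fintype.card V := by exact_mod_cast Fintype.card_pos_iff.2 ⟨f u⟩
  have e : ∀ v, uniformProb F (fun f => f u = f u' ∧ f u' = v) = 1 / (Fintype.card V : ℝ) ^ 2 := by
    intro v
    rw [← h.2 u u' hu v v]
    exact le_antisymm (uniformProb_mono fun f _ hf => ⟨hf.1.trans hf.2, hf.2⟩)
      (uniformProb_mono fun f _ hf => ⟨hf.1.trans hf.2.symm, hf.2⟩)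
  rw [uniformProb_eq_sum F _ fun f => f u']
  simp only [e]
  rw [Finset.sum_const, Finset.card_univ, nsmul_eq_mul]
  field_simp

end Probability

/-! ### Strategies -/

section Strategy

variable {S : Type*} {n : ℕ}

/-- The pairs that have to be avoided on a level are a function of what is known when they are named. -/
lemma Adaptive.exists_strategy {c m : ℕ} {Φ : List (LevelHash S n) → Prop} (h : Adaptive c m Φ) :
    ∃ β : List (LevelHash S n) → (Gam S n × Gam S n → Comp n) → List (Gam S n × Gam S n),
      (∀ pre C, (β pre C).length ≤ c) ∧ ∀ l, l.length = m →
        (∀ pre C H rest, l = pre ++ (C, H) :: rest → ∀ p ∈ β pre C, H p ≠ 0) → Φ l := by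
  classical
  induction m generalizing Φ with
  | zero =>
    refine ⟨fun _ _ => [], by simp, fun l hl _ => ?_⟩
    rw [List.length_eq_zero_iff.1 hl]
    exact h
  | succ m ih =>
    choose bad hb h using h
    choose β hβ h using fun C H hH => ih (h C H hH)
    refine ⟨fun pre C => match pre with
      | [] => bad C
      | (C₁, H₁) :: pre => if hH : ∀ p ∈ bad C₁, H₁ p ≠ 0 then β C₁ H₁ hH pre C else [], ?_, ?_⟩
    · rintro (_ | ⟨⟨C₁, H₁⟩, pre⟩) C
      · exact hb C
      · dsimp only
        split_ifs
        · exact hβ ..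
        · simp
    · rintro (_ | ⟨⟨C, H⟩, l⟩) hl hav
      · simp at hl
      · have hH : ∀ p ∈ bad C, H p ≠ 0 := hav [] C H l rfl
        refine h C H hH l (by simpa using hl) ?_
        rintro pre C' H' rest rfl p hp
        refine hav ((C, H) :: pre) C' H' rest rfl p ?_
        dsimp only
        rwa [dif_pos hH]

end Strategy

/-! ### Failure probabilities -/

section Failure

variable {S : Type*} [Fintype S] {n k : ℕ}

/-- The functions on the levels after that of the input. -/
noncomputable def levels (ω : Choices S n k) : List (LevelHash S n) :=
  List.ofFn fun ℓ : Fin (depth n) =>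
    ((fun p => (ℓ, ω.1 ℓ p) : Gam S n × Gam S n → Comp n), iteratedHash (ω.2 ℓ.succ))

@[simp] lemma length_levels (ω : Choices S n k) : (levels ω).length = depth n := by simp [levels]

lemma levels_eq_append {ω : Choices S n k} {pre rest : List (LevelHash S n)}
    {C : Gam S n × Gam S n → Comp n} {H : Gam S n × Gam S n → ℕ}
    (h : levels ω = pre ++ (C, H) :: rest) : ∃ ℓ : Fin (depth n), pre = (levels ω).take ℓ ∧
      C = (fun p => (ℓ, ω.1 ℓ p)) ∧ H = iteratedHash (ω.2 ℓ.succ) := by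
  have hl := congrArg List.length h
  rw [length_levels, List.length_append, List.length_cons] at hl
  have hlt : pre.length < depth n := by omega
  refine ⟨⟨pre.length, hlt⟩, by rw [h]; simp, ?_⟩
  have hget : (levels ω)[pre.length]? = some (C, H) := by rw [h]; simp
  rw [levels, List.getElem?_ofFn, dif_pos hlt] at hget
  simp only [Option.some.injEq, Prod.mk.injEq] at hget
  exact ⟨hget.1.symm, hget.2.symm⟩

lemma take_levels_congr {ω ω' : Choices S n k} (ℓ : ℕ)
    (h : ∀ i : Fin (depth n), (i : ℕ) < ℓ → ω.1 i = ω'.1 i ∧ ω.2 i.succ = ω'.2 i.succ) :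
    (levels ω).take ℓ = (levels ω').take ℓ := by
  refine List.ext_getElem (by simp) fun i h1 h2 => ?_
  simp only [List.length_take, length_levels, lt_min_iff] at h1
  obtain ⟨e1, e2⟩ := h ⟨i, h1.2⟩ h1.1
  simp only [levels, List.getElem_take, List.getElem_ofFn, e1, e2]

/-- There are at least two compression symbols, since there are at least three levels. -/
instance : Nontrivial (Gam S (n + 1) × Gam S (n + 1)) := by
  have hd : 2 ≤ depth (n + 1) := by unfold depth; omega
  have : Nontrivial (Fin (depth (n + 1))) := Fin.nontrivial_iff_two_le.2 hd
  obtain ⟨i, j, hij⟩ := exists_pair_ne (Fin (depth (n + 1)))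
  have h0 : 0 < (n + 1) ^ 4 := by positivity
  exact ⟨(compSym (i, ⟨0, h0⟩), compSym (i, ⟨0, h0⟩)), (compSym (j, ⟨0, h0⟩), compSym (j, ⟨0, h0⟩)),
    by simpa using hij⟩

variable {famC : Fin (depth n) → Finset (Gam S n × Gam S n → Fin (n ^ 4))}
  {famH : Fin (depth n + 1) → Fin (iterNum n) →
    Finset (Gam S n × Gam S n → Fin (iterNum n * splitParam S n k))}

lemma mem_allChoices {ω : Choices S n k} : ω ∈ allChoices famC famH ↔
    (∀ ℓ, ω.1 ℓ ∈ famC ℓ) ∧ ∀ ℓ i, ω.2 ℓ i ∈ famH ℓ i := by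
  simp [allChoices]

lemma allChoices_nonempty (hC : ∀ ℓ, PairwiseIndependent (famC ℓ))
    (hH : ∀ ℓ i, PairwiseIndependent (famH ℓ i)) : (allChoices famC famH).Nonempty := by
  choose f hf using fun ℓ => (hC ℓ).1
  choose g hg using fun ℓ i => (hH ℓ i).1
  exact ⟨(f, g), mem_allChoices.2 ⟨hf, hg⟩⟩

/-- The splitting functions violate with small probability constraints that do not depend on the
functions on the same level. -/
lemma uniformProb_split_le (hn : 1 ≤ n) (hC : ∀ ℓ, PairwiseIndependent (famC ℓ))
    (hH : ∀ ℓ i, PairwiseIndependent (famH ℓ i)) (ℓ : Fin (depth n + 1)) {c : ℕ}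
    (bad : Choices S n k → List (Gam S n × Gam S n)) (hbad : ∀ ω, (bad ω).length ≤ c)
    (hind : ∀ ω g, bad (ω.1, Function.update ω.2 ℓ g) = bad ω) :
    uniformProb (allChoices famC famH) (fun ω => ∃ p ∈ bad ω, iteratedHash (ω.2 ℓ) p = 0) ≤
      c / splitParam S n k := by
  obtain ⟨n, rfl⟩ := Nat.exists_eq_add_of_le' hn
  have step : ∀ i, uniformProb (allChoices famC famH) (fun ω => ∃ p ∈ bad ω, (ω.2 ℓ i p : ℕ) = 0) ≤
      c * (1 / (iterNum (n + 1) * splitParam S (n + 1) k : ℕ)) := by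
    intro i
    refine uniformProb_le_of_resample (allChoices_nonempty hC hH) (hH ℓ i).1 (fun ω => ω.2 ℓ i)
      (fun ω h => (ω.1, Function.update ω.2 ℓ (Function.update (ω.2 ℓ) i h)))
      (fun ω hω => (mem_allChoices.1 hω).2 ℓ i) ?_ (by simp) (by simp) (by simp)
      (fun ω h => ∃ p ∈ bad ω, (h p : ℕ) = 0) (fun ω h h' => by rw [hind]) ?_
    · intro ω hω h hh
      rw [mem_allChoices] at hω ⊢
      refine ⟨hω.1, fun ℓ' i' => ?_⟩
      by_cases h1 : ℓ' = ℓ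
      · subst h1
        by_cases h2 : i' = i
        · subst h2
          simpa using hh
        · simpa [h2] using hω.2 ℓ' i'
      · simpa [h1] using hω.2 ℓ' i'
    · intro ω _
      have hv : ∀ p, uniformProb (famH ℓ i) (fun h => (h p : ℕ) = 0) ≤
          1 / (iterNum (n + 1) * splitParam S (n + 1) k : ℕ) := by
        intro p
        have hpos : 0 < iterNum (n + 1) * splitParam S (n + 1) k := by
          obtain ⟨f, -⟩ := (hH ℓ i).1
          exact (f p).pos
        have := (hH ℓ i).uniformProb_apply_eq p ⟨0, hpos⟩
        rw [Fintype.card_fin] at this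
        rw [← this]
        exact uniformProb_mono fun h _ h0 => Fin.ext h0
      refine (uniformProb_exists_mem_list_le _ _ _ fun p _ => hv p).trans ?_
      gcongr
      exact hbad ω
  -- Without any hash functions, that is for `n = 1`, the quotient of the two equal numbers is `0 / 0 = 0`.
  have hm : (iterNum (n + 1) : ℝ) * (c * (1 / (iterNum (n + 1) * splitParam S (n + 1) k : ℕ))) ≤
      c / splitParam S (n + 1) k := by
    rw [show (iterNum (n + 1) : ℝ) * (c * (1 / (iterNum (n + 1) * splitParam S (n + 1) k : ℕ))) =
      iterNum (n + 1) / iterNum (n + 1) * (c / splitParam S (n + 1) k) by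
        push_cast
        rw [one_div, mul_inv, div_eq_mul_inv, div_eq_mul_inv]
        ring]
    exact mul_le_of_le_one_left (by positivity) (div_self_le_one _)
  refine (uniformProb_mono fun ω _ => ?_).trans ((uniformProb_exists_fin_le _ _ step).trans hm)
  rintro ⟨p, hp, h0⟩
  rw [iteratedHash] at h0
  split_ifs at h0 with h
  obtain ⟨i, -, hi⟩ := Finset.prod_eq_zero_iff.1 h
  exact ⟨i, p, hp, hi⟩

/-- A property that can be enforced adaptively fails with small probability. -/
lemma uniformProb_not_adaptive_le (hn : 1 ≤ n) (hC : ∀ ℓ, PairwiseIndependent (famC ℓ))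
    (hH : ∀ ℓ i, PairwiseIndependent (famH ℓ i)) {c : ℕ}
    {Φ : (Gam S n × Gam S n → ℕ) → List (LevelHash S n) → Prop}
    (h : AdaptiveFrom c (depth n) Φ) :
    uniformProb (allChoices famC famH) (fun ω => ¬ Φ (iteratedHash (ω.2 0)) (levels ω)) ≤
      (depth n + 1) * (c / splitParam S n k) := by
  classical
  obtain ⟨bad, hb, h⟩ := h
  choose β hβ h using fun H hH => (h H hH).exists_strategy
  let badAt : Fin (depth n + 1) → Choices S n k → List (Gam S n × Gam S n) := fun ℓ ω =>
    Fin.cases bad (fun ℓ => if hH : ∀ p ∈ bad, iteratedHash (ω.2 0) p ≠ 0 then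
      β (iteratedHash (ω.2 0)) hH ((levels ω).take ℓ) (fun p => (ℓ, ω.1 ℓ p)) else []) ℓ
  have step : ∀ ℓ, uniformProb (allChoices famC famH)
      (fun ω => ∃ p ∈ badAt ℓ ω, iteratedHash (ω.2 ℓ) p = 0) ≤ c / splitParam S n k := by
    intro ℓ
    refine uniformProb_split_le hn hC hH ℓ (badAt ℓ) ?_ ?_
    · intro ω
      induction ℓ using Fin.cases with
      | zero => exact hb
      | succ ℓ =>
        simp only [badAt, Fin.cases_succ]
        split_ifs
        · exact hβ ..
        · simp
    · intro ω g
      induction ℓ using Fin.cases with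
      | zero => rfl
      | succ ℓ =>
        have e0 : Function.update ω.2 ℓ.succ g 0 = ω.2 0 :=
          Function.update_of_ne (Fin.succ_ne_zero ℓ).symm _ _
        have e1 : (levels (ω.1, Function.update ω.2 ℓ.succ g)).take ℓ = (levels ω).take ℓ := by
          refine take_levels_congr ℓ fun i hi => ⟨rfl, ?_⟩
          refine Function.update_of_ne (fun e => ?_) _ _
          rw [Fin.succ_injective _ e] at hi
          exact lt_irrefl _ hi
        simp only [badAt, Fin.cases_succ, e0, e1]
  have := uniformProb_exists_fin_le _ _ step
  push_cast at this
  refine (uniformProb_mono fun ω _ hω => ?_).trans this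
  by_contra! hav
  have hH0 : ∀ p ∈ bad, iteratedHash (ω.2 0) p ≠ 0 := hav 0
  refine hω (h _ hH0 (levels ω) (length_levels ω) ?_)
  intro pre C H rest e p hp
  obtain ⟨ℓ, rfl, rfl, rfl⟩ := levels_eq_append e
  refine hav ℓ.succ p ?_
  simp only [badAt, Fin.cases_succ, dif_pos hH0]
  exact hp

variable [DecidableEq S]

/-- Collisions are rare: on each level there are at most `(n - 1) (n - 2) / 2` pairs of pairs in common
blocks, and they do not depend on the compression function of that level. -/
lemma uniformProb_collision_le {R : ℕ} {F : List (Gam S n) → List ℕ} (hF : IsLocalColoring R F)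
    (hC : ∀ ℓ, PairwiseIndependent (famC ℓ)) (hH : ∀ ℓ i, PairwiseIndependent (famH ℓ i))
    (x : List S) (hx : x.length ≤ n) :
    uniformProb (allChoices famC famH) (fun ω => ¬ ∀ B ∈ split (iteratedHash (ω.2 0)) (x.map letter),
      CollisionFree F (levels ω) B) ≤
        depth n * (((n - 1) * (n - 2) : ℕ) / 2 * (1 / (n : ℝ) ^ 4)) := by
  let coll : Fin (depth n) → Choices S n k → List ((Gam S n × Gam S n) × (Gam S n × Gam S n)) :=
    fun ℓ ω => (split (iteratedHash (ω.2 0)) (x.map letter)).flatMap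
      (collisionPairs F ((levels ω).take ℓ))
  have hlen : ∀ ℓ ω, ((coll ℓ ω).length : ℝ) ≤ ((n - 1) * (n - 2) : ℕ) / 2 := by
    intro ℓ ω
    have h1 := two_mul_length_flatMap_le _ (two_mul_length_collisionPairs_le hF ((levels ω).take ℓ))
      (split (iteratedHash (ω.2 0)) (x.map letter))
    rw [flatten_split, List.length_map] at h1
    have h2 : 2 * (coll ℓ ω).length ≤ (n - 1) * (n - 2) := h1.trans (by gcongr)
    have h3 : (2 * (coll ℓ ω).length : ℝ) ≤ ((n - 1) * (n - 2) : ℕ) := by exact_mod_cast h2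
    linarith
  have step : ∀ ℓ, uniformProb (allChoices famC famH) (fun ω => ∃ e ∈ coll ℓ ω,
      e.1 ≠ e.2 ∧ ω.1 ℓ e.1 = ω.1 ℓ e.2) ≤ ((n - 1) * (n - 2) : ℕ) / 2 * (1 / (n : ℝ) ^ 4) := by
    intro ℓ
    refine uniformProb_le_of_resample (allChoices_nonempty hC hH) (hC ℓ).1 (fun ω => ω.1 ℓ)
      (fun ω h => (Function.update ω.1 ℓ h, ω.2)) (fun ω hω => (mem_allChoices.1 hω).1 ℓ) ?_ (by simp)
      (by simp) (by simp) (fun ω h => ∃ e ∈ coll ℓ ω, e.1 ≠ e.2 ∧ h e.1 = h e.2) ?_ ?_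
    · intro ω hω h hh
      rw [mem_allChoices] at hω ⊢
      refine ⟨fun ℓ' => ?_, hω.2⟩
      by_cases h1 : ℓ' = ℓ
      · subst h1
        simpa using hh
      · simpa [h1] using hω.1 ℓ'
    · intro ω h h'
      have e1 : (levels (Function.update ω.1 ℓ h, ω.2)).take ℓ = (levels ω).take ℓ := by
        refine take_levels_congr ℓ fun i hi => ⟨?_, rfl⟩
        refine Function.update_of_ne (fun e => ?_) _ _
        rw [e] at hi
        exact lt_irrefl _ hi
      simp only [coll, e1]
    · intro ω _
      refine (uniformProb_exists_mem_list_le _ _ _ (q := 1 / (n : ℝ) ^ 4) fun e _ => ?_).trans ?_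
      · by_cases he : e.1 = e.2
        · simp only [he, ne_eq, not_true_eq_false, false_and, uniformProb_false]
          positivity
        · have := (hC ℓ).uniformProb_apply_eq_apply he
          rw [Fintype.card_fin] at this
          push_cast at this
          rw [← this]
          exact uniformProb_mono fun h _ hh => hh.2
      · gcongr
        exact hlen ℓ ω
  refine (uniformProb_mono fun ω _ hω => ?_).trans (uniformProb_exists_fin_le _ _ step)
  by_contra! hav
  refine hω fun B hB => collisionFree_of_collisionPairs ?_
  intro pre C H rest e p hp hne hcol
  obtain ⟨ℓ, rfl, rfl, rfl⟩ := levels_eq_append e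
  exact hav ℓ p (List.mem_flatMap.2 ⟨B, hB, hp⟩) hne (Prod.ext_iff.1 hcol).2

end Failure

/-! ### From aligned blocks to aligned grammars -/

section Conclusion

variable {S : Type*} {n k : ℕ}

/-- The edit distance of the parts behind the borders is at most the sum over the blocks by subadditivity, hence
equal to it. -/
lemma aligned_of_closeBehind {x y u v : List S} {Gx Gy : List (Gramm S n)}
    {Bx By : List (List (Ann S n S))} (h : CloseBehind (editDist x y) Bx By u v)
    (hx : flat Bx.flatten = u ++ x) (hy : flat By.flatten = v ++ y)
    (hGx : List.Forall₂ IsEval Gx (Bx.map flat)) (hGy : List.Forall₂ IsEval Gy (By.map flat)) :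
    Aligned x y Gx Gy := by
  obtain ⟨As, w, E, z, Cs, As', w', E', z', Cs', b, b', hlen, hd⟩ := h
  have lx := hGx.length_eq
  have ly := hGy.length_eq
  rw [b.eq] at lx
  rw [b'.eq] at ly
  simp only [List.length_map, List.length_append, List.length_cons] at lx ly
  have ex := b.flat_eq hx
  have ey := b'.flat_eq hy
  have sx : suffixFrom (flat E) (w.length + 1) = z := by rw [suffixFrom, b.block]; simp
  have sy : suffixFrom (flat E') (w'.length + 1) = z' := by rw [suffixFrom, b'.block]; simp
  refine ⟨w.length + 1, w'.length + 1, As.length + 1, As'.length + 1, by omega, by omega, by omega,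
    by omega, by omega, by omega, by rw [lx, ly, hlen]; push_cast; ring, flat E, flat E',
    Cs.map flat, Cs'.map flat, ?_, ?_, by rw [sx, ex], by rw [sy, ey], ?_⟩
  · have := List.forall₂_drop As.length hGx
    rw [b.eq] at this
    simpa using this
  · have := List.forall₂_drop As'.length hGy
    rw [b'.eq] at this
    simpa using this
  · rw [sx, sy]
    refine le_antisymm ?_ hd
    rw [ex, ey]
    exact (editDist_append_le ..).trans (Nat.add_le_add_left
      (editDist_flatten_le _ _ (by rw [List.length_map, List.length_map, hlen])) _)

variable [Fintype S] [DecidableEq S]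

lemma forall₂_isEval_decompose {R : ℕ} {F : List (Gam S n) → List ℕ} (hF : IsLocalColoring R F)
    (ω : Choices S n k) (x : List S) (hx : x.length ≤ n)
    (h : ∀ B ∈ split (iteratedHash (ω.2 0)) (x.map letter), CollisionFree F (levels ω) B) :
    List.Forall₂ IsEval (decompose F ω x)
      ((annDecompose F (iteratedHash (ω.2 0)) (levels ω) x).map flat) := by
  have hs := annSplit_map_syms (iteratedHash (ω.2 0)) (annLetters n x)
  rw [syms_annLetters] at hs
  rw [decompose, ← hs, List.flatMap_map, annDecompose, List.map_flatMap]
  refine forall₂_flatMap _ _ _ fun B hB => forall₂_isEval_process hF (levels ω) B [] ?_ ?_ ?_ ?_ ?_ ?_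
  · intro i hi p
    simp [levels]
  · intro D hD
    simp at hD
  · intro D hD
    simp at hD
  · intro q hq
    have hq' : q ∈ annLetters n x := by
      rw [← flatten_annSplit (iteratedHash (ω.2 0)) (annLetters n x)]
      exact List.mem_flatten.2 ⟨B, hB, hq⟩
    obtain ⟨a, -, rfl⟩ := List.mem_map.1 hq'
    exact ⟨a, rfl, rfl⟩
  · refine (flat_length_le_of_mem hB).trans ?_
    rwa [flatten_annSplit, flat_annLetters]
  · refine h _ ?_
    rw [← hs]
    exact List.mem_map_of_mem hB

lemma uniformProb_not_aligned_le {R : ℕ} {F : List (Gam S n) → List ℕ} (hF : IsLocalColoring R F)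
    (hn : 1 ≤ n) {famC : Fin (depth n) → Finset (Gam S n × Gam S n → Fin (n ^ 4))}
    {famH : Fin (depth n + 1) → Fin (iterNum n) →
      Finset (Gam S n × Gam S n → Fin (iterNum n * splitParam S n k))}
    (hC : ∀ ℓ, PairwiseIndependent (famC ℓ)) (hH : ∀ ℓ i, PairwiseIndependent (famH ℓ i))
    {u v x y : List S} (hx : (u ++ x).length ≤ n) (hy : (v ++ y).length ≤ n) {c : ℕ}
    (h : AdaptiveFrom c (depth n) fun H l =>
      CloseBehind (editDist x y) (annDecompose F H l (u ++ x)) (annDecompose F H l (v ++ y)) u v) :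
    uniformProb (allChoices famC famH)
        (fun ω => ¬ Aligned x y (decompose F ω (u ++ x)) (decompose F ω (v ++ y))) ≤
      (depth n + 1) * (c / splitParam S n k) +
        depth n * (((n - 1) * (n - 2) : ℕ) * (1 / (n : ℝ) ^ 4)) := by
  have h1 := uniformProb_not_adaptive_le hn hC hH h
  have h2 := uniformProb_collision_le hF hC hH (u ++ x) hx
  have h3 := uniformProb_collision_le hF hC hH (v ++ y) hy
  have h4 := uniformProb_mono (A := allChoices famC famH) (P := fun ω =>
    ¬ Aligned x y (decompose F ω (u ++ x)) (decompose F ω (v ++ y))) (Q := fun ω =>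
      (¬ CloseBehind (editDist x y)
        (annDecompose F (iteratedHash (ω.2 0)) (levels ω) (u ++ x))
        (annDecompose F (iteratedHash (ω.2 0)) (levels ω) (v ++ y)) u v) ∨
      (¬ ∀ B ∈ split (iteratedHash (ω.2 0)) ((u ++ x).map letter), CollisionFree F (levels ω) B) ∨
      ¬ ∀ B ∈ split (iteratedHash (ω.2 0)) ((v ++ y).map letter), CollisionFree F (levels ω) B)
    fun ω _ hω => by
      by_contra hcon
      rw [not_or, not_or, not_not, not_not, not_not] at hcon
      obtain ⟨g1, g2, g3⟩ := hcon
      exact hω (aligned_of_closeBehind g1 (flat_annDecompose hF ..) (flat_annDecompose hF ..)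
        (forall₂_isEval_decompose hF ω _ hx g2) (forall₂_isEval_decompose hF ω _ hy g3))
  refine h4.trans ((uniformProb_or_le _ _ _).trans (add_le_add h1
    ((uniformProb_or_le _ _ _).trans ((add_le_add h2 h3).trans (le_of_eq ?_)))))
  ring

end Conclusion

/-! ### Numerical estimates -/

lemma depth_le {n : ℕ} (hn : 1 ≤ n) : depth n ≤ n + 3 := by
  have key : ∀ n : ℕ, (n : ℝ) ≤ (3 / 2) ^ n := by
    intro n
    rcases n with _ | _ | n
    · norm_num
    · norm_num
    · induction n with
      | zero => norm_num
      | succ n ih =>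
        rw [pow_succ]
        push_cast at ih ⊢
        have : (0 : ℝ) ≤ n := Nat.cast_nonneg n
        linarith
  have hlog : Real.logb (3 / 2) n ≤ n := by
    rw [Real.logb_le_iff_le_rpow (by norm_num) (by exact_mod_cast hn), Real.rpow_natCast]
    exact key n
  have := Nat.ceil_le.2 hlog
  unfold depth
  omega

/-- Two bounds for the probability of a collision in one of two strings of length at most `n`; the first one is the
better one for small `n` only. -/
lemma collision_bound {n : ℕ} (hn : 1 ≤ n) :
    (depth n : ℝ) * (((n - 1) * (n - 2) : ℕ) * (1 / (n : ℝ) ^ 4)) ≤ 1 / 6 ∧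
      (depth n : ℝ) * (((n - 1) * (n - 2) : ℕ) * (1 / (n : ℝ) ^ 4)) ≤ 1 / n := by
  have hn' : (0 : ℝ) < n := by exact_mod_cast hn
  have hd : depth n * ((n - 1) * (n - 2)) ≤ (n + 3) * ((n - 1) * (n - 2)) :=
    Nat.mul_le_mul_right _ (depth_le hn)
  have e : (depth n : ℝ) * (((n - 1) * (n - 2) : ℕ) * (1 / (n : ℝ) ^ 4)) =
      (depth n * ((n - 1) * (n - 2)) : ℕ) / (n : ℝ) ^ 4 := by
    push_cast
    ring
  rw [e]
  have h3 : (n + 3) * ((n - 1) * (n - 2)) ≤ n ^ 3 := by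
    rcases n with _ | _ | n
    · simp
    · simp
    · simp only [show n + 1 + 1 - 1 = n + 1 by omega, show n + 1 + 1 - 2 = n by omega]
      nlinarith [Nat.zero_le n]
  have h4 : 6 * ((n + 3) * ((n - 1) * (n - 2))) ≤ n ^ 4 := by
    rcases le_or_gt 6 n with h6 | h6
    · calc 6 * ((n + 3) * ((n - 1) * (n - 2))) ≤ n * n ^ 3 := Nat.mul_le_mul h6 h3
        _ = n ^ 4 := by ring
    · interval_cases n <;> norm_num
  constructor
  · rw [div_le_div_iff₀ (by positivity) (by norm_num)]
    have : depth n * ((n - 1) * (n - 2)) * 6 ≤ 1 * n ^ 4 := by omega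
    exact_mod_cast this
  · rw [div_le_div_iff₀ (by positivity) hn']
    have : depth n * ((n - 1) * (n - 2)) * n ≤ 1 * n ^ 4 := by
      calc depth n * ((n - 1) * (n - 2)) * n ≤ n ^ 3 * n := Nat.mul_le_mul_right _ (hd.trans h3)
        _ = 1 * n ^ 4 := by ring
    exact_mod_cast this

/-- The probability that one of `c` constraints on each of the levels is violated, by the choice of `splitParam`. -/
lemma split_bound (S : Type*) [Fintype S] {n k c : ℕ} (hk : 1 ≤ k) {q : ℝ}
    (hc : (c : ℝ) ≤ q * (110 * radius S n * k)) :
    (depth n + 1 : ℝ) * (c / splitParam S n k) ≤ q := by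
  have hR : (0 : ℝ) < radius S n := by
    have : 0 < radius S n := by unfold radius; omega
    exact_mod_cast this
  have hk' : (0 : ℝ) < k := by exact_mod_cast hk
  have hd : (0 : ℝ) < depth n + 1 := by positivity
  unfold splitParam
  push_cast
  rw [← mul_div_assoc, div_le_iff₀ (by positivity)]
  calc (depth n + 1 : ℝ) * c ≤ (depth n + 1) * (q * (110 * radius S n * k)) := by gcongr
    _ = _ := by ring

end EDDecomp

theorem mainTheorem4 {S : Type*} [Fintype S] [DecidableEq S] (n k : ℕ) (hk : 1 ≤ k) (hkn : k ≤ n)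
    (hS : Fintype.card S ≤ n ^ 3) :
    (∃ F : List (EDDecomp.Gam S n) → List ℕ,
      EDDecomp.IsLocalColoring (EDDecomp.radius S n) F) ∧
    ∀ F : List (EDDecomp.Gam S n) → List ℕ,
      EDDecomp.IsLocalColoring (EDDecomp.radius S n) F →
    ∀ (famC : Fin (EDDecomp.depth n) →
        Finset (EDDecomp.Gam S n × EDDecomp.Gam S n → Fin (n ^ 4)))
      (famH : Fin (EDDecomp.depth n + 1) → Fin (EDDecomp.iterNum n) →
        Finset (EDDecomp.Gam S n × EDDecomp.Gam S n →
          Fin (EDDecomp.iterNum n * EDDecomp.splitParam S n k))),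
      (∀ ℓ, EDDecomp.PairwiseIndependent (famC ℓ)) →
      (∀ ℓ i, EDDecomp.PairwiseIndependent (famH ℓ i)) →
    ∀ u v x y : List S, (u ++ x).length ≤ n → (v ++ y).length ≤ n →
      EDDecomp.editDist x y ≤ k →
      (4 / 5 : ℝ) ≤ EDDecomp.uniformProb (EDDecomp.allChoices famC famH) (fun ω =>
        EDDecomp.Aligned x y (EDDecomp.decompose F ω (u ++ x))
          (EDDecomp.decompose F ω (v ++ y))) := by
  refine ⟨EDDecomp.exists_isLocalColoring S n, ?_⟩
  intro F hF famC famH hC hH u v x y hx hy hxy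
  have hn : 1 ≤ n := hk.trans hkn
  obtain ⟨hcol, hcol'⟩ := EDDecomp.collision_bound hn
  have hR : (20 : ℝ) ≤ EDDecomp.radius S n := by
    have : 20 ≤ EDDecomp.radius S n := by unfold EDDecomp.radius; omega
    exact_mod_cast this
  have hk' : (1 : ℝ) ≤ k := by exact_mod_cast hk
  have hRk : (20 : ℝ) * 1 ≤ EDDecomp.radius S n * k := mul_le_mul hR hk' (by norm_num) (by linarith)
  have hA := EDDecomp.allChoices_nonempty hC hH
  rw [show (4 / 5 : ℝ) = 1 - 1 / 5 by norm_num]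
  refine EDDecomp.one_sub_le_uniformProb hA (Q := fun ω => ¬ EDDecomp.Aligned x y
    (EDDecomp.decompose F ω (u ++ x)) (EDDecomp.decompose F ω (v ++ y))) ?_ fun ω _ => not_not.1
  -- For short strings the bound for the collisions is poor, but splitting can be excluded altogether.
  rcases le_or_gt n 25 with h25 | h25
  · have h := EDDecomp.uniformProb_not_aligned_le hF hn hC hH hx hy
      (EDDecomp.adaptive_closeBehind_of_length_le hF (EDDecomp.depth n) (c := 25) (by norm_num) u v x y
        (hx.trans h25) (hy.trans h25))
    have hs := EDDecomp.split_bound S (n := n) (k := k) (c := 25 + 25) (q := 1 / 30) hk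
      (by push_cast; linarith)
    linarith
  · have h := EDDecomp.uniformProb_not_aligned_le hF hn hC hH hx hy
      (EDDecomp.adaptive_closeBehind hF (EDDecomp.depth n) u v x y hxy)
    have hs := EDDecomp.split_bound S (n := n) (k := k)
      (c := (8 * EDDecomp.radius S n + 46) * k + (4 * EDDecomp.radius S n + 36)) (q := 17 / 110) hk
      (by push_cast; nlinarith)
    have hn' : (1 : ℝ) / n ≤ 1 / 26 := by
      have : (26 : ℝ) ≤ n := by exact_mod_cast h25
      gcongr
    linarith
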